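/- Let $k$ be an algebraically closed field and let $\mathcal T$ be a $k$-linear triangulated category with suspension $S$ and finite-dimensional morphism spaces. Suppose that $\mathcal T$ is Krull–Schmidt (every object is a finite direct sum of indecomposable objects, and indecomposable objects have local endomorphism rings) and locally finite (for each indecomposable $X$ there are, up to isomorphism, only finitely many indecomposables $Y$ with $\mathrm{Hom}_{\mathcal T}(X,Y)\neq 0$). A stable translation quiver is a locally finite quiver without double arrows with a bijection $\tau$ of its vertices such that $(\tau x)^+=x^-$ for each vertex $x$, where $x^+$ and $x^-$ are the sets of direct successors and predecessors of $x$; it is valued if each arrow $x\to y$ carries a positive integer $a_{xy}$ and $a_{\tau y\,x}=a_{xy}$. The Auslander–Reiten quiver of $\mathcal T$ has as vertices the isomorphism classes of indecomposable objects; there is an arrow $[X]\to[Y]$ if $\mathcal R(X,Y)/\mathcal R^2(X,Y)\neq0$, with value $a_{[X][Y]}=\dim_k\mathcal R(X,Y)/\mathcal R^2(X,Y)$, where $\mathcal R$ is the radical of $\mathrm{Hom}_{\mathcal T}$; and $\tau[Z]=[X]$ if and only if there is an Auslander–Reiten triangle $X\to Y\to Z\to SX$. This is a well-defined valued translation quiver.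 Its connected components are the classes of the equivalence relation on vertices generated by $x\sim y$ for each arrow $x\to y$ and by $x\sim\tau x$. For an oriented tree $\Delta$, the repetition $\mathbb Z\Delta$ has vertices $\mathbb Z\times\Delta_0$, arrows $(n,x)\to(n,y)$ and $(n-1,y)\to(n,x)$ for each arrow $x\to y$ of $\Delta$ and each $n\in\mathbb Z$, and translation $\tau(n,x)=(n-1,x)$. Write $\mathrm{Aut}(\mathbb Z\Delta)$ for its group of automorphisms commuting with $\tau$. A subgroup $G$ of $\mathrm{Aut}(\mathbb Z\Delta)$ is weakly admissible if $x^+\cap(gx)^+=\emptyset$ for all $g\in G\setminus\{1\}$ and all vertices $x$ (the trivial group is allowed). All arrows of $\mathbb Z\Delta$ and of the orbit quiver $\mathbb Z\Delta/G$ have value $1$. Let $\Gamma$ be a connected component of the Auslander–Reiten quiver of $\mathcal T$. Then there exist an oriented Dynkin tree $\Delta$ of type $A_n$ ($n\ge1$), $D_n$ ($n\ge4$), $E_6$, $E_7$ or $E_8$, a weakly admissible subgroup $G$ of $\mathrm{Aut}(\mathbb Z\Delta)$ and an isomorphism of valued translation quivers $$\theta:\Gamma\xrightarrow{\ \sim\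 }\mathbb Z\Delta/G .$$ The underlying graph of $\Delta$ is unique up to isomorphism and $G$ is unique up to conjugacy in $\mathrm{Aut}(\mathbb Z\Delta)$; precisely, if also $\Gamma\simeq\mathbb Z\Delta'/G'$ with $\Delta'$ an oriented Dynkin tree of type $A$, $D$ or $E$ and $G'$ weakly admissible, then the underlying graphs of $\Delta$ and $\Delta'$ are isomorphic and there is an isomorphism of translation quivers $\varphi:\mathbb Z\Delta\to\mathbb Z\Delta'$ with $G'=\varphi G\varphi^{-1}$. If moreover $\Gamma$ has infinitely many vertices (in particular, if the Auslander–Reiten quiver of $\mathcal T$ is connected and $\mathcal T$ has infinitely many isomorphism classes of indecomposable objects), then $G$ is trivial and $\Gamma$ is isomorphic to the repetition quiver $\mathbb Z\Delta$. -/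

import Mathlib

open CategoryTheory Limits Pretriangulated

universe w u v

/-! ### Stable and valued translation quivers -/

/-- A stable translation quiver with vertex set `V`: a locally finite quiver without double arrows
(so that the arrows are a relation on the vertices; loops are allowed), together with a bijection
`τ` of the vertices such that `(τ x)⁺ = x⁻` for every vertex `x`. -/
structure StableTranslationQuiver (V : Type u) where
  /-- there is an arrow from `x` to `y` -/
  Arrow : V → V → Prop
  /-- the translation -/
  τ : Equiv.Perm V
  finite_succ : ∀ x, {y | Arrow x y}.Finite
  finite_pred : ∀ x, {y | Arrow y x}.Finite
  arrow_τ : ∀ x y, Arrow (τ x) y ↔ Arrow y x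

/-- A valued translation quiver: every arrow `x → y` carries a positive integer `a x y`, and the
arrow `σ α : τ y → x` has the same value as `α : x → y`. We put `a x y = 0` if there is no arrow
from `x` to `y`. -/
structure ValuedTranslationQuiver (V : Type u) extends StableTranslationQuiver V where
  /-- the valuation `a_{xy}` -/
  a : V → V → ℕ
  a_pos_iff : ∀ x y, 0 < a x y ↔ Arrow x y
  a_σ : ∀ x y, a (τ y) x = a x y

namespace StableTranslationQuiver

variable {V : Type u}

/-- The set `x⁺` of direct successors of `x`. -/
def succ (Q : StableTranslationQuiver V) (x : V) : Set V := {y | Q.Arrow x y}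

/-- Isomorphisms of stable translation quivers. -/
structure Iso {W : Type v} (P : StableTranslationQuiver V) (Q : StableTranslationQuiver W)
    extends V ≃ W where
  map_arrow : ∀ x y, Q.Arrow (toEquiv x) (toEquiv y) ↔ P.Arrow x y
  map_τ : ∀ x, toEquiv (P.τ x) = Q.τ (toEquiv x)

/-- The group of automorphisms of a stable translation quiver. -/
def aut (Q : StableTranslationQuiver V) : Subgroup (Equiv.Perm V) where
  carrier := {e | (∀ x y, Q.Arrow (e x) (e y) ↔ Q.Arrow x y) ∧ ∀ x, e (Q.τ x) = Q.τ (e x)}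
  mul_mem' := by
    rintro e f ⟨he, he'⟩ ⟨hf, hf'⟩
    exact ⟨fun x y => by simp [he, hf], fun x => by simp [he', hf']⟩
  one_mem' := ⟨fun x y => by simp, fun x => by simp⟩
  inv_mem' := by
    rintro e ⟨he, he'⟩
    refine ⟨fun x y => ?_, fun x => ?_⟩
    · rw [← he]; simp
    · apply e.injective; rw [he']; simp

/-- A group `G` of automorphisms is weakly admissible if `x⁺ ∩ (g x)⁺ = ∅` for all `g ≠ 1` in `G`
and all vertices `x`. -/
def IsWeaklyAdmissible {Q : StableTranslationQuiver V} (G : Subgroup Q.aut) : Prop :=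
  ∀ g ∈ G, g ≠ 1 → ∀ x : V, Q.succ x ∩ Q.succ (g • x) = ∅

theorem exists_smul_of_mk_eq {Q : StableTranslationQuiver V} {G : Subgroup Q.aut} {x y : V}
    (h : (Quotient.mk'' x : MulAction.orbitRel.Quotient G V) = Quotient.mk'' y) :
    ∃ g ∈ Q.aut, g y = x ∧
      ∀ z, (Quotient.mk'' (g z) : MulAction.orbitRel.Quotient G V) = Quotient.mk'' z := by
  obtain ⟨g, hg⟩ := (MulAction.orbitRel_apply).1 (Quotient.eq''.1 h)
  exact ⟨g.1.1, g.1.2, hg, fun z => _root_.Quotient.sound' ((MulAction.orbitRel_apply).2 ⟨g, rfl⟩)⟩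

/-- The orbit quiver `Q/G`: its vertices are the `G`-orbits of vertices of `Q`, there is an arrow
from one orbit to another if there is one between some representatives, and the translation is
induced by the one of `Q`. -/
def orbitQuiver (Q : StableTranslationQuiver V) (G : Subgroup Q.aut) :
    StableTranslationQuiver (MulAction.orbitRel.Quotient G V) where
  Arrow X Y := ∃ x y : V, Quotient.mk'' x = X ∧ Quotient.mk'' y = Y ∧ Q.Arrow x y
  τ := Quotient.congr Q.τ (by
    intro x y
    change x ∈ MulAction.orbit G y ↔ Q.τ x ∈ MulAction.orbit G (Q.τ y)
    have key : ∀ g : G, g • Q.τ y = Q.τ (g • y) := fun g => g.1.2.2 y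
    constructor
    · rintro ⟨g, rfl⟩; exact ⟨g, key g⟩
    · rintro ⟨g, hg⟩; exact ⟨g, Q.τ.injective ((key g).symm.trans hg)⟩)
  finite_succ := by
    intro X
    induction X using Quotient.inductionOn' with | _ x => ?_
    refine ((Q.finite_succ x).image (Quotient.mk'' : V → MulAction.orbitRel.Quotient G V)).subset ?_
    rintro Y ⟨x', y, hx, rfl, h⟩
    obtain ⟨g, hg, rfl, hm⟩ := exists_smul_of_mk_eq hx.symm
    exact ⟨g y, (hg.1 _ _).2 h, hm y⟩
  finite_pred := by
    intro X
    induction X using Quotient.inductionOn' with | _ x => ?_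
    refine ((Q.finite_pred x).image (Quotient.mk'' : V → MulAction.orbitRel.Quotient G V)).subset ?_
    rintro Y ⟨y, x', rfl, hx, h⟩
    obtain ⟨g, hg, rfl, hm⟩ := exists_smul_of_mk_eq hx.symm
    exact ⟨g y, (hg.1 _ _).2 h, hm y⟩
  arrow_τ := by
    intro X Y
    induction X using Quotient.inductionOn' with | _ x => ?_
    constructor
    · rintro ⟨x', y, hx, hy, h⟩
      obtain ⟨g, hg, rfl, hm⟩ := exists_smul_of_mk_eq
        (show (Quotient.mk'' x' : MulAction.orbitRel.Quotient G V) = Quotient.mk'' (Q.τ x) from hx)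
      rw [hg.2, Q.arrow_τ] at h
      exact ⟨y, g x, hy, hm x, h⟩
    · rintro ⟨y, x', hy, hx, h⟩
      obtain ⟨g, hg, rfl, hm⟩ := exists_smul_of_mk_eq hx
      refine ⟨Q.τ (g x), y, ?_, hy, (Q.arrow_τ _ _).2 h⟩
      rw [← hg.2]
      exact hm _

open Classical in
/-- A stable translation quiver, regarded as a valued one in which every arrow has value `1`. -/
noncomputable def toValued (Q : StableTranslationQuiver V) : ValuedTranslationQuiver V where
  toStableTranslationQuiver := Q
  a x y := if Q.Arrow x y then 1 else 0
  a_pos_iff x y := by split_ifs with h <;> simp [h]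
  a_σ x y := by simp [Q.arrow_τ]

end StableTranslationQuiver

namespace ValuedTranslationQuiver

variable {V : Type u}

/-- Isomorphisms of valued translation quivers. -/
structure Iso {W : Type v} (P : ValuedTranslationQuiver V) (Q : ValuedTranslationQuiver W)
    extends StableTranslationQuiver.Iso P.toStableTranslationQuiver Q.toStableTranslationQuiver where
  map_a : ∀ x y, Q.a (toEquiv x) (toEquiv y) = P.a x y

/-- The equivalence relation on the vertices generated by `x ∼ y` for every arrow `x → y` and
`x ∼ τ x`. For a vertex `x` with an arrow `y → x` there is an arrow `τ x → y`, so `x ∼ τ x` adds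
something only at vertices without arrows. -/
def connectedSetoid (Q : ValuedTranslationQuiver V) : Setoid V :=
  Relation.EqvGen.setoid fun x y => Q.Arrow x y ∨ Q.τ x = y

/-- The connected components. -/
def Component (Q : ValuedTranslationQuiver V) : Type u := Quotient Q.connectedSetoid

/-- The vertices of a connected component. -/
def Component.Vertex {Q : ValuedTranslationQuiver V} (c : Q.Component) : Type u :=
  {x : V // Quotient.mk Q.connectedSetoid x = c}

theorem mk_τ (Q : ValuedTranslationQuiver V) (x : V) :
    Quotient.mk Q.connectedSetoid (Q.τ x) = Quotient.mk Q.connectedSetoid x :=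
  (_root_.Quotient.sound (s := Q.connectedSetoid) (a := x) (b := Q.τ x)
    (Relation.EqvGen.rel x (Q.τ x) (Or.inr rfl))).symm

/-- A connected component, as a valued translation quiver. -/
def Component.quiver {Q : ValuedTranslationQuiver V} (c : Q.Component) :
    ValuedTranslationQuiver c.Vertex where
  Arrow x y := Q.Arrow x.1 y.1
  τ := Q.τ.subtypePerm fun x => by rw [mk_τ]
  finite_succ x := (Q.finite_succ x.1).preimage Subtype.val_injective.injOn
  finite_pred x := (Q.finite_pred x.1).preimage Subtype.val_injective.injOn
  arrow_τ x y := Q.arrow_τ x.1 y.1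
  a x y := Q.a x.1 y.1
  a_pos_iff x y := Q.a_pos_iff x.1 y.1
  a_σ x y := Q.a_σ x.1 y.1

end ValuedTranslationQuiver

/-! ### Oriented trees, Dynkin trees and repetition quivers -/

/-- A (locally finite) oriented tree. -/
structure OrientedTree where
  /-- the vertices -/
  V : Type
  /-- there is an arrow from `x` to `y` -/
  Arrow : V → V → Prop
  asymm : ∀ x y, Arrow x y → ¬ Arrow y x
  isTree : (SimpleGraph.fromRel Arrow).IsTree
  finite_succ : ∀ x, {y | Arrow x y}.Finite
  finite_pred : ∀ x, {y | Arrow y x}.Finite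

/-- The Dynkin graph `D_n` on the vertices `0, …, n - 1`: the path `0 — 1 — ⋯ — n-3 — n-2` with an
additional edge `n-3 — n-1`. -/
def dynkinGraphD (n : ℕ) : SimpleGraph (Fin n) :=
  SimpleGraph.fromRel fun i j =>
    (i.val + 1 = j.val ∧ j.val + 1 < n) ∨ (i.val + 3 = n ∧ j.val + 1 = n)

/-- The Dynkin graph `E_n` on the vertices `0, …, n - 1`: the path `0 — 1 — 2 — 4 — 5 — ⋯ — n-1`
with an additional edge `2 — 3`. -/
def dynkinGraphE (n : ℕ) : SimpleGraph (Fin n) :=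
  SimpleGraph.fromRel fun i j =>
    (i.val + 1 = j.val ∧ i.val ≠ 3) ∨ (i.val = 2 ∧ j.val = 4)

namespace OrientedTree

/-- The underlying graph of an oriented tree. -/
def graph (Δ : OrientedTree) : SimpleGraph Δ.V := SimpleGraph.fromRel Δ.Arrow

/-- `Δ` is an oriented Dynkin tree of type `A_n` (`n ≥ 1`), `D_n` (`n ≥ 4`), `E_6`, `E_7` or
`E_8`. -/
def IsDynkin (Δ : OrientedTree) : Prop :=
  (∃ n : ℕ, 1 ≤ n ∧ Nonempty (Δ.graph ≃g SimpleGraph.pathGraph n)) ∨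
  (∃ n : ℕ, 4 ≤ n ∧ Nonempty (Δ.graph ≃g dynkinGraphD n)) ∨
  (∃ n : ℕ, 6 ≤ n ∧ n ≤ 8 ∧ Nonempty (Δ.graph ≃g dynkinGraphE n))

/-- The repetition `ℤΔ`: the vertices are the pairs `(n, x)`, each arrow `x → y` of `Δ` gives
arrows `(n, x) → (n, y)` and `(n - 1, y) → (n, x)` for all `n`, and `τ (n, x) = (n - 1, x)`. -/
def repetition (Δ : OrientedTree) : StableTranslationQuiver (ℤ × Δ.V) where
  Arrow p q := (p.1 = q.1 ∧ Δ.Arrow p.2 q.2) ∨ (p.1 = q.1 - 1 ∧ Δ.Arrow q.2 p.2)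
  τ := (Equiv.subRight (1 : ℤ)).prodCongr (Equiv.refl Δ.V)
  finite_succ p := by
    refine (((Set.finite_singleton p.1).prod (Δ.finite_succ p.2)).union
      ((Set.finite_singleton (p.1 + 1)).prod (Δ.finite_pred p.2))).subset ?_
    rintro ⟨n, y⟩ (⟨h, h'⟩ | ⟨h, h'⟩)
    · exact Or.inl ⟨h.symm, h'⟩
    · refine Or.inr ⟨?_, h'⟩
      simp only [Set.mem_singleton_iff]; simp only at h; omega
  finite_pred p := by
    refine (((Set.finite_singleton p.1).prod (Δ.finite_pred p.2)).union
      ((Set.finite_singleton (p.1 - 1)).prod (Δ.finite_succ p.2))).subset ?_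
    rintro ⟨n, y⟩ (⟨h, h'⟩ | ⟨h, h'⟩)
    · exact Or.inl ⟨h, h'⟩
    · exact Or.inr ⟨h, h'⟩
  arrow_τ p q := by
    have h1 : p.1 - 1 = q.1 ↔ q.1 = p.1 - 1 := eq_comm
    have h2 : p.1 - 1 = q.1 - 1 ↔ q.1 = p.1 := by omega
    simp [h1, h2, or_comm]

end OrientedTree

/-! ### The radical, Auslander–Reiten triangles and the Auslander–Reiten quiver -/

namespace AuslanderReiten

section Linear

variable (k : Type w) [Field k] {T : Type u} [Category.{v} T] [Preadditive T] [Linear k T]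

/-- The radical `R(X, Y)` of the bifunctor `Hom`: the morphisms `f : X ⟶ Y` such that
`1 - g f` is invertible for every `g : Y ⟶ X`. -/
def radical (X Y : T) : Submodule k (X ⟶ Y) where
  carrier := {f | ∀ g : Y ⟶ X, IsIso (𝟙 X - f ≫ g)}
  zero_mem' := fun g => by simp only [zero_comp, sub_zero]; infer_instance
  add_mem' := by
    intro f f' hf hf' g
    have := hf g
    have := hf' (g ≫ inv (𝟙 X - f ≫ g))
    have h : 𝟙 X - (f + f') ≫ g =
        (𝟙 X - f' ≫ g ≫ inv (𝟙 X - f ≫ g)) ≫ (𝟙 X - f ≫ g) := by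
      rw [Preadditive.sub_comp (𝟙 X)]
      simp only [Category.assoc, IsIso.inv_hom_id, Category.comp_id, Category.id_comp,
        Preadditive.add_comp]
      abel
    rw [h]
    infer_instance
  smul_mem' := by
    intro c f hf g
    rw [Linear.smul_comp, ← Linear.comp_smul]
    exact hf (c • g)

/-- The square `R²(X, Y)` of the radical: the span of the compositions of two radical morphisms. -/
def radicalSq (X Y : T) : Submodule k (X ⟶ Y) :=
  Submodule.span k
    {f | ∃ (Z : T) (g : X ⟶ Z) (h : Z ⟶ Y), g ∈ radical k X Z ∧ h ∈ radical k Z Y ∧ g ≫ h = f}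

/-- The dimension of `R(X, Y) / R²(X, Y)`. -/
noncomputable def irrDim (X Y : T) : ℕ :=
  Module.finrank k (radical k X Y ⧸ (radicalSq k X Y).submoduleOf (radical k X Y))

end Linear

section Additive

variable (T : Type u) [Category.{v} T] [HasZeroMorphisms T] [HasBinaryBiproducts T]

/-- The indecomposable objects of `T`. -/
def Indec : Type u := {X : T // Indecomposable X}

/-- Isomorphism of indecomposable objects. -/
def indecSetoid : Setoid (Indec T) where
  r X Y := Nonempty (X.1 ≅ Y.1)
  iseqv := ⟨fun _ => ⟨Iso.refl _⟩, fun ⟨e⟩ => ⟨e.symm⟩, fun ⟨e⟩ ⟨f⟩ => ⟨e ≪≫ f⟩⟩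

/-- The isomorphism classes of indecomposable objects of `T`. -/
def IndecClass : Type u := Quotient (indecSetoid T)

variable {T}

/-- The isomorphism class of an indecomposable object. -/
def Indec.cls (X : Indec T) : IndecClass T := Quotient.mk (indecSetoid T) X

variable (T)

/-- `T` is locally finite: for each indecomposable `X` there are, up to isomorphism, only finitely
many indecomposables `Y` with `Hom(X, Y) ≠ 0`. -/
def IsLocallyFinite : Prop :=
  ∀ X : Indec T, {y : IndecClass T | ∃ Y : Indec T, Y.cls = y ∧ ∃ f : X.1 ⟶ Y.1, f ≠ 0}.Finite

end Additive

/-- `T` is a Krull–Schmidt category: each object is a finite direct sum of indecomposables, and the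
indecomposables have local endomorphism rings. -/
def IsKrullSchmidt (T : Type u) [Category.{v} T] [Preadditive T] [HasBinaryBiproducts T]
    [HasFiniteBiproducts T] : Prop :=
  (∀ X : T, ∃ (n : ℕ) (Y : Fin n → T), (∀ i, Indecomposable (Y i)) ∧ Nonempty (X ≅ ⨁ Y)) ∧
  ∀ X : T, Indecomposable X → IsLocalRing (End X)

section Triangulated

variable (k : Type w) [Field k] {T : Type u} [Category.{v} T] [Preadditive T] [Linear k T]
  [HasZeroObject T] [HasShift T ℤ] [∀ n : ℤ, (shiftFunctor T n).Additive] [Pretriangulated T]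

/-- An Auslander–Reiten triangle. -/
structure IsARTriangle (t : Triangle T) : Prop where
  distinguished : t ∈ distTriang T
  indec_left : Indecomposable t.obj₁
  indec_right : Indecomposable t.obj₃
  ne_zero : t.mor₃ ≠ 0
  lift : ∀ (W : T) (f : W ⟶ t.obj₃), ¬ IsSplitEpi f → ∃ f' : W ⟶ t.obj₂, f' ≫ t.mor₂ = f
  desc : ∀ (U : T) (g : t.obj₁ ⟶ U), ¬ IsSplitMono g → ∃ g' : t.obj₂ ⟶ U, t.mor₁ ≫ g' = g

/-- The valued translation quiver `Γ` on the isomorphism classes of indecomposables is the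
Auslander–Reiten quiver of `T`: the value `a_{xy}` for `x = [X]` and `y = [Y]` is the dimension of
`R(X, Y) / R²(X, Y)` (in particular there is an arrow if and only if this is not zero), and
`τ [Z] = [X]` if and only if there is an Auslander–Reiten triangle `X ⟶ Y ⟶ Z ⟶ S X`.
These conditions determine `Γ`. -/
structure IsARQuiver (Γ : ValuedTranslationQuiver (IndecClass T)) : Prop where
  a_eq : ∀ X Y : Indec T, Γ.a X.cls Y.cls = irrDim k X.1 Y.1
  τ_eq_iff : ∀ X Z : Indec T, Γ.τ Z.cls = X.cls ↔
    ∃ (Y : T) (u : X.1 ⟶ Y) (v : Y ⟶ Z.1) (w : Z.1 ⟶ X.1⟦(1 : ℤ)⟧),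
      IsARTriangle (Triangle.mk u v w)

end Triangulated

end AuslanderReiten

/-!
The theorem has a categorical part, which produces the Auslander–Reiten quiver together with
numerical functions on it, and a combinatorial part, which needs nothing but these functions.

*Auslander–Reiten triangles.* Local finiteness and finite-dimensional morphism spaces allow one to
measure a morphism `f : X ⟶ Y` by the total dimension of the spaces of morphisms that factor through
`f` (`compRank`). A nonzero morphism `Z ⟶ W` of minimal rank with `W` indecomposable is the third
morphism of an Auslander–Reiten triangle that ends at `Z`. A morphism out of `X` of maximal rank
among those that are not split monomorphisms gives an Auslander–Reiten triangle that starts at `X`.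
As `k` is algebraically closed, the indecomposable summands of the middle term, counted with
multiplicity, are the irreducible predecessors of `Z` and the irreducible successors of `X`
(`exists_mesh`). So the quiver is a valued stable translation quiver, and `dim Hom(U, -)` is a
finitely supported function on its vertices that is subadditive on all meshes, strictly so on the
one that ends at `U` (`exists_arQuiver`).

*Dynkin type.* Summing such functions over the powers of `τ`, which is a finite sum, and then over
finitely many `U` gives a `τ`-invariant function `F` on a component that is strictly subadditive at
every vertex (`exists_isSubadditive`), i.e. with `2 F y` larger than the sum of the values of `F` at
the successors of `y`. This forces all values of arrows to be `1`. Following sectional paths away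
from a branch vertex or, if there is none, from a minimum of `F`, one sees that `F` is concave along
them and hence that they end. The lengths of the three arms at a branch vertex are bounded as usual.
The paths make up a slice, whose graph is a Dynkin graph (`exists_dynkin_slice`).

*Coverings.* A slice `Δ` of a translation quiver extends to a covering by `ℤΔ`. As `Δ` is a tree,
`ℤΔ` is simply connected: morphisms out of it lift along coverings, uniquely once the value at one
vertex is given (`exists_lift`, `lift_unique`). Hence the component is the orbit quiver of the group
of deck transformations, which is weakly admissible. Another presentation as an orbit quiver is
another covering by a repetition, and two of them are isomorphic over the component (`exists_iso`),
which gives the uniqueness of the group. The graph of `Δ` is the graph of `τ`-orbits of `ℤΔ`.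

*Infinite components.* On an infinite component `τ` has no periodic points. A deck transformation
permutes the vertices of `Δ` at which `F` is maximal. There are one or two of these, and in the
second case they are neighbours. From this it follows that the transformation is the identity
(`deckGroup_eq_bot`).
-/

namespace AuslanderReiten

/-! ### Indecomposable objects with local endomorphism rings -/

section LocalEnd

variable {T : Type u} [Category.{v} T] {X Y Z : T}

theorem isSplitMono_of_isIso_comp {g : X ⟶ Y} {r : Y ⟶ X} (h : IsIso (g ≫ r)) : IsSplitMono g :=
  ⟨⟨⟨r ≫ inv (g ≫ r), by rw [← Category.assoc, IsIso.hom_inv_id]⟩⟩⟩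

theorem isSplitEpi_of_isIso_comp {g : X ⟶ Y} {r : Y ⟶ X} (h : IsIso (r ≫ g)) : IsSplitEpi g :=
  ⟨⟨⟨inv (r ≫ g) ≫ r, by rw [Category.assoc, IsIso.inv_hom_id]⟩⟩⟩

theorem isSplitMono_of_comp {g : X ⟶ Y} {h : Y ⟶ Z} (H : IsSplitMono (g ≫ h)) : IsSplitMono g :=
  ⟨⟨⟨h ≫ retraction (g ≫ h), by rw [← Category.assoc, IsSplitMono.id]⟩⟩⟩

variable [Preadditive T]

theorem isIso_or_isIso_one_sub [IsLocalRing (End X)] (f : X ⟶ X) :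
    IsIso f ∨ IsIso (𝟙 X - f) := by
  rw [← isUnit_iff_isIso (X := X) f, ← isUnit_iff_isIso (X := X) (𝟙 X - f)]
  exact IsLocalRing.isUnit_or_isUnit_of_add_one (R := End X) (add_sub_cancel f (𝟙 X))

theorem isIso_of_comp_eq_self [IsLocalRing (End X)] {t : Z ⟶ X} (ht : t ≠ 0) {s : X ⟶ X}
    (h : t ≫ s = t) : IsIso s := by
  refine (isIso_or_isIso_one_sub s).resolve_right fun h' => ht ?_
  rw [← cancel_mono (𝟙 X - s)]
  simp [h]

theorem isIso_of_comp_eq_self' [IsLocalRing (End X)] {t : X ⟶ Z} (ht : t ≠ 0) {s : X ⟶ X}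
    (h : s ≫ t = t) : IsIso s := by
  refine (isIso_or_isIso_one_sub s).resolve_right fun h' => ht ?_
  rw [← cancel_epi (𝟙 X - s)]
  simp [h]

/-- In an additive category, `1 - f g` is invertible if and only if `1 - g f` is. -/
theorem isIso_one_sub_comp {f : X ⟶ Y} {g : Y ⟶ X} (h : IsIso (𝟙 X - f ≫ g)) :
    IsIso (𝟙 Y - g ≫ f) := by
  have h1 := IsIso.hom_inv_id (𝟙 X - f ≫ g)
  have h2 := IsIso.inv_hom_id (𝟙 X - f ≫ g)
  set i := inv (𝟙 X - f ≫ g)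
  simp only [Preadditive.sub_comp, Preadditive.comp_sub, Category.id_comp, Category.comp_id,
    Category.assoc] at h1 h2
  refine ⟨⟨𝟙 Y + g ≫ i ≫ f, ?_, ?_⟩⟩
  · have h3 := congrArg (fun e => g ≫ e ≫ f) h1
    simp only [Preadditive.sub_comp, Preadditive.comp_sub, Preadditive.comp_add,
      Category.id_comp, Category.comp_id, Category.assoc] at h3 ⊢
    rw [← sub_eq_zero] at h3 ⊢
    refine Eq.trans ?_ h3
    abel
  · have h3 := congrArg (fun e => g ≫ e ≫ f) h2
    simp only [Preadditive.sub_comp, Preadditive.comp_sub, Preadditive.add_comp,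
      Category.id_comp, Category.comp_id, Category.assoc] at h3 ⊢
    rw [← sub_eq_zero] at h3 ⊢
    refine Eq.trans ?_ h3
    abel

theorem Indecomposable.ne_zero_id [HasBinaryBiproducts T] (hX : Indecomposable X) : 𝟙 X ≠ 0 :=
  fun h => hX.1 ((IsZero.iff_id_eq_zero X).2 h)

end LocalEnd

/-! ### The radical -/

section Radical

variable {k : Type w} [Field k] {T : Type u} [Category.{v} T] [Preadditive T] [Linear k T]
  {X Y Z : T}

theorem radical_comp {f : X ⟶ Y} (hf : f ∈ radical k X Y) (h : Y ⟶ Z) : f ≫ h ∈ radical k X Z :=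
  fun g => by rw [Category.assoc]; exact hf _

theorem comp_radical {f : Y ⟶ Z} (hf : f ∈ radical k Y Z) (h : X ⟶ Y) : h ≫ f ∈ radical k X Z :=
  fun g => by
    rw [Category.assoc]
    apply isIso_one_sub_comp
    rw [Category.assoc]
    exact hf _

theorem mem_radical_iff_not_isSplitMono [HasBinaryBiproducts T] [IsLocalRing (End X)]
    (hX : Indecomposable X) {f : X ⟶ Y} : f ∈ radical k X Y ↔ ¬ IsSplitMono f := by
  constructor
  · intro hf hs
    have h := hf (retraction f)
    rw [IsSplitMono.id, sub_self] at h
    exact Indecomposable.ne_zero_id hX (by rw [← IsIso.hom_inv_id (0 : X ⟶ X), zero_comp])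
  · intro hf g
    exact (isIso_or_isIso_one_sub (f ≫ g)).resolve_left fun h => hf (isSplitMono_of_isIso_comp h)

theorem mem_radical_iff_not_isSplitEpi [HasBinaryBiproducts T] [IsLocalRing (End Y)]
    (hY : Indecomposable Y) {f : X ⟶ Y} : f ∈ radical k X Y ↔ ¬ IsSplitEpi f := by
  constructor
  · intro hf hs
    have h := isIso_one_sub_comp (hf (section_ f))
    rw [IsSplitEpi.id, sub_self] at h
    exact Indecomposable.ne_zero_id hY (by rw [← IsIso.hom_inv_id (0 : Y ⟶ Y), zero_comp])
  · intro hf g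
    apply isIso_one_sub_comp
    exact (isIso_or_isIso_one_sub (g ≫ f)).resolve_left fun h => hf (isSplitEpi_of_isIso_comp h)

end Radical

/-! ### Almost vanishing morphisms and Auslander–Reiten triangles -/

section Triangulated

variable {T : Type u} [Category.{v} T] [Preadditive T] [HasShift T ℤ] {X Y Z : T}

/-- A nonzero morphism `w : Z ⟶ X⟦1⟧` that is annihilated by all morphisms into `Z` that are not
split epimorphisms and by the suspensions of all morphisms out of `X` that are not split
monomorphisms. Such a morphism is the third
morphism of an Auslander–Reiten triangle. -/
structure IsAlmostVanishing (w : Z ⟶ X⟦(1 : ℤ)⟧) : Prop where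
  ne_zero : w ≠ 0
  comp_eq_zero : ∀ (W : T) (f : W ⟶ Z), ¬ IsSplitEpi f → f ≫ w = 0
  comp_map_eq_zero : ∀ (U : T) (g : X ⟶ U), ¬ IsSplitMono g → w ≫ g⟦(1 : ℤ)⟧' = 0

/-- Almost vanishing morphisms can be transported along isomorphisms of their ends. -/
theorem IsAlmostVanishing.of_iso {X' Z' : T} {w : Z ⟶ X⟦(1 : ℤ)⟧} (hw : IsAlmostVanishing w)
    (e : X ≅ X') (f : Z' ≅ Z) : IsAlmostVanishing (f.hom ≫ w ≫ e.hom⟦(1 : ℤ)⟧') := by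
  refine ⟨fun h => hw.1 ?_, fun W g hg => ?_, fun U g hg => ?_⟩
  · rw [← cancel_epi f.hom, ← cancel_mono (e.hom⟦(1 : ℤ)⟧')]
    simpa using h
  · have := hw.2 W (g ≫ f.hom) fun h => hg ?_
    · rw [← Category.assoc, ← Category.assoc, this, zero_comp]
    · have h' : g = (g ≫ f.hom) ≫ f.inv := by simp
      rw [h']
      infer_instance
  · have := hw.3 U (e.hom ≫ g) fun h => hg ?_
    · rw [Functor.map_comp] at this
      rw [Category.assoc, Category.assoc, this, comp_zero]
    · have h' : g = e.inv ≫ e.hom ≫ g := by simp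
      rw [h']
      infer_instance

variable [HasZeroObject T] [∀ n : ℤ, (shiftFunctor T n).Additive] [Pretriangulated T]

/-- In a distinguished triangle `X ⟶ Y ⟶ Z ⟶ X⟦1⟧`, the morphisms out of `X` that factor through
`Y` are those whose suspension is annihilated by `Z ⟶ X⟦1⟧`. -/
theorem factors_mor₁_iff {u : X ⟶ Y} {v : Y ⟶ Z} {w : Z ⟶ X⟦(1 : ℤ)⟧}
    (ht : Triangle.mk u v w ∈ distTriang T) {U : T} (g : X ⟶ U) :
    (∃ g' : Y ⟶ U, u ≫ g' = g) ↔ w ≫ g⟦(1 : ℤ)⟧' = 0 := by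
  constructor
  · rintro ⟨g', rfl⟩
    have hz : w ≫ u⟦(1 : ℤ)⟧' = 0 := comp_distTriang_mor_zero₃₁ _ ht
    rw [Functor.map_comp, reassoc_of% hz, zero_comp]
  · intro h
    obtain ⟨g', hg'⟩ : ∃ g' : Y⟦(1 : ℤ)⟧ ⟶ U⟦(1 : ℤ)⟧, g⟦(1 : ℤ)⟧' = (-u⟦(1 : ℤ)⟧') ≫ g' :=
      Triangle.yoneda_exact₃ _ (rot_of_distTriang _ ht) (g⟦(1 : ℤ)⟧') h
    refine ⟨(shiftFunctor T (1 : ℤ)).preimage (-g'), (shiftFunctor T (1 : ℤ)).map_injective ?_⟩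
    rw [Functor.map_comp, Functor.map_preimage, hg']
    simp

theorem factors_mor₂_iff {u : X ⟶ Y} {v : Y ⟶ Z} {w : Z ⟶ X⟦(1 : ℤ)⟧}
    (ht : Triangle.mk u v w ∈ distTriang T) {U : T} (g : U ⟶ Z) :
    (∃ g' : U ⟶ Y, g' ≫ v = g) ↔ g ≫ w = 0 := by
  constructor
  · rintro ⟨g', rfl⟩
    have hz : v ≫ w = 0 := comp_distTriang_mor_zero₂₃ _ ht
    rw [Category.assoc, hz, comp_zero]
  · intro h
    obtain ⟨g', hg'⟩ := Triangle.coyoneda_exact₃ _ ht g h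
    exact ⟨g', hg'.symm⟩

/-- The two lifting properties of an Auslander–Reiten triangle are the two vanishing properties of
its third morphism. -/
theorem isARTriangle_iff {u : X ⟶ Y} {v : Y ⟶ Z} {w : Z ⟶ X⟦(1 : ℤ)⟧}
    (ht : Triangle.mk u v w ∈ distTriang T) : IsARTriangle (Triangle.mk u v w) ↔
      Indecomposable X ∧ Indecomposable Z ∧ IsAlmostVanishing w :=
  ⟨fun h => ⟨h.2, h.3, h.4, fun W f hf => (factors_mor₂_iff ht f).1 (h.lift W f hf),
      fun U g hg => (factors_mor₁_iff ht g).1 (h.desc U g hg)⟩,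
    fun ⟨h1, h2, h3⟩ => ⟨ht, h1, h2, h3.1, fun W f hf => (factors_mor₂_iff ht f).2 (h3.2 W f hf),
      fun U g hg => (factors_mor₁_iff ht g).2 (h3.3 U g hg)⟩⟩

namespace IsAlmostVanishing

/-- It suffices to test on one side: if `h = f w` were nonzero for some `f` that is not a split
epimorphism, the
morphism `X ⟶ E` in a triangle on `h` would be annihilated by `w`, so that `w = s h = (s f) w`. -/
theorem of_comp_map_eq_zero [IsLocalRing (End Z)] {w : Z ⟶ X⟦(1 : ℤ)⟧} (hw : w ≠ 0)
    (H : ∀ (U : T) (g : X ⟶ U), ¬ IsSplitMono g → w ≫ g⟦(1 : ℤ)⟧' = 0) :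
    IsAlmostVanishing w := by
  refine ⟨hw, fun W f hf => ?_, H⟩
  by_contra h
  obtain ⟨E, a, b, ht⟩ := distinguished_cocone_triangle₂ (f ≫ w)
  have ha : ¬ IsSplitMono a := fun ha =>
    h (Triangle.mor₃_eq_zero_of_mono₁ _ ht (show Mono a from inferInstance))
  obtain ⟨s, hs⟩ : ∃ s : Z ⟶ W, w = s ≫ f ≫ w := Triangle.coyoneda_exact₁ _ ht w (H _ a ha)
  apply hf
  apply isSplitEpi_of_isIso_comp (r := s)
  apply isIso_of_comp_eq_self' hw
  rw [Category.assoc]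
  exact hs.symm

/-- An almost vanishing morphism factors through every nonzero morphism with the same target: the
first morphism in a triangle on `h` is not a split monomorphism, so `w` annihilates it. -/
theorem exists_comp_eq {w : Z ⟶ X⟦(1 : ℤ)⟧} (hw : IsAlmostVanishing w) {W : T}
    {h : W ⟶ X⟦(1 : ℤ)⟧} (hh : h ≠ 0) : ∃ s : Z ⟶ W, s ≫ h = w := by
  obtain ⟨E, a, b, ht⟩ := distinguished_cocone_triangle₂ h
  have ha : ¬ IsSplitMono a := fun ha =>
    hh (Triangle.mor₃_eq_zero_of_mono₁ _ ht (show Mono a from inferInstance))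
  obtain ⟨s, hs⟩ := Triangle.coyoneda_exact₁ _ ht w (hw.3 _ a ha)
  exact ⟨s, hs.symm⟩

/-- The counterpart of `exists_comp_eq` for nonzero morphisms with the same source. -/
theorem exists_comp_eq' {w : Z ⟶ X⟦(1 : ℤ)⟧} (hw : IsAlmostVanishing w) {W : T}
    {h : Z ⟶ W} (hh : h ≠ 0) : ∃ s : W ⟶ X⟦(1 : ℤ)⟧, h ≫ s = w := by
  obtain ⟨E, a, b, ht⟩ := distinguished_cocone_triangle₁ h
  have ha : ¬ IsSplitEpi a := fun ha =>
    hh (Triangle.mor₂_eq_zero_of_epi₁ _ ht (show Epi a from inferInstance))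
  obtain ⟨s, hs⟩ := Triangle.yoneda_exact₂ _ ht w (hw.2 _ a ha)
  exact ⟨s, hs.symm⟩

theorem nonempty_iso_left {X' : T} [IsLocalRing (End X)] [IsLocalRing (End X')]
    {w : Z ⟶ X⟦(1 : ℤ)⟧} {w' : Z ⟶ X'⟦(1 : ℤ)⟧} (hw : IsAlmostVanishing w)
    (hw' : IsAlmostVanishing w') : Nonempty (X ≅ X') := by
  obtain ⟨s, hs⟩ := hw.exists_comp_eq' hw'.ne_zero
  obtain ⟨s', hs'⟩ := hw'.exists_comp_eq' hw.ne_zero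
  obtain ⟨r, rfl⟩ := (shiftFunctor T (1 : ℤ)).map_surjective s
  obtain ⟨r', rfl⟩ := (shiftFunctor T (1 : ℤ)).map_surjective s'
  have aux : ∀ {A B : T} {w : Z ⟶ A⟦(1 : ℤ)⟧} {w' : Z ⟶ B⟦(1 : ℤ)⟧} (_ : w ≠ 0)
      (_ : IsLocalRing (End A)) (r : B ⟶ A) (r' : A ⟶ B) (_ : w' ≫ r⟦(1 : ℤ)⟧' = w)
      (_ : w ≫ r'⟦(1 : ℤ)⟧' = w'), IsIso (r' ≫ r) := by
    intro A B w w' h0 hA r r' h1 h2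
    refine (isIso_or_isIso_one_sub (r' ≫ r)).resolve_right fun h' => h0 ?_
    rw [← cancel_mono ((𝟙 A - r' ≫ r)⟦(1 : ℤ)⟧')]
    simp [h1, reassoc_of% h2]
  have h1 := aux hw.ne_zero inferInstance r r' hs hs'
  have h2 := aux hw'.ne_zero inferInstance r' r hs' hs
  have h3 := isSplitMono_of_isIso_comp h1
  have h4 := isSplitEpi_of_isIso_comp h2
  have : IsIso r' := isIso_of_mono_of_isSplitEpi r'
  exact ⟨asIso r'⟩

theorem nonempty_iso_right {Z' : T} [IsLocalRing (End Z)] [IsLocalRing (End Z')]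
    {w : Z ⟶ X⟦(1 : ℤ)⟧} {w' : Z' ⟶ X⟦(1 : ℤ)⟧} (hw : IsAlmostVanishing w)
    (hw' : IsAlmostVanishing w') : Nonempty (Z ≅ Z') := by
  obtain ⟨s, hs⟩ := hw.exists_comp_eq hw'.ne_zero
  obtain ⟨s', hs'⟩ := hw'.exists_comp_eq hw.ne_zero
  have h1 : IsIso (s ≫ s') :=
    isIso_of_comp_eq_self' hw.ne_zero (by rw [Category.assoc, hs', hs])
  have h2 : IsIso (s' ≫ s) :=
    isIso_of_comp_eq_self' hw'.ne_zero (by rw [Category.assoc, hs, hs'])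
  have h3 := isSplitMono_of_isIso_comp h1
  have h4 := isSplitEpi_of_isIso_comp h2
  have : IsIso s := isIso_of_mono_of_isSplitEpi s
  exact ⟨asIso s⟩

end IsAlmostVanishing

theorem Indecomposable.shift (hX : Indecomposable X) (n : ℤ) : Indecomposable (X⟦n⟧) := by
  have hz : ∀ (A : T) (m : ℤ), IsZero (A⟦m⟧) → IsZero A := fun A m h => by
    rw [IsZero.iff_id_eq_zero] at h ⊢
    apply (shiftFunctor T m).map_injective
    simpa using h
  refine ⟨fun h => hX.1 (hz _ _ h), fun A B e => ?_⟩
  have := preservesBinaryBiproducts_of_preservesBiproducts (shiftFunctor T (-n))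
  have e' : X ≅ A⟦-n⟧ ⊞ B⟦-n⟧ :=
    (shiftShiftNeg X n).symm ≪≫ (shiftFunctor T (-n)).mapIso e ≪≫
      (shiftFunctor T (-n)).mapBiprod A B
  exact (hX.2 _ _ e').imp (hz _ _) (hz _ _)

end Triangulated

/-! ### Existence of Auslander–Reiten triangles -/

section Classes

variable {T : Type u} [Category.{v} T] [HasZeroMorphisms T] [HasBinaryBiproducts T]

theorem Indec.cls_eq_iff {X Y : Indec T} : X.cls = Y.cls ↔ Nonempty (X.1 ≅ Y.1) :=
  Quotient.eq (r := indecSetoid T)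

/-- A representative of an isomorphism class of indecomposable objects. -/
noncomputable def IndecClass.rep (c : IndecClass T) : Indec T := Quotient.out (s := indecSetoid T) c

@[simp]
theorem IndecClass.cls_rep (c : IndecClass T) : c.rep.cls = c :=
  Quotient.out_eq (s := indecSetoid T) c

/-- The isomorphism class of an object that is known to be indecomposable. -/
def isoClass {X : T} (hX : Indecomposable X) : IndecClass T := Indec.cls ⟨X, hX⟩

theorem isoClass_eq_iff {X Y : T} (hX : Indecomposable X) (hY : Indecomposable Y) :
    isoClass hX = isoClass hY ↔ Nonempty (X ≅ Y) :=
  Indec.cls_eq_iff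

theorem IndecClass.isoClass_rep (c : IndecClass T) : isoClass c.rep.2 = c := c.cls_rep

theorem IndecClass.nonempty_iso_rep {X : T} (hX : Indecomposable X) :
    Nonempty (X ≅ (isoClass hX).rep.1) :=
  (isoClass_eq_iff hX _).1 (isoClass hX).isoClass_rep.symm

end Classes

theorem exists_comp_biproduct_π_ne_zero {T : Type u} [Category.{v} T] [HasZeroMorphisms T]
    [HasFiniteBiproducts T] {n : ℕ} {Y : Fin n → T} {W X : T} (e : X ≅ ⨁ Y) {f : W ⟶ X}
    (hf : f ≠ 0) : ∃ j, f ≫ e.hom ≫ biproduct.π Y j ≠ 0 := by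
  by_contra! h
  apply hf
  rw [← cancel_mono e.hom, zero_comp]
  exact biproduct.hom_ext _ _ fun j => by simpa using h j

theorem exists_biproduct_ι_comp_ne_zero {T : Type u} [Category.{v} T] [HasZeroMorphisms T]
    [HasFiniteBiproducts T] {n : ℕ} {Y : Fin n → T} {W X : T} (e : X ≅ ⨁ Y) {f : X ⟶ W}
    (hf : f ≠ 0) : ∃ j, biproduct.ι Y j ≫ e.inv ≫ f ≠ 0 := by
  by_contra! h
  apply hf
  rw [← cancel_epi e.inv, comp_zero]
  exact biproduct.hom_ext' _ _ fun j => by simpa using h j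

section CompRank

variable {k : Type w} [Field k] {T : Type u} [Category.{v} T] [Preadditive T] [Linear k T]
  {X Y Z : T}

theorem range_leftComp_comp_le (f : X ⟶ Y) (g : Y ⟶ Z) (W : T) :
    LinearMap.range (Linear.leftComp k W (f ≫ g)) ≤ LinearMap.range (Linear.leftComp k W f) := by
  rintro _ ⟨h, rfl⟩
  exact ⟨g ≫ h, by simp⟩

variable [HasBinaryBiproducts T]

variable (k) in
/-- The total dimension of the spaces of morphisms from `X` to the members of `s` that factor
through `f : X ⟶ Y`. -/
noncomputable def compRank (s : Finset (IndecClass T)) (f : X ⟶ Y) : ℕ :=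
  ∑ c ∈ s, Module.finrank k (LinearMap.range (Linear.leftComp k c.rep.1 f))

theorem compRank_le (hfin : ∀ X Y : T, FiniteDimensional k (X ⟶ Y)) (s : Finset (IndecClass T))
    (f : X ⟶ Y) : compRank k s f ≤ ∑ c ∈ s, Module.finrank k (X ⟶ c.rep.1) :=
  Finset.sum_le_sum fun c _ => by
    have := hfin X c.rep.1
    exact Submodule.finrank_le _

/-- If composing with `g` does not decrease the rank, then everything that factors through `f`
factors through `f ≫ g`. -/
theorem exists_factor_of_compRank_le (hfin : ∀ X Y : T, FiniteDimensional k (X ⟶ Y))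
    {s : Finset (IndecClass T)} {f : X ⟶ Y} {g : Y ⟶ Z}
    (h : compRank k s f ≤ compRank k s (f ≫ g)) {U : T} (hU : Indecomposable U)
    (hs : isoClass hU ∈ s) (a : Y ⟶ U) : ∃ b : Z ⟶ U, f ≫ g ≫ b = f ≫ a := by
  have hle : ∀ c ∈ s, Module.finrank k (LinearMap.range (Linear.leftComp k c.rep.1 (f ≫ g))) ≤
      Module.finrank k (LinearMap.range (Linear.leftComp k c.rep.1 f)) := fun c _ => by
    have := hfin X c.rep.1
    exact Submodule.finrank_mono (range_leftComp_comp_le f g _)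
  have heq := (Finset.sum_eq_sum_iff_of_le hle).1 (le_antisymm (Finset.sum_le_sum hle) h) _ hs
  have := hfin X (isoClass hU).rep.1
  have hr := Submodule.eq_of_le_of_finrank_eq (range_leftComp_comp_le (k := k) f g _) heq
  obtain ⟨e⟩ := IndecClass.nonempty_iso_rep hU
  have hmem : f ≫ a ≫ e.hom ∈ LinearMap.range (Linear.leftComp k (isoClass hU).rep.1 (f ≫ g)) := by
    rw [hr]
    exact ⟨a ≫ e.hom, rfl⟩
  obtain ⟨b, hb⟩ := hmem
  refine ⟨b ≫ e.inv, ?_⟩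
  rw [← cancel_mono e.hom]
  simpa using hb

end CompRank

section Existence

variable {k : Type w} [Field k] {T : Type u} [Category.{v} T] [Preadditive T] [Linear k T]

/-- Take a nonzero morphism `t : Z ⟶ W` with `W` indecomposable for which `compRank` is minimal. If
`t ≫ g ≠ 0`, then by minimality `t` factors through `t ≫ g`, so that `g` is a split monomorphism. -/
theorem exists_comp_eq_zero_of_not_isSplitMono [HasBinaryBiproducts T] [HasFiniteBiproducts T]
    (hfin : ∀ X Y : T, FiniteDimensional k (X ⟶ Y)) (hKS : IsKrullSchmidt T)
    (hLF : IsLocallyFinite T) {Z : T} (hZ : Indecomposable Z) :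
    ∃ (W : T) (_ : Indecomposable W) (t : Z ⟶ W), t ≠ 0 ∧
      ∀ (U : T) (g : W ⟶ U), ¬ IsSplitMono g → t ≫ g = 0 := by
  classical
  set s := (hLF ⟨Z, hZ⟩).toFinset with hs
  have hex : ∃ n, ∃ (W : T) (_ : Indecomposable W) (t : Z ⟶ W), t ≠ 0 ∧ compRank k s t = n :=
    ⟨_, Z, hZ, 𝟙 _, Indecomposable.ne_zero_id hZ, rfl⟩
  obtain ⟨W, hW, t, ht, hn⟩ := Nat.find_spec hex
  refine ⟨W, hW, t, ht, fun U g hg => ?_⟩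
  by_contra h0
  obtain ⟨m, Y, hY, ⟨e⟩⟩ := hKS.1 U
  obtain ⟨j, hj⟩ := exists_comp_biproduct_π_ne_zero e h0
  rw [Category.assoc] at hj
  have hmin : compRank k s t ≤ compRank k s (t ≫ g ≫ e.hom ≫ biproduct.π Y j) := by
    rw [hn]
    exact Nat.find_min' hex ⟨Y j, hY j, _, hj, rfl⟩
  have hWs : isoClass hW ∈ s := by
    rw [hs, Set.Finite.mem_toFinset]
    exact ⟨⟨W, hW⟩, rfl, t, ht⟩
  obtain ⟨b, hb⟩ := exists_factor_of_compRank_le hfin hmin hW hWs (𝟙 W)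
  rw [Category.comp_id] at hb
  have := hKS.2 W hW
  have hi := isIso_of_comp_eq_self ht hb
  refine hg (isSplitMono_of_isIso_comp (r := e.hom ≫ biproduct.π Y j ≫ b) ?_)
  simpa using hi

/-- Among the morphisms out of `X` that are not split monomorphisms there is one, `f : X ⟶ Y`, that
maximizes `compRank`. All others factor through it: for `g` with indecomposable target the morphism
`(f, g)` is not a split monomorphism either, as the endomorphism ring of `X` is local, and its rank
is at most the one of `f`. -/
theorem exists_left_almost_split [HasBinaryBiproducts T] [HasFiniteBiproducts T]
    (hfin : ∀ X Y : T, FiniteDimensional k (X ⟶ Y)) (hKS : IsKrullSchmidt T)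
    (hLF : IsLocallyFinite T) {X : T} (hX : Indecomposable X) :
    ∃ (Y : T) (f : X ⟶ Y), ¬ IsSplitMono f ∧
      ∀ (U : T) (g : X ⟶ U), ¬ IsSplitMono g → ∃ h : Y ⟶ U, f ≫ h = g := by
  classical
  have := hKS.2 X hX
  set s := (hLF ⟨X, hX⟩).toFinset with hs
  let P : ℕ → Prop := fun n => ∃ (Y : T) (f : X ⟶ Y), ¬ IsSplitMono f ∧ compRank k s f = n
  have hP0 : ∃ n, P n := by
    refine ⟨_, X, 0, fun h => Indecomposable.ne_zero_id hX ?_, rfl⟩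
    rw [← IsSplitMono.id (0 : X ⟶ X), zero_comp]
  obtain ⟨n, ⟨Y, f, hf, hn⟩, hmax⟩ : ∃ n, P n ∧ ∀ m, P m → m ≤ n := by
    obtain ⟨n0, h0⟩ := hP0
    have hb : ∀ m, P m → m ≤ ∑ c ∈ s, Module.finrank k (X ⟶ c.rep.1) := by
      rintro m ⟨Y, f, -, rfl⟩
      exact compRank_le hfin s f
    exact ⟨_, Nat.findGreatest_spec (hb n0 h0) h0, fun m hm => Nat.le_findGreatest (hb m hm) hm⟩
  have key : ∀ (U : T) (_ : Indecomposable U) (g : X ⟶ U), ¬ IsSplitMono g →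
      ∃ h : Y ⟶ U, f ≫ h = g := by
    intro U hU g hg
    by_cases hg0 : g = 0
    · exact ⟨0, by simp [hg0]⟩
    have hl : ¬ IsSplitMono (biprod.lift f g) := by
      intro h
      obtain ⟨r, h1⟩ := h.exists_splitMono.some
      rw [biprod.lift_eq, Preadditive.add_comp, Category.assoc, Category.assoc] at h1
      rcases isIso_or_isIso_one_sub (f ≫ biprod.inl ≫ r) with h2 | h2
      · exact hf (isSplitMono_of_isIso_comp h2)
      · rw [← h1, add_sub_cancel_left] at h2
        exact hg (isSplitMono_of_isIso_comp h2)
    have hle : compRank k s (biprod.lift f g) ≤ compRank k s (biprod.lift f g ≫ biprod.fst) := by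
      rw [biprod.lift_fst, hn]
      exact hmax _ ⟨_, _, hl, rfl⟩
    have hUs : isoClass hU ∈ s := by
      rw [hs, Set.Finite.mem_toFinset]
      exact ⟨⟨U, hU⟩, rfl, g, hg0⟩
    obtain ⟨b, hb⟩ := exists_factor_of_compRank_le hfin hle hU hUs biprod.snd
    exact ⟨b, by simpa using hb⟩
  refine ⟨Y, f, hf, fun U g hg => ?_⟩
  obtain ⟨m, V, hV, ⟨e⟩⟩ := hKS.1 U
  have hc : ∀ j, ∃ h : Y ⟶ V j, f ≫ h = g ≫ e.hom ≫ biproduct.π V j := fun j =>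
    key _ (hV j) _ fun h => hg (isSplitMono_of_comp h)
  choose h hh using hc
  refine ⟨biproduct.lift h ≫ e.inv, ?_⟩
  rw [← cancel_mono e.hom]
  exact biproduct.hom_ext _ _ fun j => by simpa using hh j

variable [HasZeroObject T] [HasShift T ℤ] [∀ n : ℤ, (shiftFunctor T n).Additive]
  [Pretriangulated T]

/-- The morphism of `exists_comp_eq_zero_of_not_isSplitMono` is almost vanishing. -/
theorem exists_isAlmostVanishing_source
    (hfin : ∀ X Y : T, FiniteDimensional k (X ⟶ Y)) (hKS : IsKrullSchmidt T)
    (hLF : IsLocallyFinite T) {Z : T} (hZ : Indecomposable Z) :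
    ∃ (X : T) (_ : Indecomposable X) (w : Z ⟶ X⟦(1 : ℤ)⟧), IsAlmostVanishing w := by
  obtain ⟨W, hW, t, ht, H⟩ := exists_comp_eq_zero_of_not_isSplitMono hfin hKS hLF hZ
  let e : W⟦(-1 : ℤ)⟧⟦(1 : ℤ)⟧ ≅ W := shiftNegShift W (1 : ℤ)
  refine ⟨W⟦(-1 : ℤ)⟧, Indecomposable.shift hW (-1), t ≫ e.inv, ?_⟩
  have := hKS.2 Z hZ
  refine .of_comp_map_eq_zero (fun h => ht ?_) fun U g hg => ?_
  · rw [← cancel_mono e.inv, h, zero_comp]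
  · rw [Category.assoc]
    refine H _ _ fun h => hg ?_
    have h' : IsSplitMono (g⟦(1 : ℤ)⟧') := by
      have h2 : g⟦(1 : ℤ)⟧' = e.hom ≫ e.inv ≫ g⟦(1 : ℤ)⟧' := by simp
      rw [h2]
      infer_instance
    exact ⟨⟨(shiftFunctor T (1 : ℤ)).splitMonoEquiv g |>.symm h'.exists_splitMono.some⟩⟩

/-- In a triangle on the left almost split morphism `X ⟶ Y`, a component of `C ⟶ X⟦1⟧` at an
indecomposable summand of `C` is almost vanishing. -/
theorem exists_isAlmostVanishing_target
    (hfin : ∀ X Y : T, FiniteDimensional k (X ⟶ Y)) (hKS : IsKrullSchmidt T)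
    (hLF : IsLocallyFinite T) {X : T} (hX : Indecomposable X) :
    ∃ (Z : T) (_ : Indecomposable Z) (w : Z ⟶ X⟦(1 : ℤ)⟧), IsAlmostVanishing w := by
  have := hKS.2 X hX
  obtain ⟨Y, f, hf, H⟩ := exists_left_almost_split hfin hKS hLF hX
  obtain ⟨C, v, w, ht⟩ := distinguished_cocone_triangle f
  have hw : w ≠ 0 := by
    intro h
    obtain ⟨r, hr⟩ := (factors_mor₁_iff ht (𝟙 X)).2 (by
      rw [h, zero_comp])
    exact hf ⟨⟨⟨r, hr⟩⟩⟩
  have hz : w ≫ f⟦(1 : ℤ)⟧' = 0 := comp_distTriang_mor_zero₃₁ _ ht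
  obtain ⟨m, V, hV, ⟨e⟩⟩ := hKS.1 C
  obtain ⟨j, hj⟩ := exists_biproduct_ι_comp_ne_zero e hw
  refine ⟨V j, hV j, biproduct.ι V j ≫ e.inv ≫ w, ?_⟩
  have := hKS.2 _ (hV j)
  refine .of_comp_map_eq_zero hj fun U g hg => ?_
  obtain ⟨h, rfl⟩ := H U g hg
  rw [Functor.map_comp, Category.assoc, Category.assoc, reassoc_of% hz]
  simp

end Existence

/-! ### Irreducible morphisms and the middle term of an Auslander–Reiten triangle -/

section HomBiproduct

variable (k : Type w) [Field k] {T : Type u} [Category.{v} T] [Preadditive T] [Linear k T]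
  [HasFiniteBiproducts T]

/-- A morphism into a finite direct sum is given by its components. -/
noncomputable def homToBiproduct {n : ℕ} {Y : Fin n → T} {E : T} (e : E ≅ ⨁ Y) (X : T) :
    (X ⟶ E) ≃ₗ[k] ∀ j, X ⟶ Y j where
  toFun f j := f ≫ e.hom ≫ biproduct.π Y j
  invFun g := biproduct.lift g ≫ e.inv
  map_add' f g := by ext; simp
  map_smul' c f := by ext; simp
  left_inv f := by
    rw [← cancel_mono e.hom]
    exact biproduct.hom_ext _ _ fun j => by simp
  right_inv g := by ext; simp

/-- A morphism out of a finite direct sum is given by its components. -/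
noncomputable def homFromBiproduct {n : ℕ} {Y : Fin n → T} {E : T} (e : E ≅ ⨁ Y) (X : T) :
    (E ⟶ X) ≃ₗ[k] ∀ j, Y j ⟶ X where
  toFun f j := biproduct.ι Y j ≫ e.inv ≫ f
  invFun g := e.hom ≫ biproduct.desc g
  map_add' f g := by ext; simp
  map_smul' c f := by ext; simp
  left_inv f := by
    rw [← cancel_epi e.inv]
    exact biproduct.hom_ext' _ _ fun j => by simp
  right_inv g := by ext; simp

variable {k}

theorem mem_radical_iff_homToBiproduct {n : ℕ} {Y : Fin n → T} {E : T} (e : E ≅ ⨁ Y) {X : T}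
    {f : X ⟶ E} : f ∈ radical k X E ↔ ∀ j, homToBiproduct k e X f j ∈ radical k X (Y j) := by
  refine ⟨fun h j => radical_comp h _, fun h => ?_⟩
  have hf : f = ∑ j, homToBiproduct k e X f j ≫ biproduct.ι Y j ≫ e.inv := by
    rw [← cancel_mono e.hom, Preadditive.sum_comp]
    exact (biproduct.hom_ext _ _ fun j => by
      simp [homToBiproduct, Preadditive.sum_comp, biproduct.ι_π, comp_dite])
  rw [hf]
  exact Submodule.sum_mem _ fun j _ => radical_comp (h j) _

theorem mem_radical_iff_homFromBiproduct {n : ℕ} {Y : Fin n → T} {E : T} (e : E ≅ ⨁ Y) {X : T}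
    {f : E ⟶ X} : f ∈ radical k E X ↔ ∀ j, homFromBiproduct k e X f j ∈ radical k (Y j) X := by
  refine ⟨fun h j => comp_radical (comp_radical h _) _, fun h => ?_⟩
  have hf : f = ∑ j, (e.hom ≫ biproduct.π Y j) ≫ homFromBiproduct k e X f j := by
    rw [← cancel_epi e.inv, Preadditive.comp_sum]
    exact biproduct.hom_ext' _ _ fun j => by
      simp [homFromBiproduct, Preadditive.comp_sum, biproduct.ι_π_assoc, dite_comp]
  rw [hf]
  exact Submodule.sum_mem _ fun j _ => comp_radical (h j) _

end HomBiproduct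

section Count

variable {k : Type w} [Field k] {T : Type u} [Category.{v} T] [Preadditive T]
  [Linear k T] [HasBinaryBiproducts T]

theorem isIso_of_isSplitMono {X Y : T} (hX : Indecomposable X) [IsLocalRing (End Y)]
    {f : X ⟶ Y} (hf : IsSplitMono f) : IsIso f := by
  have hne : f ≠ 0 := fun h => Indecomposable.ne_zero_id hX (by
    obtain ⟨r, hr⟩ := hf.exists_splitMono.some
    rw [← hr, h, zero_comp])
  have h := isIso_of_comp_eq_self hne (s := retraction f ≫ f) (by simp)
  have := isSplitEpi_of_isIso_comp h
  exact isIso_of_mono_of_isSplitEpi f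

variable [HasFiniteBiproducts T]

/-- Over an algebraically closed field the endomorphism ring of an indecomposable object is `k`
modulo its radical. -/
theorem finrank_quotient_radical [IsAlgClosed k] (hfin : ∀ X Y : T, FiniteDimensional k (X ⟶ Y))
    (hKS : IsKrullSchmidt T) {X Y : T} (hX : Indecomposable X) (hY : Indecomposable Y)
    [Decidable (Nonempty (X ≅ Y))] :
    Module.finrank k ((X ⟶ Y) ⧸ radical k X Y) = if Nonempty (X ≅ Y) then 1 else 0 := by
  have := hKS.2 X hX
  have := hKS.2 Y hY
  split_ifs with h
  · obtain ⟨e⟩ := h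
    refine finrank_eq_one (Submodule.Quotient.mk e.hom) ?_ ?_
    · rw [Ne, Submodule.Quotient.mk_eq_zero, mem_radical_iff_not_isSplitMono hX, not_not]
      infer_instance
    · intro q
      obtain ⟨f, rfl⟩ := Submodule.Quotient.mk_surjective _ q
      have : FiniteDimensional k (End X) := hfin X X
      have : Nontrivial (End X) := ⟨𝟙 X, 0, Indecomposable.ne_zero_id hX⟩
      obtain ⟨c, hc⟩ := spectrum.nonempty_of_isAlgClosed_of_finiteDimensional k
        (show End X from f ≫ e.inv)
      refine ⟨c, ?_⟩
      rw [← Submodule.Quotient.mk_smul, Submodule.Quotient.eq,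
        mem_radical_iff_not_isSplitMono hX]
      intro hs
      have h1 := isIso_of_isSplitMono hX hs
      apply hc
      rw [spectrum.mem_resolventSet_iff, isUnit_iff_isIso]
      have h2 : IsIso ((c • e.hom - f) ≫ e.inv) := inferInstance
      have h3 : (c • e.hom - f) ≫ e.inv = c • 𝟙 X - f ≫ e.inv := by
        rw [Preadditive.sub_comp, Linear.smul_comp, e.hom_inv_id]
      rw [h3] at h2
      rw [Algebra.algebraMap_eq_smul_one]
      exact h2
  · have hr : radical k X Y = ⊤ := by
      rw [eq_top_iff]
      rintro f -
      rw [mem_radical_iff_not_isSplitMono hX]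
      intro hf
      have := isIso_of_isSplitMono hX hf
      exact h ⟨asIso f⟩
    rw [hr]
    exact Module.finrank_zero_of_subsingleton

open Classical in
/-- The multiplicity of `X` as a summand of `E` is the codimension of the radical in `Hom(X, E)`. -/
theorem finrank_hom_to_eq [IsAlgClosed k] (hfin : ∀ X Y : T, FiniteDimensional k (X ⟶ Y))
    (hKS : IsKrullSchmidt T) {n : ℕ} {Y : Fin n → T} {E : T} (e : E ≅ ⨁ Y)
    (hY : ∀ j, Indecomposable (Y j)) {X : T} (hX : Indecomposable X) :
    Module.finrank k (X ⟶ E) = (Finset.univ.filter fun j => Nonempty (X ≅ Y j)).card +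
      Module.finrank k (radical k X E) := by
  have := hfin X E
  have : ∀ j, FiniteDimensional k (X ⟶ Y j) := fun j => hfin _ _
  let Φ : (X ⟶ E) →ₗ[k] ∀ j, (X ⟶ Y j) ⧸ radical k X (Y j) :=
    (LinearMap.pi fun j => (radical k X (Y j)).mkQ ∘ₗ LinearMap.proj j) ∘ₗ
      (homToBiproduct k e X).toLinearMap
  have hker : LinearMap.ker Φ = radical k X E := by
    ext f
    rw [LinearMap.mem_ker, mem_radical_iff_homToBiproduct e, funext_iff]
    exact forall_congr' fun j => Submodule.Quotient.mk_eq_zero _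
  have hrange : LinearMap.range Φ = ⊤ := by
    rw [LinearMap.range_eq_top]
    intro q
    choose g hg using fun j => Submodule.Quotient.mk_surjective _ (q j)
    refine ⟨(homToBiproduct k e X).symm g, funext fun j => ?_⟩
    rw [← hg j]
    simp [Φ]
  have h := LinearMap.finrank_range_add_finrank_ker Φ
  rw [hker, hrange, finrank_top, Module.finrank_pi_fintype] at h
  rw [← h, Finset.card_filter]
  congr 1
  exact Finset.sum_congr rfl fun j _ => (finrank_quotient_radical hfin hKS hX (hY j))

open Classical in
/-- The multiplicity of `X` as a summand of `E` is the codimension of the radical in `Hom(E, X)`. -/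
theorem finrank_hom_from_eq [IsAlgClosed k] (hfin : ∀ X Y : T, FiniteDimensional k (X ⟶ Y))
    (hKS : IsKrullSchmidt T) {n : ℕ} {Y : Fin n → T} {E : T} (e : E ≅ ⨁ Y)
    (hY : ∀ j, Indecomposable (Y j)) {X : T} (hX : Indecomposable X) :
    Module.finrank k (E ⟶ X) = (Finset.univ.filter fun j => Nonempty (X ≅ Y j)).card +
      Module.finrank k (radical k E X) := by
  have := hfin E X
  have : ∀ j, FiniteDimensional k (Y j ⟶ X) := fun j => hfin _ _
  let Φ : (E ⟶ X) →ₗ[k] ∀ j, (Y j ⟶ X) ⧸ radical k (Y j) X :=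
    (LinearMap.pi fun j => (radical k (Y j) X).mkQ ∘ₗ LinearMap.proj j) ∘ₗ
      (homFromBiproduct k e X).toLinearMap
  have hker : LinearMap.ker Φ = radical k E X := by
    ext f
    rw [LinearMap.mem_ker, mem_radical_iff_homFromBiproduct e, funext_iff]
    exact forall_congr' fun j => Submodule.Quotient.mk_eq_zero _
  have hrange : LinearMap.range Φ = ⊤ := by
    rw [LinearMap.range_eq_top]
    intro q
    choose g hg using fun j => Submodule.Quotient.mk_surjective _ (q j)
    refine ⟨(homFromBiproduct k e X).symm g, funext fun j => ?_⟩
    rw [← hg j]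
    simp [Φ]
  have h := LinearMap.finrank_range_add_finrank_ker Φ
  rw [hker, hrange, finrank_top, Module.finrank_pi_fintype] at h
  rw [← h, Finset.card_filter]
  congr 1
  refine Finset.sum_congr rfl fun j _ => ?_
  rw [finrank_quotient_radical hfin hKS (hY j) hX]
  exact if_congr ⟨fun ⟨i⟩ => ⟨i.symm⟩, fun ⟨i⟩ => ⟨i.symm⟩⟩ rfl rfl

end Count

section Mesh

variable {k : Type w} [Field k] {T : Type u} [Category.{v} T] [Preadditive T]
  [Linear k T] [HasZeroObject T] [HasShift T ℤ] [∀ n : ℤ, (shiftFunctor T n).Additive]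
  [Pretriangulated T]

namespace IsAlmostVanishing

variable {X E Z : T} {u : X ⟶ E} {v : E ⟶ Z} {w : Z ⟶ X⟦(1 : ℤ)⟧}

theorem left_mem_radical [IsLocalRing (End X)] (hX : Indecomposable X)
    (ht : Triangle.mk u v w ∈ distTriang T) (hw : IsAlmostVanishing w) : u ∈ radical k X E := by
  rw [mem_radical_iff_not_isSplitMono hX]
  intro hu
  exact hw.ne_zero (Triangle.mor₃_eq_zero_of_mono₁ _ ht (show Mono u from inferInstance))

theorem right_mem_radical [IsLocalRing (End Z)] (hZ : Indecomposable Z)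
    (ht : Triangle.mk u v w ∈ distTriang T) (hw : IsAlmostVanishing w) : v ∈ radical k E Z := by
  rw [mem_radical_iff_not_isSplitEpi hZ]
  intro hv
  exact hw.ne_zero (Triangle.mor₃_eq_zero_of_epi₂ _ ht (show Epi v from inferInstance))

theorem factors_right [IsLocalRing (End Z)] (hZ : Indecomposable Z)
    (ht : Triangle.mk u v w ∈ distTriang T) (hw : IsAlmostVanishing w) {U : T} {g : U ⟶ Z}
    (hg : g ∈ radical k U Z) : ∃ g' : U ⟶ E, g' ≫ v = g :=
  (factors_mor₂_iff ht g).2 (hw.2 _ g ((mem_radical_iff_not_isSplitEpi hZ).1 hg))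

theorem factors_left [IsLocalRing (End X)] (hX : Indecomposable X)
    (ht : Triangle.mk u v w ∈ distTriang T) (hw : IsAlmostVanishing w) {U : T} {g : X ⟶ U}
    (hg : g ∈ radical k X U) : ∃ g' : E ⟶ U, u ≫ g' = g :=
  (factors_mor₁_iff ht g).2 (hw.3 _ g ((mem_radical_iff_not_isSplitMono hX).1 hg))

/-- Composition with `E ⟶ Z` identifies `Hom(U, E)` modulo its radical with the irreducible
morphisms from `U` to `Z`. -/
theorem irrDim_right (hfin : ∀ X Y : T, FiniteDimensional k (X ⟶ Y)) (hX : Indecomposable X)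
    (hZ : Indecomposable Z) [IsLocalRing (End X)] [IsLocalRing (End Z)]
    (ht : Triangle.mk u v w ∈ distTriang T) (hw : IsAlmostVanishing w) (U : T) :
    irrDim k U Z + Module.finrank k (radical k U E) = Module.finrank k (U ⟶ E) := by
  have := hfin U E
  let Ψ : (U ⟶ E) →ₗ[k] radical k U Z ⧸ (radicalSq k U Z).submoduleOf (radical k U Z) :=
    Submodule.mkQ _ ∘ₗ LinearMap.codRestrict (radical k U Z) (Linear.rightComp k U v)
      fun f => comp_radical (right_mem_radical hZ ht hw) f
  have hmem : ∀ f, Ψ f = 0 ↔ f ≫ v ∈ radicalSq k U Z := fun f =>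
    Submodule.Quotient.mk_eq_zero _
  have hsq : radicalSq k U Z ≤ (radical k U E).map (Linear.rightComp k U v) := by
    refine Submodule.span_le.2 ?_
    rintro _ ⟨W, g, h, hg, hh, rfl⟩
    obtain ⟨h', rfl⟩ := factors_right hZ ht hw hh
    exact ⟨g ≫ h', radical_comp hg _, Category.assoc _ _ _⟩
  have hker : LinearMap.ker Ψ = radical k U E := by
    ext f
    rw [LinearMap.mem_ker, hmem]
    constructor
    · intro hf
      obtain ⟨r, hr, hrf⟩ := hsq hf
      have hz : v ≫ w = 0 := comp_distTriang_mor_zero₂₃ _ ht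
      obtain ⟨q, hq⟩ : ∃ q : U ⟶ X, f - r = q ≫ u :=
        Triangle.coyoneda_exact₂ _ ht (f - r)
          (show (f - r) ≫ v = 0 by rw [Preadditive.sub_comp, ← hrf]; exact sub_self _)
      rw [← sub_add_cancel f r, hq]
      exact Submodule.add_mem _ (comp_radical (left_mem_radical hX ht hw) q) hr
    · intro hf
      exact Submodule.subset_span ⟨E, f, v, hf, right_mem_radical hZ ht hw, rfl⟩
  have hrange : LinearMap.range Ψ = ⊤ := by
    rw [LinearMap.range_eq_top]
    intro q
    obtain ⟨⟨g, hg⟩, rfl⟩ := Submodule.Quotient.mk_surjective _ q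
    obtain ⟨f, rfl⟩ := factors_right hZ ht hw hg
    exact ⟨f, rfl⟩
  have h := LinearMap.finrank_range_add_finrank_ker Ψ
  rwa [hker, hrange, finrank_top] at h

/-- Composition with `X ⟶ E` identifies `Hom(E, U)` modulo its radical with the irreducible
morphisms from `X` to `U`. -/
theorem irrDim_left (hfin : ∀ X Y : T, FiniteDimensional k (X ⟶ Y)) (hX : Indecomposable X)
    (hZ : Indecomposable Z) [IsLocalRing (End X)] [IsLocalRing (End Z)]
    (ht : Triangle.mk u v w ∈ distTriang T) (hw : IsAlmostVanishing w) (U : T) :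
    irrDim k X U + Module.finrank k (radical k E U) = Module.finrank k (E ⟶ U) := by
  have := hfin E U
  let Ψ : (E ⟶ U) →ₗ[k] radical k X U ⧸ (radicalSq k X U).submoduleOf (radical k X U) :=
    Submodule.mkQ _ ∘ₗ LinearMap.codRestrict (radical k X U) (Linear.leftComp k U u)
      fun f => radical_comp (left_mem_radical hX ht hw) f
  have hmem : ∀ f, Ψ f = 0 ↔ u ≫ f ∈ radicalSq k X U := fun f =>
    Submodule.Quotient.mk_eq_zero _
  have hsq : radicalSq k X U ≤ (radical k E U).map (Linear.leftComp k U u) := by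
    refine Submodule.span_le.2 ?_
    rintro _ ⟨W, g, h, hg, hh, rfl⟩
    obtain ⟨g', rfl⟩ := factors_left hX ht hw hg
    exact ⟨g' ≫ h, comp_radical hh _, (Category.assoc _ _ _).symm⟩
  have hker : LinearMap.ker Ψ = radical k E U := by
    ext f
    rw [LinearMap.mem_ker, hmem]
    constructor
    · intro hf
      obtain ⟨r, hr, hrf⟩ := hsq hf
      obtain ⟨q, hq⟩ : ∃ q : Z ⟶ U, f - r = v ≫ q :=
        Triangle.yoneda_exact₂ _ ht (f - r)
          (show u ≫ (f - r) = 0 by rw [Preadditive.comp_sub, ← hrf]; exact sub_self _)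
      rw [← sub_add_cancel f r, hq]
      exact Submodule.add_mem _ (radical_comp (right_mem_radical hZ ht hw) q) hr
    · intro hf
      exact Submodule.subset_span ⟨E, u, f, left_mem_radical hX ht hw, hf, rfl⟩
  have hrange : LinearMap.range Ψ = ⊤ := by
    rw [LinearMap.range_eq_top]
    intro q
    obtain ⟨⟨g, hg⟩, rfl⟩ := Submodule.Quotient.mk_surjective _ q
    obtain ⟨f, rfl⟩ := factors_left hX ht hw hg
    exact ⟨f, rfl⟩
  have h := LinearMap.finrank_range_add_finrank_ker Ψ
  rwa [hker, hrange, finrank_top] at h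

/-- `dim Hom(U, -)` is subadditive on an Auslander–Reiten triangle. -/
theorem finrank_hom_le (hfin : ∀ X Y : T, FiniteDimensional k (X ⟶ Y))
    (ht : Triangle.mk u v w ∈ distTriang T) (U : T) :
    Module.finrank k (U ⟶ E) ≤ Module.finrank k (U ⟶ X) + Module.finrank k (U ⟶ Z) := by
  have := hfin U E
  have := hfin U X
  have := hfin U Z
  have h := LinearMap.finrank_range_add_finrank_ker (Linear.rightComp k U v)
  have h1 : LinearMap.ker (Linear.rightComp k U v) ≤ LinearMap.range (Linear.rightComp k U u) := by
    intro f hf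
    obtain ⟨q, hq⟩ := Triangle.coyoneda_exact₂ _ ht f hf
    exact ⟨q, hq.symm⟩
  have h2 := (Submodule.finrank_mono h1).trans (LinearMap.finrank_range_le _)
  have h3 := Submodule.finrank_le (LinearMap.range (Linear.rightComp k U v))
  omega

/-- The subadditivity is strict at `U = Z`, as the identity of `Z` does not lift to `E`. -/
theorem finrank_hom_lt (hfin : ∀ X Y : T, FiniteDimensional k (X ⟶ Y))
    (ht : Triangle.mk u v w ∈ distTriang T) (hw : IsAlmostVanishing w) :
    Module.finrank k (Z ⟶ E) < Module.finrank k (Z ⟶ X) + Module.finrank k (Z ⟶ Z) := by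
  have := hfin Z E
  have := hfin Z X
  have := hfin Z Z
  have h := LinearMap.finrank_range_add_finrank_ker (Linear.rightComp k Z v)
  have h1 : LinearMap.ker (Linear.rightComp k Z v) ≤ LinearMap.range (Linear.rightComp k Z u) := by
    intro f hf
    obtain ⟨q, hq⟩ := Triangle.coyoneda_exact₂ _ ht f hf
    exact ⟨q, hq.symm⟩
  have h2 := (Submodule.finrank_mono h1).trans (LinearMap.finrank_range_le _)
  have h3 : Module.finrank k (LinearMap.range (Linear.rightComp k Z v)) <
      Module.finrank k (Z ⟶ Z) := by
    refine Submodule.finrank_lt ?_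
    intro htop
    have hid : 𝟙 Z ∈ LinearMap.range (Linear.rightComp k Z v) := by rw [htop]; trivial
    obtain ⟨s, hs⟩ := hid
    have := (factors_mor₂_iff ht (𝟙 Z)).1 ⟨s, hs⟩
    exact hw.ne_zero (by rwa [Category.id_comp] at this)
  omega

end IsAlmostVanishing

open Classical in
/-- The numerical data of an Auslander–Reiten triangle `x ⟶ E ⟶ z`: the classes of the
indecomposable summands of `E`, counted with multiplicity, are the irreducible predecessors of `z`
and the irreducible successors of `x`, and `dim Hom(u, -)` is subadditive. -/
theorem exists_mesh [IsAlgClosed k] (hfin : ∀ X Y : T, FiniteDimensional k (X ⟶ Y))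
    (hKS : IsKrullSchmidt T) {X Z : T} (hX : Indecomposable X) (hZ : Indecomposable Z)
    {w : Z ⟶ X⟦(1 : ℤ)⟧} (hw : IsAlmostVanishing w) :
    ∃ (n : ℕ) (E : Fin n → IndecClass T),
      (∀ (U : T) (hU : Indecomposable U), irrDim k U Z =
        (Finset.univ.filter fun j => E j = isoClass hU).card) ∧
      (∀ (U : T) (hU : Indecomposable U), irrDim k X U =
        (Finset.univ.filter fun j => E j = isoClass hU).card) ∧
      ∀ U : T, ∑ j, Module.finrank k (U ⟶ (E j).rep.1) + (if U = Z then 1 else 0) ≤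
        Module.finrank k (U ⟶ X) + Module.finrank k (U ⟶ Z) := by
  have := hKS.2 X hX
  have := hKS.2 Z hZ
  obtain ⟨E, u, v, ht⟩ := distinguished_cocone_triangle₂ w
  obtain ⟨n, Y, hY, ⟨e⟩⟩ := hKS.1 E
  have hcls : ∀ (U : T) (hU : Indecomposable U), (Finset.univ.filter fun j =>
      isoClass (hY j) = isoClass hU) =
      Finset.univ.filter fun j => Nonempty (U ≅ Y j) := fun U hU => by
    refine Finset.filter_congr fun j _ => ?_
    rw [isoClass_eq_iff]
    exact ⟨fun ⟨i⟩ => ⟨i.symm⟩, fun ⟨i⟩ => ⟨i.symm⟩⟩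
  refine ⟨n, fun j => isoClass (hY j), fun U hU => ?_, fun U hU => ?_, fun U => ?_⟩
  · rw [hcls U hU]
    have h1 := hw.irrDim_right hfin hX hZ ht U
    have h2 := finrank_hom_to_eq hfin hKS e hY hU
    omega
  · rw [hcls U hU]
    have h1 := hw.irrDim_left hfin hX hZ ht U
    have h2 := finrank_hom_from_eq hfin hKS e hY hU
    omega
  · have : ∀ j, FiniteDimensional k (U ⟶ Y j) := fun j => hfin _ _
    have h1 : ∑ j, Module.finrank k (U ⟶ (isoClass (hY j)).rep.1) =
        Module.finrank k (U ⟶ E) := by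
      rw [(homToBiproduct k e U).finrank_eq, Module.finrank_pi_fintype]
      refine Finset.sum_congr rfl fun j _ => ?_
      obtain ⟨i⟩ := IndecClass.nonempty_iso_rep (hY j)
      exact (Linear.homCongr k (Iso.refl U) i.symm).finrank_eq
    rw [h1]
    split_ifs with h
    · subst h
      exact hw.finrank_hom_lt hfin ht
    · exact IsAlmostVanishing.finrank_hom_le hfin ht U

end Mesh

/-! ### The Auslander–Reiten quiver -/

section Quiver

variable {k : Type w} [Field k] {T : Type u} [Category.{v} T] [Preadditive T]
  [Linear k T] [HasZeroObject T] [HasShift T ℤ] [∀ n : ℤ, (shiftFunctor T n).Additive]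
  [Pretriangulated T]

/-- `irrDim` is invariant under isomorphisms, as it counts summands in the middle term of an
Auslander–Reiten triangle. -/
theorem irrDim_congr [IsAlgClosed k] (hfin : ∀ X Y : T, FiniteDimensional k (X ⟶ Y))
    (hKS : IsKrullSchmidt T) (hLF : IsLocallyFinite T) {X X' Y Y' : T} (hX : Indecomposable X)
    (hX' : Indecomposable X') (hY : Indecomposable Y) (hY' : Indecomposable Y') (e : X ≅ X')
    (f : Y ≅ Y') : irrDim k X Y = irrDim k X' Y' := by
  classical
  obtain ⟨A, hA, w, hw⟩ := exists_isAlmostVanishing_source hfin hKS hLF hY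
  obtain ⟨n, E, h1, -, -⟩ := exists_mesh hfin hKS hA hY hw
  obtain ⟨B, hB, w', hw'⟩ := exists_isAlmostVanishing_target hfin hKS hLF hX'
  obtain ⟨m, F, -, h2, -⟩ := exists_mesh hfin hKS hX' hB hw'
  rw [h1 X hX, (isoClass_eq_iff hX hX').2 ⟨e⟩, ← h1 X' hX', h2 Y hY,
    (isoClass_eq_iff hY hY').2 ⟨f⟩, ← h2 Y' hY']

/-- `x` and `z` are the ends of an Auslander–Reiten triangle `x ⟶ E ⟶ z`. -/
def IsTranslate (x z : IndecClass T) : Prop :=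
  ∃ w : z.rep.1 ⟶ x.rep.1⟦(1 : ℤ)⟧, IsAlmostVanishing w

theorem isTranslate_isoClass_iff {X Z : T} (hX : Indecomposable X) (hZ : Indecomposable Z) :
    IsTranslate (isoClass hX) (isoClass hZ) ↔ ∃ w : Z ⟶ X⟦(1 : ℤ)⟧, IsAlmostVanishing w := by
  obtain ⟨e⟩ := IndecClass.nonempty_iso_rep hX
  obtain ⟨f⟩ := IndecClass.nonempty_iso_rep hZ
  exact ⟨fun ⟨w, hw⟩ => ⟨_, hw.of_iso e.symm f⟩, fun ⟨w, hw⟩ => ⟨_, hw.of_iso e f.symm⟩⟩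

theorem isTranslate_iff_isARTriangle {X Z : T} (hX : Indecomposable X) (hZ : Indecomposable Z) :
    IsTranslate (isoClass hX) (isoClass hZ) ↔
      ∃ (Y : T) (u : X ⟶ Y) (v : Y ⟶ Z) (w : Z ⟶ X⟦(1 : ℤ)⟧),
        IsARTriangle (Triangle.mk u v w) := by
  rw [isTranslate_isoClass_iff]
  constructor
  · rintro ⟨w, hw⟩
    obtain ⟨Y, u, v, ht⟩ := distinguished_cocone_triangle₂ w
    exact ⟨Y, u, v, w, (isARTriangle_iff ht).2 ⟨hX, hZ, hw⟩⟩
  · rintro ⟨Y, u, v, w, h⟩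
    exact ⟨w, ((isARTriangle_iff h.distinguished).1 h).2.2⟩

theorem existsUnique_isTranslate_left (hfin : ∀ X Y : T, FiniteDimensional k (X ⟶ Y))
    (hKS : IsKrullSchmidt T) (hLF : IsLocallyFinite T) (z : IndecClass T) :
    ∃! x, IsTranslate x z := by
  obtain ⟨X, hX, w, hw⟩ := exists_isAlmostVanishing_source hfin hKS hLF z.rep.2
  have h1 : IsTranslate (isoClass hX) z := by
    rw [← z.isoClass_rep, isTranslate_isoClass_iff]
    exact ⟨w, hw⟩
  refine ⟨_, h1, ?_⟩
  rintro y ⟨w', hw'⟩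
  obtain ⟨w, hw⟩ := h1
  have := hKS.2 _ y.rep.2
  have := hKS.2 _ (isoClass hX).rep.2
  rw [← y.isoClass_rep, ← (isoClass hX).isoClass_rep, isoClass_eq_iff]
  exact hw'.nonempty_iso_left hw

theorem existsUnique_isTranslate_right (hfin : ∀ X Y : T, FiniteDimensional k (X ⟶ Y))
    (hKS : IsKrullSchmidt T) (hLF : IsLocallyFinite T) (x : IndecClass T) :
    ∃! z, IsTranslate x z := by
  obtain ⟨Z, hZ, w, hw⟩ := exists_isAlmostVanishing_target hfin hKS hLF x.rep.2
  have h1 : IsTranslate x (isoClass hZ) := by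
    rw [← x.isoClass_rep, isTranslate_isoClass_iff]
    exact ⟨w, hw⟩
  refine ⟨_, h1, ?_⟩
  rintro y ⟨w', hw'⟩
  obtain ⟨w, hw⟩ := h1
  have := hKS.2 _ y.rep.2
  have := hKS.2 _ (isoClass hZ).rep.2
  rw [← y.isoClass_rep, ← (isoClass hZ).isoClass_rep, isoClass_eq_iff]
  exact hw'.nonempty_iso_right hw

open Classical in
/-- The mesh relation of `exists_mesh` in terms of isomorphism classes. -/
theorem IsTranslate.exists_mesh [IsAlgClosed k] (hfin : ∀ X Y : T, FiniteDimensional k (X ⟶ Y))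
    (hKS : IsKrullSchmidt T) {x z : IndecClass T} (h : IsTranslate x z) :
    ∃ (n : ℕ) (E : Fin n → IndecClass T),
      (∀ c : IndecClass T, irrDim k c.rep.1 z.rep.1 =
        (Finset.univ.filter fun j => E j = c).card) ∧
      (∀ c : IndecClass T, irrDim k x.rep.1 c.rep.1 =
        (Finset.univ.filter fun j => E j = c).card) ∧
      ∀ c : IndecClass T, ∑ j, Module.finrank k (c.rep.1 ⟶ (E j).rep.1) +
        (if z = c then 1 else 0) ≤
        Module.finrank k (c.rep.1 ⟶ x.rep.1) + Module.finrank k (c.rep.1 ⟶ z.rep.1) := by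
  obtain ⟨w, hw⟩ := h
  obtain ⟨n, E, h1, h2, h3⟩ := AuslanderReiten.exists_mesh hfin hKS x.rep.2 z.rep.2 hw
  refine ⟨n, E, fun c => ?_, fun c => ?_, fun c => ?_⟩
  · rw [h1 _ c.rep.2, c.isoClass_rep]
  · rw [h2 _ c.rep.2, c.isoClass_rep]
  · refine le_trans (Nat.add_le_add_left ?_ _) (h3 c.rep.1)
    split_ifs with h h' <;> first | omega | exact (h' (by rw [h])).elim

/-- The Auslander–Reiten quiver exists, and for every vertex `u` the dimensions `dim Hom(u, -)` form
a finitely supported function that is subadditive on all meshes, strictly so on the mesh that ends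
at `u`. -/
theorem exists_arQuiver [IsAlgClosed k] (hfin : ∀ X Y : T, FiniteDimensional k (X ⟶ Y))
    (hKS : IsKrullSchmidt T) (hLF : IsLocallyFinite T) :
    ∃ Γ : ValuedTranslationQuiver (IndecClass T), IsARQuiver k Γ ∧
      ∀ u : IndecClass T, ∃ φ : IndecClass T → ℕ, {x | φ x ≠ 0}.Finite ∧
        ∀ (y : IndecClass T) (s : Finset (IndecClass T)),
          ∑ x ∈ s, Γ.a x y * φ x ≤ φ (Γ.τ y) + φ y ∧
          (y = u → ∑ x ∈ s, Γ.a x y * φ x + 1 ≤ φ (Γ.τ y) + φ y) := by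
  classical
  choose t ht htu using existsUnique_isTranslate_left hfin hKS hLF
  choose t' ht' htu' using existsUnique_isTranslate_right hfin hKS hLF
  have hpos : ∀ {n : ℕ} (E : Fin n → IndecClass T) (c : IndecClass T),
      0 < (Finset.univ.filter fun j => E j = c).card → c ∈ Set.range E := fun E c h => by
    obtain ⟨j, hj⟩ := Finset.card_pos.1 h
    exact ⟨j, (Finset.mem_filter.1 hj).2⟩
  have hσ : ∀ x y : IndecClass T, irrDim k (t y).rep.1 x.rep.1 = irrDim k x.rep.1 y.rep.1 := by
    intro x y
    obtain ⟨n, E, h1, h2, -⟩ := (ht y).exists_mesh hfin hKS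
    rw [h1, h2]
  let Γ : ValuedTranslationQuiver (IndecClass T) :=
    { Arrow := fun x y => 0 < irrDim k x.rep.1 y.rep.1
      τ := ⟨t, t', fun z => (htu' _ _ (ht z)).symm, fun x => (htu _ _ (ht' x)).symm⟩
      finite_succ := fun x => by
        obtain ⟨n, E, -, h, -⟩ := (ht' x).exists_mesh hfin hKS
        refine (Set.finite_range E).subset fun y hy => ?_
        rw [Set.mem_ofPred_eq, h] at hy
        exact hpos E y hy
      finite_pred := fun x => by
        obtain ⟨n, E, h, -, -⟩ := (ht x).exists_mesh hfin hKS
        refine (Set.finite_range E).subset fun y hy => ?_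
        rw [Set.mem_ofPred_eq, h] at hy
        exact hpos E y hy
      arrow_τ := fun x y => by
        change 0 < irrDim k (t x).rep.1 y.rep.1 ↔ _
        rw [hσ]
      a := fun x y => irrDim k x.rep.1 y.rep.1
      a_pos_iff := fun x y => Iff.rfl
      a_σ := fun x y => hσ x y }
  have hτ : ∀ x z : IndecClass T, Γ.τ z = x ↔ IsTranslate x z := fun x z =>
    ⟨fun h => by rw [← h]; exact ht z, fun h => (htu _ _ h).symm⟩
  refine ⟨Γ, ⟨fun X Y => ?_, fun X Z => ?_⟩, fun u => ?_⟩
  · obtain ⟨e⟩ := IndecClass.nonempty_iso_rep X.2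
    obtain ⟨f⟩ := IndecClass.nonempty_iso_rep Y.2
    exact irrDim_congr hfin hKS hLF X.cls.rep.2 X.2 Y.cls.rep.2 Y.2 e.symm f.symm
  · exact (hτ _ _).trans (isTranslate_iff_isARTriangle X.2 Z.2)
  · refine ⟨fun x => Module.finrank k (u.rep.1 ⟶ x.rep.1), ?_, fun y s => ?_⟩
    · refine (hLF u.rep).subset fun x hx => ⟨x.rep, x.cls_rep, ?_⟩
      by_contra! h
      apply hx
      have : Subsingleton (u.rep.1 ⟶ x.rep.1) := ⟨fun f g => by rw [h f, h g]⟩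
      exact Module.finrank_zero_of_subsingleton
    · obtain ⟨n, E, h1, -, h3⟩ := (ht y).exists_mesh hfin hKS
      have hle : ∑ x ∈ s, Γ.a x y * Module.finrank k (u.rep.1 ⟶ x.rep.1) ≤
          ∑ j, Module.finrank k (u.rep.1 ⟶ (E j).rep.1) := by
        calc ∑ x ∈ s, Γ.a x y * Module.finrank k (u.rep.1 ⟶ x.rep.1)
            = ∑ x ∈ s, ∑ j ∈ Finset.univ.filter (fun j => E j = x),
                Module.finrank k (u.rep.1 ⟶ (E j).rep.1) := by
              refine Finset.sum_congr rfl fun x _ => ?_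
              rw [Finset.sum_congr rfl (g := fun _ => Module.finrank k (u.rep.1 ⟶ x.rep.1))
                fun j hj => by rw [(Finset.mem_filter.1 hj).2], Finset.sum_const, smul_eq_mul]
              exact congrArg (· * _) (h1 x)
          _ = ∑ j ∈ Finset.univ.filter (fun j => E j ∈ s),
                Module.finrank k (u.rep.1 ⟶ (E j).rep.1) :=
              Finset.sum_fiberwise_eq_sum_filter _ _ _ _
          _ ≤ _ := Finset.sum_le_sum_of_subset (Finset.filter_subset _ _)
      have h4 := h3 u
      rw [show Γ.τ y = t y from rfl]
      beta_reduce
      refine ⟨by omega, fun h => ?_⟩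
      rw [if_pos h] at h4
      omega

end Quiver

end AuslanderReiten

/-! ### Subadditive functions on translation quivers -/

theorem StableTranslationQuiver.arrow_zpow_τ {V : Type u} (Q : StableTranslationQuiver V) (n : ℤ)
    (x y : V) : Q.Arrow ((Q.τ ^ n) x) ((Q.τ ^ n) y) ↔ Q.Arrow x y := by
  have h1 : ∀ x y, Q.Arrow (Q.τ x) (Q.τ y) ↔ Q.Arrow x y := fun x y => by
    rw [Q.arrow_τ, Q.arrow_τ]
  induction n generalizing x y with
  | zero => simp
  | succ n ih =>
    rw [zpow_add_one, Equiv.Perm.mul_apply, Equiv.Perm.mul_apply]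
    exact (ih _ _).trans (h1 x y)
  | pred n ih =>
    refine Iff.trans ?_ (ih x y)
    rw [← h1 ((Q.τ ^ (-(n : ℤ) - 1)) x), ← Equiv.Perm.mul_apply,
      ← Equiv.Perm.mul_apply, ← zpow_one_add, add_sub_cancel]

namespace ValuedTranslationQuiver

variable {V : Type u} (Q : ValuedTranslationQuiver V)

/-- `Q` has at most one connected component. -/
def IsConnected : Prop := ∀ x y, Q.connectedSetoid x y

variable {Q}

theorem IsConnected.induction (hQ : Q.IsConnected) {p : V → Prop} (hτ : ∀ x, p (Q.τ x) ↔ p x)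
    (ha : ∀ x y, Q.Arrow x y → p x → p y) {x : V} (hx : p x) (y : V) : p y := by
  have key : ∀ x y, Relation.EqvGen (fun x y => Q.Arrow x y ∨ Q.τ x = y) x y → (p x ↔ p y) := by
    intro x y h
    induction h with
    | rel x y h =>
      rcases h with h | rfl
      · exact ⟨ha x y h, fun hy => ha _ _ ((Q.arrow_τ y x).2 h) ((hτ y).2 hy)⟩
      · exact (hτ x).symm
    | refl => exact Iff.rfl
    | symm _ _ _ ih => exact ih.symm
    | trans _ _ _ _ _ ih1 ih2 => exact ih1.trans ih2
  exact (key x y (hQ x y)).1 hx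

theorem a_τ_τ (x y : V) : Q.a (Q.τ x) (Q.τ y) = Q.a x y := by
  rw [Q.a_σ, Q.a_σ]

theorem a_zpow_τ (n : ℤ) (x y : V) : Q.a ((Q.τ ^ n) x) ((Q.τ ^ n) y) = Q.a x y := by
  induction n generalizing x y with
  | zero => simp
  | succ n ih => rw [zpow_add_one, Equiv.Perm.mul_apply, Equiv.Perm.mul_apply, ih, a_τ_τ]
  | pred n ih =>
    rw [← ih x y, ← a_τ_τ ((Q.τ ^ (-(n : ℤ) - 1)) x), ← Equiv.Perm.mul_apply,
      ← Equiv.Perm.mul_apply, ← zpow_one_add, add_sub_cancel]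

/-- `φ` is a finitely supported function on the vertices that is subadditive on all meshes
`τ y → x → y`, and strictly so on the mesh that ends at `u`. The functions `dim Hom(u, -)` on the
Auslander–Reiten quiver are the motivating example. The sums over arbitrary finite sets `s` amount
to the sum over `y⁻`, as `a x y = 0` for the other vertices `x`. -/
def IsHomDim (Q : ValuedTranslationQuiver V) (u : V) (φ : V → ℕ) : Prop :=
  {x | φ x ≠ 0}.Finite ∧ ∀ (y : V) (s : Finset V), ∑ x ∈ s, Q.a x y * φ x ≤ φ (Q.τ y) + φ y ∧
    (y = u → ∑ x ∈ s, Q.a x y * φ x + 1 ≤ φ (Q.τ y) + φ y)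

/-- In a connected quiver every `τ`-orbit meets the support of `φ`: where `φ` vanishes on a
`τ`-orbit, it also vanishes on the neighbouring `τ`-orbits. -/
theorem IsHomDim.exists_zpow_ne_zero (hQ : Q.IsConnected) {u : V} {φ : V → ℕ}
    (hφ : Q.IsHomDim u φ) (y : V) : ∃ n : ℤ, φ ((Q.τ ^ n) y) ≠ 0 := by
  by_contra! h
  have hall : ∀ y, ∀ n : ℤ, φ ((Q.τ ^ n) y) = 0 := by
    refine fun z => hQ.induction (p := fun z => ∀ n : ℤ, φ ((Q.τ ^ n) z) = 0) ?_ ?_ h z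
    · intro x
      refine ⟨fun h n => ?_, fun h n => ?_⟩
      · have := h (n - 1)
        rwa [← Equiv.Perm.mul_apply, ← zpow_add_one, sub_add_cancel] at this
      · rw [← Equiv.Perm.mul_apply, ← zpow_add_one]
        exact h _
    · intro x y hxy hx n
      have h1 := (hφ.2 ((Q.τ ^ (n - 1)) x) {(Q.τ ^ n) y}).1
      rw [hx, ← Equiv.Perm.mul_apply, ← zpow_one_add, hx, Finset.sum_singleton] at h1
      have h2 : 0 < Q.a ((Q.τ ^ n) y) ((Q.τ ^ (n - 1)) x) := by
        rw [Q.a_pos_iff, ← sub_add_cancel n 1, zpow_add_one, add_sub_cancel_right,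
          (Commute.zpow_self Q.τ (n - 1)).eq, Equiv.Perm.mul_apply, Q.arrow_τ, Q.arrow_zpow_τ]
        exact hxy
      by_contra h3
      have := Nat.mul_pos h2 (Nat.pos_of_ne_zero h3)
      omega
  have h1 := (hφ.2 u ∅).2 rfl
  have h2 := hall u 0
  have h3 := hall u 1
  simp only [zpow_zero, zpow_one, Equiv.Perm.coe_one, id] at h2 h3
  simp [h2, h3] at h1

theorem finite_range_zpow_apply {τ : Equiv.Perm V} {v : V} {m : ℕ} (hm : 0 < m)
    (h : (τ ^ m) v = v) : (Set.range fun n : ℤ => (τ ^ n) v).Finite := by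
  refine (Set.finite_range fun i : Fin m => (τ ^ (i : ℕ)) v).subset ?_
  rintro _ ⟨n, rfl⟩
  have hm' : (0 : ℤ) < m := by exact_mod_cast hm
  refine ⟨⟨(n % m).toNat, by have := Int.emod_lt_of_pos n hm'; omega⟩, ?_⟩
  have h1 : ((τ ^ m) ^ (n / m)) v = v := Equiv.Perm.zpow_apply_eq_self_of_apply_eq_self h _
  have h2 : τ ^ n = τ ^ ((n % m).toNat) * (τ ^ m) ^ (n / m) := by
    rw [← zpow_natCast, ← zpow_natCast, ← zpow_mul, ← zpow_add, Int.toNat_of_nonneg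
      (Int.emod_nonneg _ hm'.ne'), Int.emod_add_mul_ediv]
  change _ = (τ ^ n) v
  rw [h2, Equiv.Perm.mul_apply, h1]

/-- In an infinite connected quiver no vertex is `τ`-periodic: as the quiver is locally finite,
periodicity would spread to all vertices, and there are only finitely many `τ`-orbits. -/
theorem IsHomDim.eq_zero_of_zpow_apply_eq (hQ : Q.IsConnected) [Infinite V] {u : V} {φ : V → ℕ}
    (hφ : Q.IsHomDim u φ) {y : V} {n : ℤ} (h : (Q.τ ^ n) y = y) : n = 0 := by
  by_contra hn
  have hy : ∃ m : ℕ, 0 < m ∧ (Q.τ ^ m) y = y := by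
    refine ⟨n.natAbs, Int.natAbs_pos.2 hn, ?_⟩
    rw [← zpow_natCast]
    rcases Int.natAbs_eq n with h' | h'
    · rwa [← h']
    · rw [← neg_eq_iff_eq_neg.2 h', zpow_neg, Equiv.Perm.inv_eq_iff_eq]
      exact h.symm
  have hper : ∀ z, ∃ m : ℕ, 0 < m ∧ (Q.τ ^ m) z = z := by
    refine hQ.induction ?_ ?_ hy
    · intro x
      refine exists_congr fun m => and_congr_right fun _ => ?_
      rw [← Equiv.Perm.mul_apply, (Commute.pow_self Q.τ m).eq, Equiv.Perm.mul_apply]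
      exact Q.τ.injective.eq_iff
    · rintro x z hxz ⟨m, hm, hx⟩
      have hmem : ∀ i : ℕ, (Q.τ ^ (m * i)) z ∈ {z | Q.Arrow x z} := by
        intro i
        have hx' : (Q.τ ^ (m * i)) x = x := by
          rw [pow_mul]
          exact Equiv.Perm.pow_apply_eq_self_of_apply_eq_self hx i
        have h1 := (Q.arrow_zpow_τ ((m * i : ℕ) : ℤ) x z).2 hxz
        rwa [zpow_natCast, hx'] at h1
      have key : ∀ i j : ℕ, i < j → (Q.τ ^ (m * i)) z = (Q.τ ^ (m * j)) z →
          ∃ m : ℕ, 0 < m ∧ (Q.τ ^ m) z = z := by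
        intro i j hij he
        refine ⟨m * (j - i), Nat.mul_pos hm (Nat.sub_pos_of_lt hij), ?_⟩
        apply (Q.τ ^ (m * i)).injective
        rw [← Equiv.Perm.mul_apply, ← pow_add, ← Nat.mul_add, Nat.add_sub_cancel' hij.le, he]
      obtain ⟨i, -, j, -, hij, he⟩ := Set.infinite_univ.exists_ne_map_eq_of_mapsTo
        (f := fun i : ℕ => (Q.τ ^ (m * i)) z) (fun i _ => hmem i) (Q.finite_succ x)
      rcases lt_or_gt_of_ne hij with h | h
      · exact key i j h he
      · exact key j i h he.symm
  refine Set.infinite_univ (α := V) ((hφ.1.biUnion (t := fun v => Set.range fun n : ℤ =>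
    (Q.τ ^ n) v) fun v _ => ?_).subset fun y _ => ?_)
  · obtain ⟨m, hm, h⟩ := hper v
    exact finite_range_zpow_apply hm h
  · obtain ⟨n, hn⟩ := hφ.exists_zpow_ne_zero hQ y
    refine Set.mem_biUnion (x := (Q.τ ^ n) y) hn ⟨-n, ?_⟩
    simp

theorem IsHomDim.finite_orbit_support (hQ : Q.IsConnected) {u : V} {φ : V → ℕ}
    (hφ : Q.IsHomDim u φ) (y : V) :
    (Function.support fun h : Subgroup.zpowers Q.τ => φ (h.1 y)).Finite := by
  rcases finite_or_infinite V with hV | hV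
  · exact Set.toFinite _
  · refine Set.Finite.of_finite_image (f := fun h : Subgroup.zpowers Q.τ => h.1 y)
      (hφ.1.subset ?_) ?_
    · rintro _ ⟨h, hh, rfl⟩
      exact hh
    · rintro ⟨_, a, rfl⟩ - ⟨_, b, rfl⟩ - hab
      have h1 : (Q.τ ^ (-b + a)) y = y := by
        rw [zpow_add, Equiv.Perm.mul_apply, zpow_neg, Equiv.Perm.inv_eq_iff_eq]
        exact hab
      have h2 := hφ.eq_zero_of_zpow_apply_eq hQ h1
      have h3 : a = b := by omega
      subst h3
      rfl

/-- The sum of `φ (h y)` over all elements `h` of the group generated by `τ`, so that every vertex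
of a finite orbit may count several times. With the sum over the group instead of the orbit, the
inequalities for the translates of a mesh can be added up although the `τ`-orbits that the mesh
meets may have different lengths. The sum is finite by `IsHomDim.finite_orbit_support`. -/
noncomputable def orbitSum (Q : ValuedTranslationQuiver V) (φ : V → ℕ) (y : V) : ℕ :=
  ∑ᶠ h : Subgroup.zpowers Q.τ, φ (h.1 y)

theorem orbitSum_τ (φ : V → ℕ) (y : V) : Q.orbitSum φ (Q.τ y) = Q.orbitSum φ y := by
  let t : Subgroup.zpowers Q.τ := ⟨Q.τ, Subgroup.mem_zpowers _⟩
  exact finsum_comp_equiv (Equiv.mulRight t) (f := fun h : Subgroup.zpowers Q.τ => φ (h.1 y))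

theorem IsHomDim.sum_mul_orbitSum_le (hQ : Q.IsConnected) {u : V} {φ : V → ℕ}
    (hφ : Q.IsHomDim u φ) (y : V) (s : Finset V) :
    ∑ x ∈ s, Q.a x y * Q.orbitSum φ x ≤ 2 * Q.orbitSum φ y ∧
      ((∃ n : ℤ, (Q.τ ^ n) y = u) →
        ∑ x ∈ s, Q.a x y * Q.orbitSum φ x + 1 ≤ 2 * Q.orbitSum φ y) := by
  classical
  have hfin := hφ.finite_orbit_support hQ
  have hle : ∀ (z : V) (K : Finset (Subgroup.zpowers Q.τ)),
      ∑ h ∈ K, φ (h.1 z) ≤ Q.orbitSum φ z := by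
    intro z K
    rw [orbitSum, finsum_eq_sum_of_support_subset (s := K ∪ (hfin z).toFinset) _ (by simp)]
    exact Finset.sum_le_sum_of_subset Finset.subset_union_left
  let K₀ : Finset (Subgroup.zpowers Q.τ) := s.biUnion fun x => (hfin x).toFinset
  have heq : ∀ K, K₀ ⊆ K → ∑ x ∈ s, Q.a x y * Q.orbitSum φ x =
      ∑ h ∈ K, ∑ x ∈ s, Q.a x y * φ (h.1 x) := by
    intro K hK
    rw [Finset.sum_comm]
    refine Finset.sum_congr rfl fun x hx => ?_
    rw [← Finset.mul_sum, orbitSum, finsum_eq_sum_of_support_subset]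
    intro h hh
    exact hK (Finset.mem_biUnion.2 ⟨x, hx, (hfin x).mem_toFinset.2 hh⟩)
  have hmesh : ∀ h : Subgroup.zpowers Q.τ,
      ∑ x ∈ s, Q.a x y * φ (h.1 x) ≤ φ (h.1 (Q.τ y)) + φ (h.1 y) ∧
      (h.1 y = u → ∑ x ∈ s, Q.a x y * φ (h.1 x) + 1 ≤ φ (h.1 (Q.τ y)) + φ (h.1 y)) := by
    rintro ⟨_, n, rfl⟩
    have h1 := hφ.2 ((Q.τ ^ n) y) (s.map (Q.τ ^ n).toEmbedding)
    rw [Finset.sum_map, ← Equiv.Perm.mul_apply, ← (Commute.zpow_self Q.τ n).eq] at h1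
    simpa [a_zpow_τ] using h1
  have h2 : 2 * Q.orbitSum φ y = Q.orbitSum φ (Q.τ y) + Q.orbitSum φ y := by
    rw [orbitSum_τ, two_mul]
  rw [h2]
  constructor
  · rw [heq K₀ subset_rfl]
    refine le_trans (Finset.sum_le_sum fun h _ => (hmesh h).1) ?_
    rw [Finset.sum_add_distrib]
    exact add_le_add (hle _ _) (hle _ _)
  · rintro ⟨n, hn⟩
    let h₀ : Subgroup.zpowers Q.τ := ⟨Q.τ ^ n, n, rfl⟩
    rw [heq (insert h₀ K₀) (Finset.subset_insert _ _)]
    have hlt : ∑ h ∈ insert h₀ K₀, ∑ x ∈ s, Q.a x y * φ (h.1 x) <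
        ∑ h ∈ insert h₀ K₀, (φ (h.1 (Q.τ y)) + φ (h.1 y)) :=
      Finset.sum_lt_sum (fun h _ => (hmesh h).1)
        ⟨h₀, Finset.mem_insert_self _ _, (hmesh h₀).2 hn⟩
    refine le_trans (Nat.succ_le_of_lt hlt) ?_
    rw [Finset.sum_add_distrib]
    exact add_le_add (hle _ _) (hle _ _)

/-- A `τ`-invariant function on the vertices that is strictly subadditive at every vertex. It may be
read as a function on the graph of `τ`-orbits; such a function exists only on Dynkin graphs. -/
structure IsSubadditive (Q : ValuedTranslationQuiver V) (F : V → ℕ) : Prop where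
  τ : ∀ x, F (Q.τ x) = F x
  sum_lt : ∀ (y : V) (s : Finset V), ∑ x ∈ s, Q.a y x * F x + 1 ≤ 2 * F y

/-- The support of one of the functions `φ` contains a member `u` of every `τ`-orbit. The sum of
the orbit sums for all these `u` is subadditive, and strictly so everywhere. -/
theorem exists_isSubadditive (hQ : Q.IsConnected) (hdim : ∀ u, ∃ φ, Q.IsHomDim u φ) :
    ∃ F, Q.IsSubadditive F := by
  classical
  rcases isEmpty_or_nonempty V with hV | ⟨⟨u₀⟩⟩
  · exact ⟨fun _ => 0, fun x => (IsEmpty.false x).elim, fun x => (IsEmpty.false x).elim⟩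
  choose φ hφ using hdim
  refine ⟨fun x => ∑ u ∈ (hφ u₀).1.toFinset, Q.orbitSum (φ u) x, fun x => ?_, fun y s => ?_⟩
  · exact Finset.sum_congr rfl fun u _ => orbitSum_τ _ _
  · -- The statement about successors is the one about predecessors, translated by `τ`.
    have hs : ∑ x ∈ s, Q.a y x * ∑ u ∈ (hφ u₀).1.toFinset, Q.orbitSum (φ u) x =
        ∑ u ∈ (hφ u₀).1.toFinset, ∑ x ∈ s.map Q.τ.toEmbedding, Q.a x y * Q.orbitSum (φ u) x := by
      simp only [Finset.sum_map, Equiv.coe_toEmbedding, Q.a_σ, orbitSum_τ, Finset.mul_sum]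
      exact Finset.sum_comm
    obtain ⟨n, hn⟩ := (hφ u₀).exists_zpow_ne_zero hQ y
    rw [hs, Finset.mul_sum]
    refine Nat.succ_le_of_lt (Finset.sum_lt_sum (fun u _ =>
      ((hφ u).sum_mul_orbitSum_le hQ y _).1) ⟨(Q.τ ^ n) y, ?_, ?_⟩)
    · rw [Set.Finite.mem_toFinset]
      exact hn
    · exact ((hφ _).sum_mul_orbitSum_le hQ y _).2 ⟨n, rfl⟩

end ValuedTranslationQuiver

/-! ### Slices of translation quivers -/

namespace StableTranslationQuiver

variable {V : Type u} {Q : StableTranslationQuiver V}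

theorem arrow_symm_τ (x y : V) : Q.Arrow y (Q.τ.symm x) ↔ Q.Arrow x y := by
  rw [← Q.arrow_τ, Equiv.apply_symm_apply]

/-- A map `π` from the vertices of an oriented graph with arrows `A` to the vertices of `Q` that
maps the neighbours of each vertex `i` bijectively to `(π i)⁺`, where a successor `j` of `i` is
mapped to `π j`, and a predecessor `j` of `i` to `τ⁻¹ (π j)`. -/
structure IsSlice (Q : StableTranslationQuiver V) {ι : Type*} (A : ι → ι → Prop) (π : ι → V) :
    Prop where
  arrow : ∀ i j, A i j → Q.Arrow (π i) (π j)
  inj_succ : ∀ i j j', A i j → A i j' → π j = π j' → j = j'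
  inj_pred : ∀ i j j', A j i → A j' i → π j = π j' → j = j'
  ne : ∀ i j j', A i j → A j' i → π j ≠ Q.τ.symm (π j')
  surj : ∀ i z, Q.Arrow (π i) z → (∃ j, A i j ∧ π j = z) ∨ ∃ j, A j i ∧ Q.τ.symm (π j) = z

/-- A sectional path `v 0 → v 1 → ⋯ → v (m + 1)` that has no branches at `v 1, …, v m` and cannot be
prolonged beyond `v (m + 1)`. -/
structure IsArm (Q : StableTranslationQuiver V) (v : ℕ → V) (m : ℕ) : Prop where
  arrow : ∀ i, i ≤ m → Q.Arrow (v i) (v (i + 1))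
  step : ∀ i, i < m → ∀ z, Q.Arrow (v (i + 1)) z → z = Q.τ.symm (v i) ∨ z = v (i + 2)
  ne : ∀ i, i < m → v (i + 2) ≠ Q.τ.symm (v i)
  last : ∀ z, Q.Arrow (v (m + 1)) z → z = Q.τ.symm (v m)

theorem IsArm.cons {v : ℕ → V} {m : ℕ} (h : Q.IsArm v m) {x : V} (hx : Q.Arrow x (v 0))
    (hs : ∀ z, Q.Arrow (v 0) z → z = Q.τ.symm x ∨ z = v 1) (hne : v 1 ≠ Q.τ.symm x) :
    Q.IsArm (fun n => Nat.casesOn n x v) (m + 1) where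
  arrow i hi := by
    cases i with
    | zero => exact hx
    | succ i => exact h.arrow i (by omega)
  step i hi := by
    cases i with
    | zero => exact hs
    | succ i => exact h.step i (by omega)
  ne i hi := by
    cases i with
    | zero => exact hne
    | succ i => exact h.ne i (by omega)
  last := h.last

theorem isArm_zero {x y : V} (hx : Q.Arrow x y) (h : ∀ z, Q.Arrow y z → z = Q.τ.symm x) :
    Q.IsArm (fun n => Nat.casesOn n x fun _ => y) 0 where
  arrow i hi := by
    obtain rfl : i = 0 := by omega
    exact hx
  step i hi := by omega
  ne i hi := by omega
  last := h

end StableTranslationQuiver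

namespace ValuedTranslationQuiver.IsSubadditive

variable {V : Type u} {Q : ValuedTranslationQuiver V} {F : V → ℕ}

theorem symm_τ (hF : Q.IsSubadditive F) (x : V) : F (Q.τ.symm x) = F x := by
  rw [← hF.τ, Equiv.apply_symm_apply]

theorem sum_succ_lt (hF : Q.IsSubadditive F) {y : V} {s : Finset V}
    (hs : ∀ x ∈ s, Q.Arrow y x) : ∑ x ∈ s, F x + 1 ≤ 2 * F y := by
  refine le_trans (Nat.succ_le_succ (Finset.sum_le_sum fun x hx => ?_)) (hF.sum_lt y s)
  exact Nat.le_mul_of_pos_left _ ((Q.a_pos_iff y x).2 (hs x hx))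

theorem two_succ_lt (hF : Q.IsSubadditive F) {y x₁ x₂ : V} (h1 : Q.Arrow y x₁)
    (h2 : Q.Arrow y x₂) (h12 : x₁ ≠ x₂) : F x₁ + F x₂ + 1 ≤ 2 * F y := by
  classical
  have := hF.sum_succ_lt (y := y) (s := {x₁, x₂}) (by simp [h1, h2])
  rwa [Finset.sum_pair h12] at this

theorem three_succ_lt (hF : Q.IsSubadditive F) {y x₁ x₂ x₃ : V} (h1 : Q.Arrow y x₁)
    (h2 : Q.Arrow y x₂) (h3 : Q.Arrow y x₃) (h12 : x₁ ≠ x₂) (h13 : x₁ ≠ x₃) (h23 : x₂ ≠ x₃) :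
    F x₁ + (F x₂ + F x₃) + 1 ≤ 2 * F y := by
  classical
  have := hF.sum_succ_lt (y := y) (s := {x₁, x₂, x₃}) (by simp [h1, h2, h3])
  rwa [Finset.sum_insert (by simp [h12, h13]), Finset.sum_pair h23] at this

theorem succ_lt_of_arrow (hF : Q.IsSubadditive F) {x y : V} (h : Q.Arrow x y) :
    F x + 1 ≤ 2 * F y := by
  have := hF.sum_succ_lt (y := y) (s := {Q.τ.symm x})
    (by simpa [StableTranslationQuiver.arrow_symm_τ] using h)
  rwa [Finset.sum_singleton, hF.symm_τ] at this

/-- If `a x y ≥ 2`, the inequalities at `x` and at `y` give `F y < F x` and `F x < F y`. -/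
theorem a_eq_one (hF : Q.IsSubadditive F) {x y : V} (h : Q.Arrow x y) : Q.a x y = 1 := by
  have h1 := hF.sum_lt x {y}
  have h2 := hF.sum_lt y {Q.τ.symm x}
  have h3 : Q.a y (Q.τ.symm x) = Q.a x y := by rw [← Q.a_σ, Equiv.apply_symm_apply]
  rw [Finset.sum_singleton] at h1 h2
  rw [h3, hF.symm_τ] at h2
  have h4 := (Q.a_pos_iff x y).2 h
  by_contra h5
  have h6 : 2 ≤ Q.a x y := by omega
  have h7 := Nat.mul_le_mul_right (F y) h6
  have h8 := Nat.mul_le_mul_right (F x) h6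
  omega

/-- If `x → y` is an arrow along which `F` does not increase, then a sectional path through `x → y`
does not branch at `y`. -/
theorem eq_of_arrow_of_arrow (hF : Q.IsSubadditive F) {x y z z' : V} (hxy : Q.Arrow x y)
    (hle : F y ≤ F x) (hz : Q.Arrow y z) (hz' : Q.Arrow y z') (hne : z ≠ Q.τ.symm x)
    (hne' : z' ≠ Q.τ.symm x) : z = z' := by
  by_contra h
  have h1 := hF.three_succ_lt ((StableTranslationQuiver.arrow_symm_τ x y).2 hxy) hz hz' hne.symm
    hne'.symm h
  rw [hF.symm_τ] at h1
  have h2 := hF.succ_lt_of_arrow hz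
  have h3 := hF.succ_lt_of_arrow hz'
  omega

/-- If `F` does not increase along the arrow `x → y`, it decreases strictly from `y` on along a
sectional path, which therefore ends. -/
theorem exists_isArm_of_le (hF : Q.IsSubadditive F) {x y : V} (hxy : Q.Arrow x y)
    (hle : F y ≤ F x) : ∃ v m, v 0 = x ∧ v 1 = y ∧ Q.IsArm v m := by
  induction hn : F y using Nat.strong_induction_on generalizing x y with
  | _ n ih => ?_
  by_cases h : ∃ z, Q.Arrow y z ∧ z ≠ Q.τ.symm x
  · obtain ⟨z, hz, hne⟩ := h
    have h1 := hF.two_succ_lt ((StableTranslationQuiver.arrow_symm_τ x y).2 hxy) hz hne.symm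
    rw [hF.symm_τ] at h1
    obtain ⟨v, m, rfl, rfl, hv⟩ := ih (F z) (by omega) hz (by omega) rfl
    refine ⟨_, _, rfl, rfl, hv.cons hxy (fun z' hz' => ?_) hne⟩
    by_cases h' : z' = Q.τ.symm x
    · exact Or.inl h'
    · exact Or.inr (hF.eq_of_arrow_of_arrow hxy hle hz' hz h' hne)
  · push Not at h
    exact ⟨_, _, rfl, rfl, StableTranslationQuiver.isArm_zero hxy h⟩

/-- The differences of `F` decrease along a sectional path, so that they become negative. -/
theorem exists_isArm_of_not_branch (hF : Q.IsSubadditive F)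
    (hb : ∀ y x₁ x₂ x₃, Q.Arrow y x₁ → Q.Arrow y x₂ → Q.Arrow y x₃ →
      x₁ ≠ x₂ → x₁ ≠ x₃ → x₂ = x₃) {x y : V} (hxy : Q.Arrow x y) :
    ∃ v m, v 0 = x ∧ v 1 = y ∧ Q.IsArm v m := by
  obtain ⟨d, hd⟩ : ∃ d, F y ≤ F x + d := ⟨F y, Nat.le_add_left _ _⟩
  induction d generalizing x y with
  | zero => exact hF.exists_isArm_of_le hxy hd
  | succ d ih =>
    by_cases h : ∃ z, Q.Arrow y z ∧ z ≠ Q.τ.symm x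
    · obtain ⟨z, hz, hne⟩ := h
      have h0 := (StableTranslationQuiver.arrow_symm_τ x y).2 hxy
      have h1 := hF.two_succ_lt h0 hz hne.symm
      rw [hF.symm_τ] at h1
      obtain ⟨v, m, rfl, rfl, hv⟩ := ih hz (by omega)
      refine ⟨_, _, rfl, rfl, hv.cons hxy (fun z' hz' => ?_) hne⟩
      by_cases h' : z' = Q.τ.symm x
      · exact Or.inl h'
      · exact Or.inr (hb _ _ _ _ h0 hz' hz (Ne.symm h') hne.symm)
    · push Not at h
      exact ⟨_, _, rfl, rfl, StableTranslationQuiver.isArm_zero hxy h⟩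

end ValuedTranslationQuiver.IsSubadditive

/-! ### Dynkin trees -/

/-- A graph on `0, …, n` is a tree if every vertex but `0` has exactly one smaller neighbour. -/
theorem isTree_of_existsUnique_lt {n : ℕ} {G : SimpleGraph (Fin (n + 1))}
    (h : ∀ i, i ≠ 0 → ∃! j, j < i ∧ G.Adj i j) : G.IsTree := by
  have hconn : G.Connected := by
    rw [SimpleGraph.connected_iff_exists_forall_reachable]
    refine ⟨0, fun i => ?_⟩
    induction hi : i.val using Nat.strong_induction_on generalizing i with
    | _ m ih => ?_
    by_cases h0 : i = 0
    · rw [h0]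
    · obtain ⟨j, ⟨hj, hadj⟩, -⟩ := h i h0
      exact (ih j (by omega) j rfl).trans hadj.symm.reachable
  rw [SimpleGraph.isTree_iff_connected_and_card]
  -- There are at most `n` edges, as an edge is determined by its larger end.
  refine ⟨hconn, le_antisymm ?_ hconn.card_vert_le_card_edgeSet_add_one⟩
  choose p hp using fun i : Fin n => h i.succ (Fin.succ_ne_zero i)
  have hsub : G.edgeSet ⊆ Set.range fun i : Fin n => s(i.succ, p i) := by
    have key : ∀ i j, j < i → G.Adj i j → s(i, j) ∈ Set.range fun i : Fin n => s(i.succ, p i) := by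
      intro i j hji hadj
      obtain ⟨k, rfl⟩ := Fin.exists_succ_eq.2 (Fin.ne_zero_of_lt hji)
      exact ⟨k, by rw [(hp k).2 j ⟨hji, hadj⟩]⟩
    intro e
    induction e using Sym2.ind with
    | _ i j => ?_
    intro hadj
    rw [SimpleGraph.mem_edgeSet] at hadj
    rcases lt_or_gt_of_ne hadj.ne with hij | hij
    · rw [Sym2.eq_swap]
      exact key j i hij hadj.symm
    · exact key i j hij hadj
  have h1 := Set.ncard_le_ncard hsub (Set.finite_range _)
  have h2 : (Set.range fun i : Fin n => s(i.succ, p i)).ncard ≤ n := by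
    rw [← Set.image_univ]
    refine (Set.ncard_image_le Set.finite_univ).trans ?_
    rw [Set.ncard_univ, Nat.card_eq_fintype_card, Fintype.card_fin]
  rw [Nat.card_coe_set_eq, Nat.card_eq_fintype_card (α := Fin (n + 1)), Fintype.card_fin]
  omega

/-- The arrows `0 → 1 → ⋯ → n`. -/
def linearArrow (n : ℕ) (i j : Fin (n + 1)) : Prop := i.val + 1 = j.val

theorem fromRel_linearArrow (n : ℕ) :
    SimpleGraph.fromRel (linearArrow n) = SimpleGraph.pathGraph (n + 1) := by
  ext i j
  rw [SimpleGraph.pathGraph_adj, SimpleGraph.fromRel_adj, Ne, Fin.ext_iff]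
  unfold linearArrow
  omega

/-- The linearly oriented tree of type `A_{n+1}`. -/
def linearTree (n : ℕ) : OrientedTree where
  V := Fin (n + 1)
  Arrow := linearArrow n
  asymm i j h h' := by
    unfold linearArrow at h h'
    omega
  isTree := by
    refine isTree_of_existsUnique_lt fun i hi => ?_
    obtain ⟨k, rfl⟩ := Fin.exists_succ_eq.2 hi
    simp only [SimpleGraph.fromRel_adj, Ne, Fin.ext_iff, linearArrow, Fin.val_succ, Fin.lt_def]
    exact ⟨k.castSucc, by simp, fun j hj => Fin.ext (by simp; omega)⟩
  finite_succ _ := Set.toFinite _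
  finite_pred _ := Set.toFinite _

theorem linearTree_isDynkin (n : ℕ) : (linearTree n).IsDynkin := by
  refine Or.inl ⟨n + 1, by omega, ?_⟩
  rw [← fromRel_linearArrow]
  exact ⟨SimpleGraph.Iso.refl⟩

/-- The arrows of a star with arms of lengths `q + 1`, `1` and `r + 1`, oriented away from the
branch vertex `q + 1`. The arms are `q, …, 0` and `q + 2` and `q + 3, …, q + r + 3`. -/
def starArrow (q r : ℕ) (i j : Fin (q + r + 4)) : Prop :=
  (j.val + 1 = i.val ∧ i.val ≤ q + 1) ∨
    (i.val = q + 1 ∧ (j.val = q + 2 ∨ j.val = q + 3)) ∨ (i.val + 1 = j.val ∧ q + 3 ≤ i.val)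

theorem fromRel_starArrow_zero (q : ℕ) :
    SimpleGraph.fromRel (starArrow q 0) = dynkinGraphD (q + 0 + 4) := by
  ext i j
  rw [dynkinGraphD, SimpleGraph.fromRel_adj, SimpleGraph.fromRel_adj, Ne, Fin.ext_iff]
  unfold starArrow
  omega

theorem fromRel_starArrow_one (r : ℕ) :
    SimpleGraph.fromRel (starArrow 1 r) = dynkinGraphE (1 + r + 4) := by
  ext i j
  rw [dynkinGraphE, SimpleGraph.fromRel_adj, SimpleGraph.fromRel_adj, Ne, Fin.ext_iff]
  unfold starArrow
  omega

/-- The oriented star with arms of lengths `q + 1`, `1` and `r + 1`. -/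
def starTree (q r : ℕ) : OrientedTree where
  V := Fin (q + r + 4)
  Arrow := starArrow q r
  asymm i j h h' := by
    unfold starArrow at h h'
    omega
  isTree := by
    refine isTree_of_existsUnique_lt (n := q + r + 3) fun i hi => ?_
    obtain ⟨k, rfl⟩ := Fin.exists_succ_eq.2 hi
    simp only [SimpleGraph.fromRel_adj, Ne, Fin.ext_iff, starArrow, Fin.val_succ, Fin.lt_def]
    by_cases h : k.val = q + 2
    · exact ⟨⟨q + 1, by omega⟩, by simp only [true_and]; omega,
        fun j hj => Fin.ext (by simp only; omega)⟩
    · exact ⟨k.castSucc, by simp only [Fin.val_castSucc, true_and]; omega,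
        fun j hj => Fin.ext (by simp only [Fin.val_castSucc]; omega)⟩
  finite_succ _ := Set.toFinite _
  finite_pred _ := Set.toFinite _

theorem starTree_isDynkin_D (q : ℕ) : (starTree q 0).IsDynkin := by
  refine Or.inr (Or.inl ⟨q + 0 + 4, by omega, ?_⟩)
  rw [← fromRel_starArrow_zero]
  exact ⟨SimpleGraph.Iso.refl⟩

theorem starTree_isDynkin_E {r : ℕ} (h1 : 1 ≤ r) (h3 : r ≤ 3) : (starTree 1 r).IsDynkin := by
  refine Or.inr (Or.inr ⟨1 + r + 4, by omega, by omega, ?_⟩)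
  rw [← fromRel_starArrow_one]
  exact ⟨SimpleGraph.Iso.refl⟩

theorem OrientedTree.IsDynkin.finite {Δ : OrientedTree} (h : Δ.IsDynkin) : Finite Δ.V := by
  rcases h with ⟨n, -, ⟨e⟩⟩ | ⟨n, -, ⟨e⟩⟩ | ⟨n, -, -, ⟨e⟩⟩ <;>
    exact Finite.of_equiv _ e.toEquiv.symm

/-! ### Dynkin slices -/

namespace StableTranslationQuiver

variable {V : Type u} {Q : StableTranslationQuiver V}

/-- An arm that cannot be prolonged at its beginning either is a slice of type `A`. -/
theorem IsArm.isSlice_linear {v : ℕ → V} {m : ℕ} (hv : Q.IsArm v m)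
    (h0 : ∀ z, Q.Arrow (v 0) z → z = v 1) :
    Q.IsSlice (linearArrow (m + 1)) fun i => v i.val where
  arrow i j h := by
    have h1 := hv.arrow i.val (by unfold linearArrow at h; omega)
    rwa [show i.val + 1 = j.val from h] at h1
  inj_succ i j j' h h' _ := by
    unfold linearArrow at h h'
    omega
  inj_pred i j j' h h' _ := by
    unfold linearArrow at h h'
    omega
  ne i j j' h h' := by
    unfold linearArrow at h h'
    have h1 := hv.ne j'.val (by omega)
    rwa [show j'.val + 2 = j.val by omega] at h1
  surj i z hz := by
    unfold linearArrow
    obtain ⟨i, hi⟩ := i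
    cases i with
    | zero => exact Or.inl ⟨⟨1, by omega⟩, rfl, (h0 z hz).symm⟩
    | succ i =>
      rcases Nat.lt_or_ge i m with him | him
      · rcases hv.step i him z hz with h | h
        · exact Or.inr ⟨⟨i, by omega⟩, rfl, h.symm⟩
        · exact Or.inl ⟨⟨i + 2, by omega⟩, rfl, h.symm⟩
      · obtain rfl : i = m := by omega
        exact Or.inr ⟨⟨i, by omega⟩, rfl, (hv.last z hz).symm⟩

theorem isSlice_linear_zero {x : V} (hx : ∀ y, ¬ Q.Arrow x y) :
    Q.IsSlice (linearArrow 0) fun _ => x where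
  arrow i j h := by unfold linearArrow at h; omega
  inj_succ i j j' h := by unfold linearArrow at h; omega
  inj_pred i j j' h := by unfold linearArrow at h; omega
  ne i j j' h := by unfold linearArrow at h; omega
  surj i z hz := (hx z hz).elim

/-- Three arms that start at the same vertex `b`, the second of them of length one, form a slice if
there are no further arrows from `b`. -/
theorem isSlice_star {u w : ℕ → V} {c : V} {q r : ℕ} (hu : Q.IsArm u q) (hw : Q.IsArm w r)
    (huw : u 0 = w 0) (hc : Q.Arrow (u 0) c) (hc' : ∀ z, Q.Arrow c z → z = Q.τ.symm (u 0))
    (hb : ∀ z, Q.Arrow (u 0) z → z = u 1 ∨ z = c ∨ z = w 1) (h1 : u 1 ≠ c) (h2 : u 1 ≠ w 1)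
    (h3 : c ≠ w 1) :
    Q.IsSlice (starArrow q r) fun i => if i.val ≤ q + 1 then u (q + 1 - i.val) else
      if i.val = q + 2 then c else w (i.val - (q + 2)) := by
  set π : Fin (q + r + 4) → V := fun i => if i.val ≤ q + 1 then u (q + 1 - i.val) else
      if i.val = q + 2 then c else w (i.val - (q + 2)) with hπ
  have hπu : ∀ (i : Fin (q + r + 4)) (k : ℕ), i.val + k = q + 1 → π i = u k := by
    intro i k h
    simp only [hπ]
    rw [if_pos (by omega), show q + 1 - i.val = k by omega]
  have hπc : ∀ i : Fin (q + r + 4), i.val = q + 2 → π i = c := by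
    intro i h
    simp only [hπ]
    rw [if_neg (by omega), if_pos h]
  have hπw : ∀ (i : Fin (q + r + 4)) (k : ℕ), i.val = q + 3 + k → π i = w (k + 1) := by
    intro i k h
    simp only [hπ]
    rw [if_neg (by omega), if_neg (by omega), show i.val - (q + 2) = k + 1 by omega]
  -- The positions of the vertices on the arms.
  have hpos : ∀ i : Fin (q + r + 4), i.val = q + 1 ∨ (∃ k, k ≤ q ∧ i.val + (k + 1) = q + 1) ∨
      i.val = q + 2 ∨ ∃ k, k ≤ r ∧ i.val = q + 3 + k := by
    intro i
    rcases Nat.lt_or_ge i.val (q + 1) with h | h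
    · exact Or.inr (Or.inl ⟨q - i.val, by omega, by omega⟩)
    · rcases Nat.lt_or_ge i.val (q + 3) with h' | h'
      · omega
      · exact Or.inr (Or.inr (Or.inr ⟨i.val - (q + 3), by omega, by omega⟩))
  have hsucc : ∀ i j, starArrow q r i j →
      (∃ k, k ≤ q ∧ i.val + k = q + 1 ∧ j.val + (k + 1) = q + 1) ∨
      (i.val = q + 1 ∧ j.val = q + 2) ∨ (i.val = q + 1 ∧ j.val = q + 3 + 0) ∨
      ∃ k, k < r ∧ i.val = q + 3 + k ∧ j.val = q + 3 + (k + 1) := by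
    intro i j h
    unfold starArrow at h
    rcases h with h | ⟨h, h' | h'⟩ | h
    · exact Or.inl ⟨q + 1 - i.val, by omega⟩
    · omega
    · omega
    · exact Or.inr (Or.inr (Or.inr ⟨i.val - (q + 3), by omega⟩))
  refine ⟨fun i j h => ?_, fun i j j' h h' he => ?_, fun i j j' h h' _ => ?_,
    fun i j j' h h' => ?_, fun i z hz => ?_⟩
  · rcases hsucc i j h with ⟨k, hk, hi, hj⟩ | ⟨hi, hj⟩ | ⟨hi, hj⟩ | ⟨k, hk, hi, hj⟩
    · rw [hπu i k hi, hπu j _ hj]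
      exact hu.arrow k hk
    · rw [hπu i 0 (by omega), hπc j hj]
      exact hc
    · rw [hπu i 0 (by omega), hπw j 0 hj, huw]
      exact hw.arrow 0 (Nat.zero_le _)
    · rw [hπw i k hi, hπw j _ hj]
      exact hw.arrow (k + 1) (by omega)
  · apply Fin.ext
    rcases hsucc i j h with ⟨k, hk, hi, hj⟩ | ⟨hi, hj⟩ | ⟨hi, hj⟩ | ⟨k, hk, hi, hj⟩ <;>
      rcases hsucc i j' h' with ⟨l, hl, hi', hj'⟩ | ⟨hi', hj'⟩ | ⟨hi', hj'⟩ | ⟨l, hl, hi', hj'⟩ <;>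
      first
      | omega
      | (obtain rfl : k = 0 := by omega
         rw [hπu j 1 (by omega)] at he
         first
         | exact (h1 (he.trans (hπc j' hj'))).elim
         | exact (h2 (he.trans (hπw j' 0 hj'))).elim)
      | (obtain rfl : l = 0 := by omega
         rw [hπu j' 1 (by omega)] at he
         first
         | exact (h1 (he.symm.trans (hπc j hj))).elim
         | exact (h2 (he.symm.trans (hπw j 0 hj))).elim)
      | (rw [hπc j hj, hπw j' 0 hj'] at he
         exact (h3 he).elim)
      | (rw [hπw j 0 hj, hπc j' hj'] at he
         exact (h3 he.symm).elim)
  · apply Fin.ext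
    unfold starArrow at h h'
    omega
  · rcases hsucc i j h with ⟨k, hk, hi, hj⟩ | ⟨hi, hj⟩ | ⟨hi, hj⟩ | ⟨k, hk, hi, hj⟩
    · rcases hsucc j' i h' with ⟨l, hl, hj', hi'⟩ | ⟨hj', hi'⟩ | ⟨hj', hi'⟩ | ⟨l, hl, hj', hi'⟩
      · rw [hπu j _ hj, hπu j' l hj', show k + 1 = l + 2 by omega]
        exact hu.ne l (by omega)
      all_goals omega
    · unfold starArrow at h'
      omega
    · unfold starArrow at h'
      omega
    · rw [hπw j _ hj]
      rcases hsucc j' i h' with ⟨l, hl, hj', hi'⟩ | ⟨hj', hi'⟩ | ⟨hj', hi'⟩ | ⟨l, hl, hj', hi'⟩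
      · omega
      · omega
      · obtain rfl : k = 0 := by omega
        rw [hπu j' 0 (by omega), huw]
        exact hw.ne 0 hk
      · obtain rfl : k = l + 1 := by omega
        rw [hπw j' l hj']
        exact hw.ne (l + 1) (by omega)
  · rcases hpos i with hi | ⟨k, hk, hi⟩ | hi | ⟨k, hk, hi⟩
    · rw [hπu i 0 (by omega)] at hz
      left
      rcases hb z hz with rfl | rfl | rfl
      · exact ⟨⟨q, by omega⟩, by unfold starArrow; simp only; omega, hπu _ 1 rfl⟩
      · exact ⟨⟨q + 2, by omega⟩, by unfold starArrow; simp only [true_or, and_true]; omega,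
          hπc _ rfl⟩
      · exact ⟨⟨q + 3, by omega⟩, by unfold starArrow; simp only [or_true, and_true]; omega,
          hπw _ 0 rfl⟩
    · rw [hπu i _ hi] at hz
      have hp : ∃ j, starArrow q r j i ∧ Q.τ.symm (π j) = Q.τ.symm (u k) :=
        ⟨⟨i.val + 1, by omega⟩, by unfold starArrow; simp only [true_and]; omega,
          by rw [hπu _ k (by simp only; omega)]⟩
      rcases Nat.lt_or_ge k q with hkq | hkq
      · rcases hu.step k hkq z hz with rfl | rfl
        · exact Or.inr hp
        · exact Or.inl ⟨⟨i.val - 1, by omega⟩, by unfold starArrow; simp only; omega,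
            hπu _ _ (by simp only; omega)⟩
      · obtain rfl : k = q := by omega
        rw [hu.last z hz]
        exact Or.inr hp
    · rw [hπc i hi] at hz
      refine Or.inr ⟨⟨q + 1, by omega⟩, by unfold starArrow; simp only [true_and]; omega, ?_⟩
      rw [hπu _ 0 rfl, hc' z hz]
    · rw [hπw i k hi] at hz
      have hp : ∃ j, starArrow q r j i ∧ Q.τ.symm (π j) = Q.τ.symm (w k) := by
        cases k with
        | zero =>
          exact ⟨⟨q + 1, by omega⟩, by unfold starArrow; simp only [true_and]; omega,
            by rw [hπu _ 0 rfl, huw]⟩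
        | succ k =>
          exact ⟨⟨q + 3 + k, by omega⟩, by unfold starArrow; simp only; omega,
            by rw [hπw _ k rfl]⟩
      rcases Nat.lt_or_ge k r with hkr | hkr
      · rcases hw.step k hkr z hz with rfl | rfl
        · exact Or.inr hp
        · exact Or.inl ⟨⟨q + 3 + (k + 1), by omega⟩, by unfold starArrow; simp only; omega,
            hπw _ _ rfl⟩
      · obtain rfl : k = r := by omega
        rw [hw.last z hz]
        exact Or.inr hp

end StableTranslationQuiver

namespace ValuedTranslationQuiver.IsSubadditive

variable {V : Type u} {Q : ValuedTranslationQuiver V} {F : V → ℕ}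

/-- `F` is strictly concave along an arm. The estimates below on its first difference follow from
this and from strict subadditivity at the last vertex. -/
theorem isArm_step_le (hF : Q.IsSubadditive F) {v : ℕ → V} {m : ℕ} (hv : Q.IsArm v m) {i : ℕ}
    (hi : i < m) : F (v i) + F (v (i + 2)) + 1 ≤ 2 * F (v (i + 1)) := by
  have h := hF.two_succ_lt ((StableTranslationQuiver.arrow_symm_τ _ _).2 (hv.arrow i hi.le))
    (hv.arrow (i + 1) hi) (hv.ne i hi).symm
  rwa [hF.symm_τ] at h

theorem isArm_zero_lt (hF : Q.IsSubadditive F) {v : ℕ → V} {m : ℕ} (hv : Q.IsArm v m) :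
    F (v 0) < 2 * F (v 1) :=
  hF.succ_lt_of_arrow (hv.arrow 0 (Nat.zero_le _))

theorem isArm_one_lt (hF : Q.IsSubadditive F) {v : ℕ → V} {m : ℕ} (hv : Q.IsArm v m) (hm : 1 ≤ m) :
    2 * F (v 0) < 3 * F (v 1) := by
  have h1 := hF.isArm_step_le hv (i := 0) (by omega)
  have h2 := hF.succ_lt_of_arrow (hv.arrow 1 (by omega))
  simp only [Nat.zero_add, Nat.reduceAdd] at h1 h2
  omega

theorem isArm_two_lt (hF : Q.IsSubadditive F) {v : ℕ → V} {m : ℕ} (hv : Q.IsArm v m) (hm : 2 ≤ m) :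
    3 * F (v 0) < 4 * F (v 1) := by
  have h1 := hF.isArm_step_le hv (i := 0) (by omega)
  have h2 := hF.isArm_step_le hv (i := 1) (by omega)
  have h3 := hF.succ_lt_of_arrow (hv.arrow 2 (by omega))
  simp only [Nat.zero_add, Nat.reduceAdd] at h1 h2 h3
  omega

theorem isArm_four_lt (hF : Q.IsSubadditive F) {v : ℕ → V} {m : ℕ} (hv : Q.IsArm v m) (hm : 4 ≤ m) :
    5 * F (v 0) < 6 * F (v 1) := by
  have h1 := hF.isArm_step_le hv (i := 0) (by omega)
  have h2 := hF.isArm_step_le hv (i := 1) (by omega)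
  have h3 := hF.isArm_step_le hv (i := 2) (by omega)
  have h4 := hF.isArm_step_le hv (i := 3) (by omega)
  have h5 := hF.succ_lt_of_arrow (hv.arrow 4 (by omega))
  simp only [Nat.zero_add, Nat.reduceAdd] at h1 h2 h3 h4 h5
  omega

/-- Three arms at a branch vertex, in the order of their lengths. The values of `F` next to the
branch vertex are too large if the arms contain an extended Dynkin tree of type `E`. -/
theorem exists_dynkin_slice_of_arms (hF : Q.IsSubadditive F) {v₁ v₂ v₃ : ℕ → V} {m₁ m₂ m₃ : ℕ}
    (h1 : Q.IsArm v₁ m₁) (h2 : Q.IsArm v₂ m₂) (h3 : Q.IsArm v₃ m₃) (h12 : v₁ 0 = v₂ 0)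
    (h13 : v₁ 0 = v₃ 0) (hne12 : v₁ 1 ≠ v₂ 1) (hne13 : v₁ 1 ≠ v₃ 1) (hne23 : v₂ 1 ≠ v₃ 1)
    (hb : ∀ z, Q.Arrow (v₁ 0) z → z = v₁ 1 ∨ z = v₂ 1 ∨ z = v₃ 1) (hm12 : m₁ ≤ m₂)
    (hm23 : m₂ ≤ m₃) :
    ∃ (Δ : OrientedTree) (π : Δ.V → V), Δ.IsDynkin ∧ Q.IsSlice Δ.Arrow π := by
  have hsum := hF.three_succ_lt (h1.arrow 0 (Nat.zero_le _))
    (by rw [h12]; exact h2.arrow 0 (Nat.zero_le _)) (by rw [h13]; exact h3.arrow 0 (Nat.zero_le _))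
    hne12 hne13 hne23
  have e12 := congrArg F h12
  have e13 := congrArg F h13
  obtain rfl : m₁ = 0 := by
    by_contra hm
    have h1 := hF.isArm_one_lt h1 (by omega)
    have h2 := hF.isArm_one_lt h2 (by omega)
    have h3 := hF.isArm_one_lt h3 (by omega)
    rw [Nat.zero_add] at hsum
    omega
  have h1' := hF.isArm_zero_lt h1
  rw [Nat.zero_add] at hsum
  rcases Nat.lt_or_ge m₂ 2 with hm2 | hm2
  · rcases Nat.lt_or_ge m₂ 1 with hm2' | hm2'
    · obtain rfl : m₂ = 0 := by omega
      refine ⟨starTree m₃ 0, _, starTree_isDynkin_D m₃, StableTranslationQuiver.isSlice_star h3 h2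
        (c := v₁ 1) ?_ ?_ ?_ ?_ hne13.symm hne23.symm hne12⟩
      · rw [← h13, h12]
      · rw [← h13]
        exact h1.arrow 0 le_rfl
      · rw [← h13]
        exact h1.last
      · intro z hz
        rw [← h13] at hz
        rcases hb z hz with h | h | h <;> simp [h]
    · obtain rfl : m₂ = 1 := by omega
      have hm3 : m₃ ≤ 3 := by
        by_contra hm
        have h2 := hF.isArm_one_lt h2 le_rfl
        have h3 := hF.isArm_four_lt h3 (by omega)
        omega
      refine ⟨starTree 1 m₃, _, starTree_isDynkin_E hm23 hm3,
        StableTranslationQuiver.isSlice_star h2 h3 (c := v₁ 1) ?_ ?_ ?_ ?_ hne12.symm hne23 hne13⟩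
      · rw [← h12, h13]
      · rw [← h12]
        exact h1.arrow 0 le_rfl
      · rw [← h12]
        exact h1.last
      · intro z hz
        rw [← h12] at hz
        rcases hb z hz with h | h | h <;> simp [h]
  · have h2 := hF.isArm_two_lt h2 hm2
    have h3 := hF.isArm_two_lt h3 (by omega)
    omega

/-- A translation quiver with a subadditive function has a slice that is a Dynkin tree. -/
theorem exists_dynkin_slice [Nonempty V] (hF : Q.IsSubadditive F) :
    ∃ (Δ : OrientedTree) (π : Δ.V → V), Δ.IsDynkin ∧ Q.IsSlice Δ.Arrow π := by
  classical
  by_cases hb : ∀ y x₁ x₂ x₃, Q.Arrow y x₁ → Q.Arrow y x₂ → Q.Arrow y x₃ →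
      x₁ ≠ x₂ → x₁ ≠ x₃ → x₂ = x₃
  · -- A vertex at which `F` is minimal has at most one successor.
    obtain ⟨x, hx⟩ : ∃ x, ∀ y, F x ≤ F y := ⟨_, fun y => Function.argmin_le F y⟩
    by_cases h : ∃ y, Q.Arrow x y
    · obtain ⟨y, hy⟩ := h
      obtain ⟨v, m, rfl, rfl, hv⟩ := hF.exists_isArm_of_not_branch hb hy
      refine ⟨linearTree (m + 1), _, linearTree_isDynkin _, hv.isSlice_linear fun z hz => ?_⟩
      by_contra hne
      have h1 := hF.two_succ_lt hz hy hne
      have h2 := hx z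
      have h3 := hx (v 1)
      omega
    · push Not at h
      exact ⟨linearTree 0, _, linearTree_isDynkin _, StableTranslationQuiver.isSlice_linear_zero h⟩
  · push Not at hb
    obtain ⟨b, c₁, c₂, c₃, h1, h2, h3, h12, h13, h23⟩ := hb
    have hsum := hF.three_succ_lt h1 h2 h3 h12 h13 h23
    have e1 := hF.succ_lt_of_arrow h1
    have e2 := hF.succ_lt_of_arrow h2
    have e3 := hF.succ_lt_of_arrow h3
    have hall : ∀ z, Q.Arrow b z → z = c₁ ∨ z = c₂ ∨ z = c₃ := by
      intro z hz
      by_contra! hne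
      have h4 := hF.sum_succ_lt (y := b) (s := {z, c₁, c₂, c₃}) (by simp [hz, h1, h2, h3])
      rw [Finset.sum_insert (by simp [hne]), Finset.sum_insert (by simp [h12, h13]),
        Finset.sum_pair h23] at h4
      have e4 := hF.succ_lt_of_arrow hz
      omega
    obtain ⟨v₁, m₁, rfl, rfl, a1⟩ := hF.exists_isArm_of_le h1 (by omega)
    obtain ⟨v₂, m₂, b2, rfl, a2⟩ := hF.exists_isArm_of_le h2 (by omega)
    obtain ⟨v₃, m₃, b3, rfl, a3⟩ := hF.exists_isArm_of_le h3 (by omega)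
    have key := @exists_dynkin_slice_of_arms _ _ _ hF
    rcases le_total m₁ m₂ with h | h <;> rcases le_total m₂ m₃ with h' | h' <;>
      rcases le_total m₁ m₃ with h'' | h''
    · exact key a1 a2 a3 b2.symm b3.symm h12 h13 h23 hall h h'
    · exact key a1 a2 a3 b2.symm b3.symm h12 h13 h23 hall h h'
    · exact key a1 a3 a2 b3.symm b2.symm h13 h12 h23.symm (fun z hz => by
        have := hall z hz; tauto) h'' h'
    · exact key a3 a1 a2 b3 (b3.trans b2.symm) h13.symm h23.symm h12 (fun z hz => by
        have := hall z (b3 ▸ hz); tauto) h'' h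
    · exact key a2 a1 a3 b2 (b2.trans b3.symm) h12.symm h23 h13 (fun z hz => by
        have := hall z (b2 ▸ hz); tauto) h h''
    · exact key a2 a3 a1 (b2.trans b3.symm) b2 h23 h12.symm h13.symm (fun z hz => by
        have := hall z (b2 ▸ hz); tauto) h' h''
    · exact key a3 a2 a1 (b3.trans b2.symm) b3 h23.symm h13.symm h12.symm (fun z hz => by
        have := hall z (b3 ▸ hz); tauto) h' h
    · exact key a3 a2 a1 (b3.trans b2.symm) b3 h23.symm h13.symm h12.symm (fun z hz => by
        have := hall z (b3 ▸ hz); tauto) h' h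

end ValuedTranslationQuiver.IsSubadditive

/-! ### Coverings of translation quivers -/

/-- Data can be lifted along a tree: if `R` relates admissible values at neighbouring vertices and
admissible values can be extended along edges, then a value at one vertex extends to all of them. -/
theorem SimpleGraph.IsTree.exists_lift {X : Type*} {G : SimpleGraph X} (hG : G.IsTree)
    {W : Type*} (ok : X → W → Prop) (R : X → X → W → W → Prop)
    (hsymm : ∀ x y a b, R x y a b → R y x b a)
    (hstep : ∀ x y a, G.Adj x y → ok x a → ∃ b, ok y b ∧ R x y a b) (r : X) (w : W)
    (hw : ok r w) :
    ∃ g : X → W, g r = w ∧ (∀ x, ok x (g x)) ∧ ∀ x y, G.Adj x y → R x y (g x) (g y) := by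
  classical
  choose! nxt hnxt using hstep
  -- The value at the end of a walk from `x` to `r`, computed from `r` backwards.
  let val : ∀ x y, G.Walk x y → W → W := fun x y p w =>
    p.rec (motive := fun _ _ _ => W) (fun {_} => w) (fun {a b _} _ _ ih => nxt b a ih)
  have hval : ∀ x (p : G.Walk x r), ok x (val x r p w) := by
    intro x p
    induction p with
    | nil => exact hw
    | cons h p ih => exact (hnxt _ _ _ h.symm (ih hw)).1
  choose p hp hpu using fun x => hG.existsUnique_path x r
  have hr : p r = SimpleGraph.Walk.nil := (hpu r _ SimpleGraph.Walk.IsPath.nil).symm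
  refine ⟨fun x => val x r (p x) w, ?_, fun x => hval x _, ?_⟩
  · simp only [hr]
    rfl
  · have key : ∀ x y (h : G.Adj x y), x ∉ (p y).support →
        R x y (val x r (p x) w) (val y r (p y) w) := by
      intro x y h hx
      rw [← hpu x _ (SimpleGraph.Walk.IsPath.cons (hp y) hx (h := h))]
      exact hsymm _ _ _ _ (hnxt y x _ h.symm (hval y (p y))).2
    intro x y h
    by_cases hx : x ∈ (p y).support
    · refine hsymm _ _ _ _ (key y x h.symm fun hy => ?_)
      exact hG.isAcyclic.ne_mem_support_of_support_of_adj_of_isPath (hp x).reverse (hp y).reverse h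
        (by simpa using hy) (by simpa using hx)
    · exact key x y h hx

namespace StableTranslationQuiver

variable {V W : Type*} {P : StableTranslationQuiver W} {Q : StableTranslationQuiver V}

/-- A morphism of translation quivers. -/
structure IsMorphism (P : StableTranslationQuiver W) (Q : StableTranslationQuiver V) (p : W → V) :
    Prop where
  map_τ : ∀ x, p (P.τ x) = Q.τ (p x)
  map_arrow : ∀ x y, P.Arrow x y → Q.Arrow (p x) (p y)

/-- A covering: a morphism that maps `x⁺` bijectively to `(p x)⁺` for every vertex `x`. -/
structure IsCovering (P : StableTranslationQuiver W) (Q : StableTranslationQuiver V) (p : W → V) :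
    Prop extends IsMorphism P Q p where
  lift : ∀ x z, Q.Arrow (p x) z → ∃ y, P.Arrow x y ∧ p y = z
  inj : ∀ x y y', P.Arrow x y → P.Arrow x y' → p y = p y' → y = y'

theorem IsMorphism.map_zpow_τ {p : W → V} (hp : IsMorphism P Q p) (n : ℤ) (x : W) :
    p ((P.τ ^ n) x) = (Q.τ ^ n) (p x) := by
  induction n generalizing x with
  | zero => simp
  | succ n ih =>
    rw [zpow_add_one, zpow_add_one, Equiv.Perm.mul_apply, Equiv.Perm.mul_apply, ih, hp.map_τ]
  | pred n ih =>
    rw [zpow_sub_one, zpow_sub_one, Equiv.Perm.mul_apply, Equiv.Perm.mul_apply, ih]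
    congr 1
    rw [Equiv.Perm.eq_inv_iff_eq, ← hp.map_τ, ← Equiv.Perm.mul_apply, mul_inv_cancel,
      Equiv.Perm.one_apply]

theorem IsCovering.lift_pred {p : W → V} (hp : IsCovering P Q p) {x : W} {z : V}
    (h : Q.Arrow z (p x)) : ∃ y, P.Arrow y x ∧ p y = z := by
  obtain ⟨y, hy, rfl⟩ := hp.lift (P.τ x) z (by rwa [hp.map_τ, Q.arrow_τ])
  exact ⟨y, (P.arrow_τ x y).1 hy, rfl⟩

theorem IsCovering.inj_pred {p : W → V} (hp : IsCovering P Q p) {x y y' : W} (h : P.Arrow y x)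
    (h' : P.Arrow y' x) (he : p y = p y') : y = y' :=
  hp.inj (P.τ x) y y' ((P.arrow_τ x y).2 h) ((P.arrow_τ x y').2 h') he

end StableTranslationQuiver

namespace OrientedTree

open StableTranslationQuiver

variable {Δ : OrientedTree} {V W : Type*} {P : StableTranslationQuiver W}
  {Q : StableTranslationQuiver V}

theorem repetition_τ (n : ℤ) (x : Δ.V) : Δ.repetition.τ (n, x) = (n - 1, x) := rfl

theorem repetition_zpow_τ (m n : ℤ) (x : Δ.V) : (Δ.repetition.τ ^ m) (n, x) = (n - m, x) := by
  induction m generalizing n with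
  | zero => simp
  | succ m ih =>
    rw [zpow_add_one, Equiv.Perm.mul_apply, repetition_τ, ih, sub_sub, add_comm (1 : ℤ)]
  | pred m ih =>
    rw [zpow_sub_one, Equiv.Perm.mul_apply]
    have h : Δ.repetition.τ⁻¹ (n, x) = (n + 1, x) := by
      rw [Equiv.Perm.inv_eq_iff_eq, repetition_τ, add_sub_cancel_right]
    rw [h, ih]
    congr 1
    ring

theorem arrow_same {n : ℤ} {x y : Δ.V} (h : Δ.Arrow x y) : Δ.repetition.Arrow (n, x) (n, y) :=
  Or.inl ⟨rfl, h⟩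

theorem arrow_next {n : ℤ} {x y : Δ.V} (h : Δ.Arrow x y) : Δ.repetition.Arrow (n, y) (n + 1, x) :=
  Or.inr ⟨(add_sub_cancel_right n 1).symm, h⟩

theorem graph_adj {x y : Δ.V} : Δ.graph.Adj x y ↔ Δ.Arrow x y ∨ Δ.Arrow y x := by
  rw [graph, SimpleGraph.fromRel_adj, and_iff_right_iff_imp]
  rintro (h | h) rfl <;> exact Δ.asymm _ _ h h

/-- A property of vertices of `ℤΔ` that is invariant under translation and spreads along arrows
holds everywhere or nowhere. -/
theorem repetition_induction {p : ℤ × Δ.V → Prop} (hτ : ∀ a, p (Δ.repetition.τ a) ↔ p a)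
    (ha : ∀ a b, Δ.repetition.Arrow a b → p a → p b) {a : ℤ × Δ.V} (h : p a) (b : ℤ × Δ.V) :
    p b := by
  have hz : ∀ (n : ℤ) (x : Δ.V), p (n, x) ↔ p (0, x) := by
    intro n x
    induction n with
    | zero => exact Iff.rfl
    | succ n ih => rw [← ih, ← hτ, repetition_τ, add_sub_cancel_right]
    | pred n ih => rw [← ih, ← hτ (-(n : ℤ), x), repetition_τ]
  have hadj : ∀ x y, Δ.graph.Adj x y → p (0, x) → p (0, y) := by
    intro x y h hx
    rcases graph_adj.1 h with h | h
    · exact ha _ _ (arrow_same h) hx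
    · exact (hz _ _).1 (ha _ _ (arrow_next h) hx)
  obtain ⟨q⟩ := Δ.isTree.connected a.2 b.2
  have hw : ∀ {x y} (_ : Δ.graph.Walk x y), p (0, x) → p (0, y) := by
    intro x y q
    induction q with
    | nil => exact id
    | cons h _ ih => exact fun hx => ih (hadj _ _ h hx)
  exact (hz _ _).2 (hw q ((hz _ _).1 h))

/-- A slice of `Q` that is an oriented tree `Δ` extends to a covering of `Q` by `ℤΔ`. -/
theorem isCovering_of_isSlice {π : Δ.V → V} (hπ : Q.IsSlice Δ.Arrow π) :
    IsCovering Δ.repetition Q fun a => (Q.τ ^ (-a.1)) (π a.2) where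
  map_τ := by
    rintro ⟨n, x⟩
    change (Q.τ ^ (-(n - 1))) (π x) = Q.τ ((Q.τ ^ (-n)) (π x))
    rw [← Equiv.Perm.mul_apply, ← zpow_one_add]
    congr 2
    ring
  map_arrow := by
    rintro ⟨n, x⟩ ⟨m, y⟩ (⟨h1, h2⟩ | ⟨h1, h2⟩)
    · obtain rfl : n = m := h1
      exact (Q.arrow_zpow_τ _ _ _).2 (hπ.arrow _ _ h2)
    · obtain rfl : n = m - 1 := h1
      change Q.Arrow ((Q.τ ^ (-(m - 1))) (π x)) ((Q.τ ^ (-m)) (π y))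
      rw [show -(m - 1) = -m + 1 by ring, zpow_add_one, Equiv.Perm.mul_apply, Q.arrow_zpow_τ,
        Q.arrow_τ]
      exact hπ.arrow _ _ h2
  lift := by
    rintro ⟨n, x⟩ z h
    change Q.Arrow ((Q.τ ^ (-n)) (π x)) z at h
    rw [← Q.arrow_zpow_τ n, ← Equiv.Perm.mul_apply, ← zpow_add, add_neg_cancel, zpow_zero,
      Equiv.Perm.one_apply] at h
    rcases hπ.surj x _ h with ⟨j, hj, he⟩ | ⟨j, hj, he⟩
    · refine ⟨(n, j), arrow_same hj, ?_⟩
      change (Q.τ ^ (-n)) (π j) = z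
      rw [he, ← Equiv.Perm.mul_apply, ← zpow_add, neg_add_cancel, zpow_zero, Equiv.Perm.one_apply]
    · refine ⟨(n + 1, j), arrow_next hj, ?_⟩
      change (Q.τ ^ (-(n + 1))) (π j) = z
      rw [Equiv.symm_apply_eq] at he
      rw [he, ← Equiv.Perm.mul_apply, ← Equiv.Perm.mul_apply, ← zpow_add_one, ← zpow_add,
        show -(n + 1) + 1 + n = 0 by ring, zpow_zero, Equiv.Perm.one_apply]
  inj := by
    have hne : ∀ (n : ℤ) (x y y' : Δ.V), Δ.Arrow x y → Δ.Arrow y' x →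
        (Q.τ ^ (-n)) (π y) ≠ (Q.τ ^ (-(n + 1))) (π y') := by
      intro n x y y' h h' he
      rw [neg_add, zpow_add, Equiv.Perm.mul_apply] at he
      have h1 := (Q.τ ^ (-n)).injective he
      rw [zpow_neg_one] at h1
      exact hπ.ne x y y' h h' h1
    rintro ⟨n, x⟩ ⟨m, y⟩ ⟨m', y'⟩ (⟨h1, h2⟩ | ⟨h1, h2⟩) (⟨h3, h4⟩ | ⟨h3, h4⟩) he
    · obtain rfl : n = m := h1
      obtain rfl : n = m' := h3
      rw [hπ.inj_succ x y y' h2 h4 ((Q.τ ^ (-n)).injective he)]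
    · obtain rfl : n = m := h1
      obtain rfl : m' = n + 1 := by change n = m' - 1 at h3; omega
      exact (hne n x y y' h2 h4 he).elim
    · obtain rfl : m = n + 1 := by change n = m - 1 at h1; omega
      obtain rfl : n = m' := h3
      exact (hne n x y' y h4 h2 he.symm).elim
    · obtain rfl : m = n + 1 := by change n = m - 1 at h1; omega
      obtain rfl : m' = n + 1 := by change n = m' - 1 at h3; omega
      rw [hπ.inj_pred x y y' h2 h4 ((Q.τ ^ (-(n + 1))).injective he)]

/-- `ℤΔ` is simply connected: morphisms lift along coverings. -/
theorem exists_lift {p : W → V} (hp : IsCovering P Q p) {q : ℤ × Δ.V → V}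
    (hq : IsMorphism Δ.repetition Q q) {a : ℤ × Δ.V} {w : W} (h : p w = q a) :
    ∃ f : ℤ × Δ.V → W, IsMorphism Δ.repetition P f ∧ (∀ b, p (f b) = q b) ∧ f a = w := by
  obtain ⟨n, x⟩ := a
  have hτ : ∀ m y, q (m, y) = (Q.τ ^ (-m)) (q (0, y)) := by
    intro m y
    rw [← hq.map_zpow_τ, repetition_zpow_τ, sub_neg_eq_add, zero_add]
  obtain ⟨g, hg, hok, hR⟩ := Δ.isTree.exists_lift (fun y w => p w = q (0, y))
    (fun y z a b => (Δ.Arrow y z → P.Arrow a b) ∧ (Δ.Arrow z y → P.Arrow b a))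
    (fun y z a b h => ⟨h.2, h.1⟩) (fun y z a hyz ha => by
      rcases graph_adj.1 hyz with h | h
      · obtain ⟨b, hb, he⟩ := hp.lift a (q (0, z)) (ha ▸ hq.map_arrow _ _ (arrow_same h))
        exact ⟨b, he, fun _ => hb, fun h' => (Δ.asymm _ _ h h').elim⟩
      · obtain ⟨b, hb, he⟩ := hp.lift_pred (x := a) (ha ▸ hq.map_arrow _ _ (arrow_same h))
        exact ⟨b, he, fun h' => (Δ.asymm _ _ h h').elim, fun _ => hb⟩) x ((P.τ ^ n) w) (by
      rw [hp.map_zpow_τ, h, ← hq.map_zpow_τ, repetition_zpow_τ, sub_self])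
  refine ⟨fun b => (P.τ ^ (-b.1)) (g b.2), ⟨?_, ?_⟩, ?_, ?_⟩
  · rintro ⟨m, y⟩
    change (P.τ ^ (-(m - 1))) (g y) = P.τ ((P.τ ^ (-m)) (g y))
    rw [← Equiv.Perm.mul_apply, ← zpow_one_add]
    congr 2
    ring
  · rintro ⟨m, y⟩ ⟨m', z⟩ (⟨h1, h2⟩ | ⟨h1, h2⟩)
    · obtain rfl : m = m' := h1
      exact (P.arrow_zpow_τ _ _ _).2 ((hR y z (graph_adj.2 (Or.inl h2))).1 h2)
    · obtain rfl : m = m' - 1 := h1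
      change P.Arrow ((P.τ ^ (-(m' - 1))) (g y)) ((P.τ ^ (-m')) (g z))
      rw [show -(m' - 1) = -m' + 1 by ring, zpow_add_one, Equiv.Perm.mul_apply, P.arrow_zpow_τ,
        P.arrow_τ]
      exact (hR y z (graph_adj.2 (Or.inr h2))).2 h2
  · rintro ⟨m, y⟩
    rw [hp.map_zpow_τ, hok, ← hτ]
  · change (P.τ ^ (-n)) (g x) = w
    rw [hg, ← Equiv.Perm.mul_apply, ← zpow_add, neg_add_cancel, zpow_zero, Equiv.Perm.one_apply]

/-- A lift along a covering is determined by its value at one vertex. -/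
theorem lift_unique {p : W → V} (hp : IsCovering P Q p) {f g : ℤ × Δ.V → W}
    (hf : IsMorphism Δ.repetition P f) (hg : IsMorphism Δ.repetition P g)
    (hfg : ∀ b, p (f b) = p (g b)) {a : ℤ × Δ.V} (h : f a = g a) : f = g := by
  refine funext fun b => repetition_induction (p := fun a => f a = g a) ?_ ?_ h b
  · intro a
    rw [hf.map_τ, hg.map_τ, P.τ.injective.eq_iff]
  · intro a b hab he
    exact hp.inj (f a) _ _ (hf.map_arrow _ _ hab) (he ▸ hg.map_arrow _ _ hab) (hfg b)

end OrientedTree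

/-! ### Deck transformations -/

namespace StableTranslationQuiver

variable {V W : Type*} {P : StableTranslationQuiver W} {Q : StableTranslationQuiver V}

/-- The deck transformations of `p`: the automorphisms `g` with `p g = p`. -/
def deckGroup (P : StableTranslationQuiver W) (p : W → V) : Subgroup P.aut where
  carrier := {g | ∀ x, p (g • x) = p x}
  mul_mem' {g h} hg hh x := by rw [mul_smul, hg, hh]
  one_mem' x := by rw [one_smul]
  inv_mem' {g} hg x := by rw [← hg, smul_inv_smul]

theorem mem_deckGroup {p : W → V} {g : P.aut} : g ∈ deckGroup P p ↔ ∀ x, p (g • x) = p x :=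
  Iff.rfl

theorem isMorphism_smul (g : P.aut) : IsMorphism P P fun x => g • x :=
  ⟨g.2.2, fun x y h => (g.2.1 x y).2 h⟩

theorem IsMorphism.comp {X : Type*} {R : StableTranslationQuiver X} {p : W → V} {f : X → W}
    (hp : IsMorphism P Q p) (hf : IsMorphism R P f) : IsMorphism R Q (p ∘ f) :=
  ⟨fun x => by simp [hf.map_τ, hp.map_τ], fun x y h => hp.map_arrow _ _ (hf.map_arrow _ _ h)⟩

theorem isMorphism_id : IsMorphism P P id := ⟨fun _ => rfl, fun _ _ => id⟩

theorem Iso.isMorphism (e : P.Iso Q) : IsMorphism P Q e.toEquiv :=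
  ⟨e.map_τ, fun x y h => (e.map_arrow x y).2 h⟩

theorem Iso.isMorphism_symm (e : P.Iso Q) : IsMorphism Q P e.toEquiv.symm :=
  ⟨fun x => by rw [Equiv.symm_apply_eq, e.map_τ, Equiv.apply_symm_apply],
    fun x y h => by rwa [← e.map_arrow, Equiv.apply_symm_apply, Equiv.apply_symm_apply]⟩

/-- The projection to the orbit quiver of a weakly admissible group is a covering. -/
theorem isCovering_mk {G : Subgroup P.aut} (hG : IsWeaklyAdmissible G) :
    IsCovering P (P.orbitQuiver G) (Quotient.mk'' : W → MulAction.orbitRel.Quotient G W) where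
  map_τ _ := rfl
  map_arrow x y h := ⟨x, y, rfl, rfl, h⟩
  lift := by
    rintro x _ ⟨x', y, hx, rfl, h⟩
    obtain ⟨g, hg, rfl, hm⟩ := exists_smul_of_mk_eq hx.symm
    exact ⟨g y, (hg.1 _ _).2 h, hm y⟩
  inj x y y' h h' he := by
    obtain ⟨g, rfl⟩ := MulAction.orbitRel_apply.1 (Quotient.eq''.1 he)
    by_cases h1 : g = 1
    · rw [h1]
      exact one_smul _ _
    · exfalso
      have hg : (g.1)⁻¹ ≠ 1 := fun h2 => h1 (Subtype.ext (inv_eq_one.1 h2))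
      have hempty := hG _ (inv_mem g.2) hg x
      have hmem : y' ∈ P.succ x ∩ P.succ (g.1⁻¹ • x) := by
        refine ⟨h', ?_⟩
        have := (isMorphism_smul g.1⁻¹).map_arrow _ _ h
        change P.Arrow (g.1⁻¹ • x) (g.1⁻¹ • g.1 • y') at this
        rwa [inv_smul_smul] at this
      rw [hempty] at hmem
      exact hmem

theorem IsCovering.comp_iso {X : Type*} {R : StableTranslationQuiver X} {p : W → V}
    (hp : IsCovering P Q p) (e : R.Iso Q) : IsCovering P R (e.toEquiv.symm ∘ p) where
  toIsMorphism := e.isMorphism_symm.comp hp.toIsMorphism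
  lift x z h := by
    rw [← e.map_arrow, Function.comp_apply, Equiv.apply_symm_apply] at h
    obtain ⟨y, hy, he⟩ := hp.lift x _ h
    exact ⟨y, hy, by rw [Function.comp_apply, he, Equiv.symm_apply_apply]⟩
  inj x y y' h h' he := hp.inj x y y' h h' (e.toEquiv.symm.injective he)

end StableTranslationQuiver

namespace OrientedTree

open StableTranslationQuiver

variable {Δ Δ' : OrientedTree} {V : Type*} {Q : StableTranslationQuiver V}

/-- Two coverings of `Q` by repetitions of trees are isomorphic. -/
theorem exists_iso {p : ℤ × Δ.V → V} {p' : ℤ × Δ'.V → V} (hp : IsCovering Δ.repetition Q p)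
    (hp' : IsCovering Δ'.repetition Q p') {a : ℤ × Δ.V} {a' : ℤ × Δ'.V} (h : p a = p' a') :
    ∃ φ : Δ.repetition.Iso Δ'.repetition, (∀ b, p' (φ.toEquiv b) = p b) ∧ φ.toEquiv a = a' := by
  obtain ⟨f, hf, hpf, hfa⟩ := exists_lift hp' hp.toIsMorphism h.symm
  obtain ⟨g, hg, hpg, hga⟩ := exists_lift hp hp'.toIsMorphism h
  have h1 : g ∘ f = id := lift_unique hp (hg.comp hf) isMorphism_id
    (fun b => by simp [hpg, hpf]) (a := a) (by simp [hfa, hga])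
  have h2 : f ∘ g = id := lift_unique hp' (hf.comp hg) isMorphism_id
    (fun b => by simp [hpg, hpf]) (a := a') (by simp [hfa, hga])
  refine ⟨⟨⟨f, g, congrFun h1, congrFun h2⟩, fun x y => ⟨fun hxy => ?_, hf.map_arrow x y⟩,
    hf.map_τ⟩, hpf, hfa⟩
  have h3 := hg.map_arrow _ _ hxy
  have e1 : g (f x) = x := congrFun h1 x
  have e2 : g (f y) = y := congrFun h1 y
  change Δ.repetition.Arrow (g (f x)) (g (f y)) at h3
  rwa [e1, e2] at h3

section Deck

variable {p : ℤ × Δ.V → V} (hp : IsCovering Δ.repetition Q p)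

include hp

theorem eq_of_smul_eq {g h : Δ.repetition.aut} (hgh : ∀ b, p (g • b) = p (h • b)) {a : ℤ × Δ.V}
    (ha : g • a = h • a) : g = h := by
  have := lift_unique hp (isMorphism_smul g) (isMorphism_smul h) hgh ha
  exact Subtype.ext (Equiv.ext (congrFun this))

theorem eq_one_of_mem_deckGroup {g : Δ.repetition.aut} (hg : g ∈ deckGroup Δ.repetition p)
    {a : ℤ × Δ.V} (ha : g • a = a) : g = 1 :=
  eq_of_smul_eq hp (fun b => by rw [hg, one_smul]) (a := a) (by rw [ha, one_smul])

theorem exists_mem_deckGroup {a b : ℤ × Δ.V} (h : p a = p b) :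
    ∃ g ∈ deckGroup Δ.repetition p, g • a = b := by
  obtain ⟨φ, h1, h2⟩ := exists_iso hp hp h
  exact ⟨⟨φ.toEquiv, φ.map_arrow, φ.map_τ⟩, h1, h2⟩

/-- If `x` and `g x` have a common successor `z`, they are equal, as a covering is injective on the
predecessors of `z`. So `g` has a fixed vertex, and `g = 1`. -/
theorem isWeaklyAdmissible_deckGroup : IsWeaklyAdmissible (deckGroup Δ.repetition p) := by
  intro g hg h1 x
  rw [Set.eq_empty_iff_forall_notMem]
  rintro z ⟨hz, hz'⟩
  exact h1 (eq_one_of_mem_deckGroup hp hg (hp.inj_pred hz' hz (hg x)))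

theorem mk_eq_mk_iff (a b : ℤ × Δ.V) :
    (Quotient.mk'' a : MulAction.orbitRel.Quotient (deckGroup Δ.repetition p) (ℤ × Δ.V)) =
      Quotient.mk'' b ↔ p a = p b := by
  constructor
  · intro h
    obtain ⟨g, rfl⟩ := MulAction.orbitRel_apply.1 (Quotient.eq''.1 h)
    exact g.2 b
  · intro h
    obtain ⟨g, hg, rfl⟩ := exists_mem_deckGroup hp h.symm
    exact Quotient.sound' (MulAction.orbitRel_apply.2 ⟨⟨g, hg⟩, rfl⟩)

theorem surjective_of_isCovering {R : ValuedTranslationQuiver V}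
    (hR : R.toStableTranslationQuiver = Q) (hconn : R.IsConnected) : Function.Surjective p := by
  subst hR
  obtain ⟨x⟩ := Δ.isTree.connected.nonempty
  refine fun y => hconn.induction (p := fun y => ∃ a, p a = y) ?_ ?_ ⟨(0, x), rfl⟩ y
  · intro z
    constructor
    · rintro ⟨a, ha⟩
      refine ⟨Δ.repetition.τ.symm a, R.τ.injective ?_⟩
      rw [← hp.map_τ, Equiv.apply_symm_apply, ha]
    · rintro ⟨a, rfl⟩
      exact ⟨_, hp.map_τ a⟩
  · rintro _ z h ⟨a, rfl⟩
    obtain ⟨b, -, hb⟩ := hp.lift a z h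
    exact ⟨b, hb⟩

/-- If `m` has the same fibres as the covering `p`, then the quivers covered by `m` and by `p` are
isomorphic. This applies to the projection `m` to the orbit quiver of the deck group, and to the
identity if the deck group is trivial. -/
theorem nonempty_iso_of_surjective {X : Type*} {R : ValuedTranslationQuiver V}
    (hR : R.toStableTranslationQuiver = Q) (ha : ∀ x y, R.Arrow x y → R.a x y = 1)
    {S : StableTranslationQuiver X} {m : ℤ × Δ.V → X} (hm : Function.Surjective m)
    (hmp : ∀ a b, m a = m b ↔ p a = p b) (hp' : Function.Surjective p)
    (hτ : ∀ a, m (Δ.repetition.τ a) = S.τ (m a))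
    (hA : ∀ a b, S.Arrow (m a) (m b) ↔ ∃ a' b', m a' = m a ∧ m b' = m b ∧
      Δ.repetition.Arrow a' b') : Nonempty (R.Iso S.toValued) := by
  classical
  subst hR
  let e : V ≃ X := Equiv.ofBijective (fun v => m (Function.surjInv hp' v)) (by
    constructor
    · intro v v' h
      have := (hmp _ _).1 h
      rwa [Function.surjInv_eq hp', Function.surjInv_eq hp'] at this
    · intro x
      obtain ⟨a, rfl⟩ := hm x
      exact ⟨p a, (hmp _ _).2 (Function.surjInv_eq hp' _)⟩)
  have he : ∀ a, e (p a) = m a := fun a => (hmp _ _).2 (Function.surjInv_eq hp' _)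
  have hArrow : ∀ x y, S.Arrow (e x) (e y) ↔ R.Arrow x y := by
    intro x y
    obtain ⟨a, rfl⟩ := hp' x
    obtain ⟨b, rfl⟩ := hp' y
    rw [he, he, hA]
    constructor
    · rintro ⟨a', b', h1, h2, h⟩
      rw [← (hmp _ _).1 h1, ← (hmp _ _).1 h2]
      exact hp.map_arrow _ _ h
    · intro h
      obtain ⟨b', hb', hpb⟩ := hp.lift a _ h
      exact ⟨a, b', rfl, (hmp _ _).2 hpb, hb'⟩
  refine ⟨⟨⟨e, hArrow, fun x => ?_⟩, fun x y => ?_⟩⟩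
  · obtain ⟨a, rfl⟩ := hp' x
    have h1 : R.τ (p a) = p (Δ.repetition.τ a) := (hp.map_τ a).symm
    have h2 : e (R.τ (p a)) = S.τ (e (p a)) := by rw [h1, he, he, hτ]
    exact h2
  · change (if S.Arrow (e x) (e y) then 1 else 0) = R.a x y
    rw [hArrow]
    split_ifs with h
    · exact (ha x y h).symm
    · by_contra h0
      exact h ((R.a_pos_iff x y).1 (Nat.pos_of_ne_zero (Ne.symm h0)))

end Deck

/-- A weakly admissible group is the deck group of the projection to its orbit quiver. -/
theorem mem_iff_of_isWeaklyAdmissible {G : Subgroup Δ.repetition.aut} (hG : IsWeaklyAdmissible G)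
    {g : Δ.repetition.aut} : g ∈ G ↔
      ∀ b : ℤ × Δ.V,
        (Quotient.mk'' (g • b) : MulAction.orbitRel.Quotient G (ℤ × Δ.V)) = Quotient.mk'' b := by
  have hmem : ∀ h ∈ G, ∀ b : ℤ × Δ.V,
      (Quotient.mk'' (h • b) : MulAction.orbitRel.Quotient G (ℤ × Δ.V)) = Quotient.mk'' b :=
    fun h hh b => Quotient.sound' (MulAction.orbitRel_apply.2 ⟨⟨h, hh⟩, rfl⟩)
  refine ⟨hmem g, fun h => ?_⟩
  obtain ⟨x⟩ := Δ.isTree.connected.nonempty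
  obtain ⟨k, hk⟩ := MulAction.orbitRel_apply.1 (Quotient.eq''.1 (h (0, x)))
  have := eq_of_smul_eq (isCovering_mk hG) (g := k.1) (h := g)
    (fun b => by rw [hmem _ k.2, h]) (a := (0, x)) hk
  exact this ▸ k.2

/-! ### Uniqueness of the tree -/

theorem graph_adj_of_arrow {a b : ℤ × Δ.V} (h : Δ.repetition.Arrow a b) :
    Δ.graph.Adj a.2 b.2 := by
  rw [graph_adj]
  rcases h with h | h
  · exact Or.inl h.2
  · exact Or.inr h.2

theorem snd_of_isMorphism {f : ℤ × Δ.V → ℤ × Δ'.V}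
    (hf : IsMorphism Δ.repetition Δ'.repetition f) (n : ℤ) (x : Δ.V) :
    (f (n, x)).2 = (f (0, x)).2 := by
  have h : (n, x) = (Δ.repetition.τ ^ (-n)) (0, x) := by
    rw [repetition_zpow_τ, sub_neg_eq_add, zero_add]
  rw [h, hf.map_zpow_τ]
  obtain ⟨m, y⟩ := f (0, x)
  rw [repetition_zpow_τ]

theorem adj_of_isMorphism {f : ℤ × Δ.V → ℤ × Δ'.V}
    (hf : IsMorphism Δ.repetition Δ'.repetition f) {x y : Δ.V} (h : Δ.graph.Adj x y) :
    Δ'.graph.Adj (f (0, x)).2 (f (0, y)).2 := by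
  rcases graph_adj.1 h with h | h
  · exact graph_adj_of_arrow (hf.map_arrow _ _ (arrow_same h))
  · exact (graph_adj_of_arrow (hf.map_arrow _ _ (arrow_same h))).symm

/-- The underlying graph of `Δ` is the graph of `τ`-orbits of `ℤΔ`. -/
theorem nonempty_graph_iso (φ : Δ.repetition.Iso Δ'.repetition) :
    Nonempty (Δ.graph ≃g Δ'.graph) := by
  have h1 := φ.isMorphism
  have h2 := φ.isMorphism_symm
  have e1 : ∀ x, (φ.toEquiv.symm (0, (φ.toEquiv (0, x)).2)).2 = x := fun x => by
    rw [← snd_of_isMorphism h2 (φ.toEquiv (0, x)).1, Prod.mk.eta, Equiv.symm_apply_apply]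
  have e2 : ∀ x, (φ.toEquiv (0, (φ.toEquiv.symm (0, x)).2)).2 = x := fun x => by
    rw [← snd_of_isMorphism h1 (φ.toEquiv.symm (0, x)).1, Prod.mk.eta, Equiv.apply_symm_apply]
  refine ⟨⟨⟨fun x => (φ.toEquiv (0, x)).2, fun x => (φ.toEquiv.symm (0, x)).2, e1, e2⟩, ?_⟩⟩
  intro x y
  refine ⟨fun h => ?_, adj_of_isMorphism h1⟩
  have h3 : Δ.graph.Adj (φ.toEquiv.symm (0, (φ.toEquiv (0, x)).2)).2
      (φ.toEquiv.symm (0, (φ.toEquiv (0, y)).2)).2 := adj_of_isMorphism h2 h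
  rwa [e1, e1] at h3

/-! ### Infinite quivers -/

/-- Let `f` be strictly subadditive on the vertices of a tree. Then any two vertices at which `f` is
maximal are neighbours, as `f` decreases strictly along paths once it does not increase. -/
theorem adj_of_forall_le {G : SimpleGraph Δ.V} (hG : G.Connected) {f : Δ.V → ℕ}
    (hf : ∀ x y z, G.Adj x y → G.Adj x z → y ≠ z → f y + f z + 1 ≤ 2 * f x) {x y : Δ.V}
    (hx : ∀ z, f z ≤ f x) (hy : f y = f x) (hxy : x ≠ y) : G.Adj x y := by
  have key : ∀ {a c : Δ.V} (q : G.Walk a c), q.IsPath → ∀ b, G.Adj b a → b ∉ q.support →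
      f a ≤ f b → c = a ∨ f c < f b := by
    intro a c q
    induction q with
    | nil => exact fun _ _ _ _ _ => Or.inl rfl
    | @cons a a' c h q ih =>
      intro hq b hba hb hle
      rw [SimpleGraph.Walk.cons_isPath_iff] at hq
      have hne : b ≠ a' := fun he => hb (by simp [he])
      have h1 := hf a b a' hba.symm h hne
      rcases ih hq.1 a h hq.2 (by omega) with h2 | h2
      · right
        rw [h2]
        omega
      · right
        omega
  obtain ⟨q, hq⟩ := (hG x y).exists_isPath
  cases q with
  | nil => exact (hxy rfl).elim
  | @cons _ a _ h q =>
    rw [SimpleGraph.Walk.cons_isPath_iff] at hq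
    rcases key q hq.1 x h hq.2 (hx a) with h1 | h1
    · rwa [h1]
    · omega

/-- Let `Δ` be finite and suppose that no vertex of `Q` is `τ`-periodic. A deck transformation `g`
permutes the vertices of `Δ` at which the subadditive function is maximal, and there are at most two
of them, which are then neighbours. If `g` fixes one of them, then it moves a vertex `(0, x)` of
`ℤΔ` by a power of `τ`, which is trivial by assumption, so that `g = 1`. If `g` interchanged two of
them, its square would move `(0, x)` by an odd power of `τ`, a contradiction. -/
theorem deckGroup_eq_bot {Q : ValuedTranslationQuiver V} {p : ℤ × Δ.V → V}
    (hp : IsCovering Δ.repetition Q.toStableTranslationQuiver p) [Finite Δ.V] {F : V → ℕ}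
    (hF : Q.IsSubadditive F) (hτ : ∀ (x : V) (n : ℤ), (Q.τ ^ n) x = x → n = 0) :
    deckGroup Δ.repetition p = ⊥ := by
  have := Δ.isTree.connected.nonempty
  have hpn : ∀ n x, p (n, x) = (Q.τ ^ (-n)) (p (0, x)) := by
    intro n x
    rw [← hp.map_zpow_τ, repetition_zpow_τ, sub_neg_eq_add, zero_add]
  have hFz : ∀ (n : ℤ) x, F ((Q.τ ^ n) x) = F x := by
    intro n x
    induction n generalizing x with
    | zero => rfl
    | succ n ih => rw [zpow_add_one, Equiv.Perm.mul_apply, ih, hF.τ]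
    | pred n ih =>
      rw [zpow_sub_one, Equiv.Perm.mul_apply, ih]
      exact hF.symm_τ x
  set f : Δ.V → ℕ := fun x => F (p (0, x)) with hfdef
  have hfp : ∀ n x, F (p (n, x)) = f x := fun n x => by rw [hpn, hFz]
  have hf : ∀ x y z, Δ.graph.Adj x y → Δ.graph.Adj x z → y ≠ z → f y + f z + 1 ≤ 2 * f x := by
    have hsucc : ∀ x y, Δ.graph.Adj x y → ∃ n, Δ.repetition.Arrow (0, x) (n, y) := by
      intro x y h
      rcases graph_adj.1 h with h | h
      · exact ⟨0, arrow_same h⟩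
      · exact ⟨0 + 1, arrow_next h⟩
    intro x y z hy hz hyz
    obtain ⟨n, hn⟩ := hsucc x y hy
    obtain ⟨m, hm⟩ := hsucc x z hz
    rw [← hfp n y, ← hfp m z]
    exact hF.two_succ_lt (hp.map_arrow _ _ hn) (hp.map_arrow _ _ hm) fun h =>
      hyz (congrArg Prod.snd (hp.inj _ _ _ hn hm h))
  obtain ⟨x, hx⟩ := Finite.exists_max f
  have hadj : ∀ y, f y = f x → x ≠ y → Δ.graph.Adj x y := fun y hy hxy =>
    adj_of_forall_le Δ.isTree.connected hf hx hy hxy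
  rw [Subgroup.eq_bot_iff_forall]
  intro g hg
  have hgf : ∀ x, f (g • ((0 : ℤ), x)).2 = f x := fun x => by
    rw [← hfp (g • ((0 : ℤ), x)).1, Prod.mk.eta, hg]
  have hgn : ∀ (n : ℤ) (x : Δ.V), g • (n, x) =
      ((g • ((0 : ℤ), x)).1 + n, (g • ((0 : ℤ), x)).2) := by
    intro n x
    have h := (isMorphism_smul g).map_zpow_τ (-n) (0, x)
    rw [repetition_zpow_τ, sub_neg_eq_add, zero_add] at h
    rw [h]
    exact (repetition_zpow_τ (-n) _ _).trans (by rw [sub_neg_eq_add]; rfl)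
  obtain ⟨c, y, hcy⟩ : ∃ c y, g • ((0 : ℤ), x) = (c, y) := ⟨_, _, rfl⟩
  obtain ⟨c', z, hcz⟩ : ∃ c' z, g • ((0 : ℤ), y) = (c', z) := ⟨_, _, rfl⟩
  have hy : f y = f x := by rw [← hgf x, hcy]
  have hz : f z = f x := by rw [← hy, ← hgf y, hcz]
  by_cases hxy : x = y
  · subst hxy
    have h1 := hg (0, x)
    rw [hcy, hpn] at h1
    have h2 : c = 0 := by simpa using hτ _ _ h1
    exact eq_one_of_mem_deckGroup hp hg (by rw [hcy, h2])
  · exfalso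
    have hA := hadj y hy hxy
    have hyz : y ≠ z := by
      rintro rfl
      have h1 := hgn (c' - c) x
      rw [hcy] at h1
      have h2 : g • ((c' - c : ℤ), x) = g • ((0 : ℤ), y) := by
        rw [h1, hcz]
        simp
      exact hxy (congrArg Prod.snd (smul_left_cancel g h2))
    obtain rfl : x = z := by
      by_contra hxz
      have h1 := hf x y z hA (hadj z hz hxz) hyz
      omega
    have h1 : g • ((c : ℤ), y) = (c' + c, x) := by rw [hgn, hcz]
    have h2 : p (c' + c, x) = p (0, x) := by rw [← h1, hg, ← hcy, hg]
    rw [hpn] at h2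
    have h3 := hτ _ _ h2
    rcases graph_adj.1 hA with h | h
    · have h4 := (isMorphism_smul g).map_arrow _ _ (arrow_same (n := 0) h)
      simp only [hcy, hcz] at h4
      rcases h4 with h4 | ⟨h4, -⟩
      · exact Δ.asymm _ _ h h4.2
      · simp only at h4
        omega
    · have h4 := (isMorphism_smul g).map_arrow _ _ (arrow_same (n := 0) h)
      simp only [hcy, hcz] at h4
      rcases h4 with h4 | ⟨h4, -⟩
      · exact Δ.asymm _ _ h h4.2
      · simp only at h4
        omega

end OrientedTree

/-! ### Components -/

namespace ValuedTranslationQuiver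

variable {V : Type u} {Q : ValuedTranslationQuiver V}

theorem Component.nonempty_vertex (c : Q.Component) : Nonempty c.Vertex := by
  obtain ⟨x, hx⟩ := Quotient.exists_rep c
  exact ⟨⟨x, hx⟩⟩

theorem Component.isConnected (c : Q.Component) : c.quiver.IsConnected := by
  have key : ∀ x y, Relation.EqvGen (fun x y => Q.Arrow x y ∨ Q.τ x = y) x y →
      ∀ (hx : Quotient.mk Q.connectedSetoid x = c) (hy : Quotient.mk Q.connectedSetoid y = c),
        c.quiver.connectedSetoid ⟨x, hx⟩ ⟨y, hy⟩ := by
    intro x y h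
    induction h with
    | rel x y h =>
      intro hx hy
      exact Relation.EqvGen.rel _ _ (h.imp id fun h => Subtype.ext h)
    | refl => exact fun _ _ => Relation.EqvGen.refl _
    | symm _ _ _ ih => exact fun hx hy => Relation.EqvGen.symm _ _ (ih hy hx)
    | trans x y z h1 _ ih1 ih2 =>
      intro hx hz
      have hy : Quotient.mk Q.connectedSetoid y = c := by
        rw [← hx]
        exact (_root_.Quotient.sound (s := Q.connectedSetoid) h1).symm
      exact Relation.EqvGen.trans _ _ _ (ih1 hx hy) (ih2 hy hz)
  rintro ⟨x, hx⟩ ⟨y, hy⟩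
  exact key x y (Quotient.exact (hx.trans hy.symm)) hx hy

theorem Component.isHomDim (c : Q.Component) {u : c.Vertex} {φ : V → ℕ} (h : Q.IsHomDim u.1 φ) :
    c.quiver.IsHomDim u fun x => φ x.1 := by
  refine ⟨h.1.preimage Subtype.val_injective.injOn, fun y s => ?_⟩
  let i : c.Vertex ↪ V := ⟨fun x => x.1, fun _ _ => Subtype.ext⟩
  have h1 := h.2 y.1 (s.map i)
  have e : ∑ x ∈ s.map i, Q.a x y.1 * φ x = ∑ x ∈ s, Q.a x.1 y.1 * φ x.1 := Finset.sum_map ..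
  rw [e] at h1
  exact ⟨h1.1, fun hy => h1.2 (congrArg Subtype.val hy)⟩

end ValuedTranslationQuiver

open StableTranslationQuiver in
/-- The structure theorem for a connected valued translation quiver with functions that behave like
the functions `dim Hom(u, -)` on the Auslander–Reiten quiver. The group is the deck group of the
covering that extends a Dynkin slice, and uniqueness holds because `ℤΔ` is simply connected. -/
theorem ValuedTranslationQuiver.exists_iso_orbitQuiver {V : Type u} [Nonempty V]
    {Q : ValuedTranslationQuiver V} (hQ : Q.IsConnected) (hdim : ∀ u, ∃ φ, Q.IsHomDim u φ) :
    ∃ (Δ : OrientedTree) (G : Subgroup Δ.repetition.aut),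
      Δ.IsDynkin ∧ IsWeaklyAdmissible G ∧
      Nonempty (Q.Iso (Δ.repetition.orbitQuiver G).toValued) ∧
      (∀ (Δ' : OrientedTree) (G' : Subgroup Δ'.repetition.aut),
        IsWeaklyAdmissible G' → Nonempty (Q.Iso (Δ'.repetition.orbitQuiver G').toValued) →
        Nonempty (Δ.graph ≃g Δ'.graph) ∧
        ∃ φ : Δ.repetition.Iso Δ'.repetition,
          ∀ g' : Δ'.repetition.aut, g' ∈ G' ↔
            ∃ g ∈ G, ∀ a : ℤ × Δ.V, g' • φ.toEquiv a = φ.toEquiv (g • a)) ∧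
      (Infinite V → G = ⊥ ∧ Nonempty (Q.Iso Δ.repetition.toValued)) := by
  obtain ⟨F, hF⟩ := exists_isSubadditive hQ hdim
  obtain ⟨Δ, π, hΔ, hπ⟩ := hF.exists_dynkin_slice
  have hfin := hΔ.finite
  have hp := OrientedTree.isCovering_of_isSlice hπ
  set p : ℤ × Δ.V → V := fun a => (Q.τ ^ (-a.1)) (π a.2)
  have hsurj := OrientedTree.surjective_of_isCovering hp rfl hQ
  refine ⟨Δ, deckGroup Δ.repetition p, hΔ, OrientedTree.isWeaklyAdmissible_deckGroup hp, ?_, ?_, ?_⟩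
  · exact OrientedTree.nonempty_iso_of_surjective hp rfl (fun _ _ => hF.a_eq_one)
      Quotient.mk''_surjective (OrientedTree.mk_eq_mk_iff hp) hsurj (fun _ => rfl)
      (fun _ _ => Iff.rfl)
  · rintro Δ' G' hG' ⟨e⟩
    have hp' := (isCovering_mk hG').comp_iso e.toIso
    obtain ⟨x⟩ := Δ'.isTree.connected.nonempty
    obtain ⟨a, ha⟩ := hsurj ((e.toIso.toEquiv.symm ∘ Quotient.mk'') ((0 : ℤ), x))
    obtain ⟨φ, hφ, -⟩ := OrientedTree.exists_iso hp hp' ha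
    refine ⟨OrientedTree.nonempty_graph_iso φ, φ, fun g' => ?_⟩
    have hmem : g' ∈ G' ↔ g' ∈ deckGroup Δ'.repetition
        (e.toIso.toEquiv.symm ∘
          (Quotient.mk'' : _ → MulAction.orbitRel.Quotient G' (ℤ × Δ'.V))) := by
      rw [OrientedTree.mem_iff_of_isWeaklyAdmissible hG', mem_deckGroup]
      exact forall_congr' fun b => e.toIso.toEquiv.symm.injective.eq_iff.symm
    rw [hmem, mem_deckGroup]
    constructor
    · intro h
      let σ : Equiv.Perm (ℤ × Δ.V) := (φ.toEquiv.trans g'.1).trans φ.toEquiv.symm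
      have hσ : σ ∈ Δ.repetition.aut := by
        refine ⟨fun x y => ?_, ?_⟩
        · rw [← φ.map_arrow, ← φ.map_arrow x y]
          simp only [σ, Equiv.trans_apply, Equiv.apply_symm_apply]
          exact g'.2.1 _ _
        · exact (φ.isMorphism_symm.comp ((isMorphism_smul g').comp φ.isMorphism)).map_τ
      refine ⟨⟨σ, hσ⟩, fun b => ?_, fun b => ?_⟩
      · change p (φ.toEquiv.symm (g' • φ.toEquiv b)) = p b
        rw [← hφ, Equiv.apply_symm_apply, h, hφ]
      · change _ = φ.toEquiv (φ.toEquiv.symm (g' • φ.toEquiv b))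
        rw [Equiv.apply_symm_apply]
    · rintro ⟨g, hg, h⟩ b
      obtain ⟨b, rfl⟩ := φ.toEquiv.surjective b
      rw [h, hφ, hφ, hg]
  · intro hV
    obtain ⟨u⟩ := ‹Nonempty V›
    obtain ⟨φ, hφ⟩ := hdim u
    have hbot := OrientedTree.deckGroup_eq_bot hp hF fun x n h => hφ.eq_zero_of_zpow_apply_eq hQ h
    refine ⟨hbot, OrientedTree.nonempty_iso_of_surjective hp rfl (fun _ _ => hF.a_eq_one)
      Function.surjective_id (fun a b => ?_) hsurj (fun _ => rfl) (fun a b => ?_)⟩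
    · refine ⟨fun h => congrArg p h, fun h => ?_⟩
      obtain ⟨g, hg, rfl⟩ := OrientedTree.exists_mem_deckGroup hp h
      rw [hbot, Subgroup.mem_bot] at hg
      rw [hg, one_smul]
    · exact ⟨fun h => ⟨a, b, rfl, rfl, h⟩, fun ⟨_, _, h1, h2, h⟩ => by cases h1; cases h2; exact h⟩

theorem theorem4p0p1
    (k : Type w) [Field k] [IsAlgClosed k]
    (T : Type u) [Category.{v} T] [Preadditive T] [Linear k T] [HasZeroObject T] [HasShift T ℤ]
    [∀ n : ℤ, (shiftFunctor T n).Additive] [∀ n : ℤ, (shiftFunctor T n).Linear k]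
    [Pretriangulated T] [IsTriangulated T]
    (hom_finite : ∀ X Y : T, FiniteDimensional k (X ⟶ Y))
    (krull_schmidt : AuslanderReiten.IsKrullSchmidt T)
    (locally_finite : AuslanderReiten.IsLocallyFinite T) :
    ∃ Γ : ValuedTranslationQuiver (AuslanderReiten.IndecClass T),
      AuslanderReiten.IsARQuiver k Γ ∧
      ∀ c : Γ.Component,
        ∃ (Δ : OrientedTree) (G : Subgroup Δ.repetition.aut),
          Δ.IsDynkin ∧
          StableTranslationQuiver.IsWeaklyAdmissible G ∧
          Nonempty (c.quiver.Iso (Δ.repetition.orbitQuiver G).toValued) ∧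
          (∀ (Δ' : OrientedTree) (G' : Subgroup Δ'.repetition.aut),
            Δ'.IsDynkin →
            StableTranslationQuiver.IsWeaklyAdmissible G' →
            Nonempty (c.quiver.Iso (Δ'.repetition.orbitQuiver G').toValued) →
            Nonempty (Δ.graph ≃g Δ'.graph) ∧
            ∃ φ : Δ.repetition.Iso Δ'.repetition,
              ∀ g' : Δ'.repetition.aut, g' ∈ G' ↔
                ∃ g ∈ G, ∀ p : ℤ × Δ.V, g' • φ.toEquiv p = φ.toEquiv (g • p)) ∧
          (Infinite c.Vertex →
            G = ⊥ ∧ Nonempty (c.quiver.Iso Δ.repetition.toValued)) := by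
  obtain ⟨Γ, hΓ, hdim⟩ := AuslanderReiten.exists_arQuiver hom_finite krull_schmidt locally_finite
  refine ⟨Γ, hΓ, fun c => ?_⟩
  have := c.nonempty_vertex
  obtain ⟨Δ, G, h1, h2, h3, h4, h5⟩ := ValuedTranslationQuiver.exists_iso_orbitQuiver
    c.isConnected fun u => (hdim u.1).imp' _ fun φ hφ => c.isHomDim (u := u) hφ
  exact ⟨Δ, G, h1, h2, h3, fun Δ' G' _ hG' h => h4 Δ' G' hG' h, h5⟩
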